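/- Let $n,K\ge 1$ be integers, $0=\tau_0<\tau_1<\dots<\tau_K$, $A_0,\dots,A_K\in\mathbb R^{n\times n}$, and consider the delay system $$\dot x(t)=A_0x(t)+\sum_{i=1}^K A_i x(t-\tau_i)\quad(t\ge 0),\qquad x=\phi\in\mathcal C([-\tau_K,0],\mathbb R^n)\ \text{ on }[-\tau_K,0]. \tag{1}$$ It is *exponentially stable* if there are $C,\alpha>0$ with $\|x(t)\|\le Ce^{-\alpha t}\sup_{[-\tau_K,0]}\|\phi\|$ for all $t\ge0$, all $\phi$ and all solutions $x$. Write $[K]=\{1,\dots,K\}$. Functions in $W_2$ are continuous functions with weak first (partial) derivatives in $L_2$; multipliers and kernels on $[-\tau_K,0]$ are identified when they agree almost everywhere. **The map $\mathcal L_1$.** Put $a_i=(\tau_i-\tau_{i-1})/\tau_i$ and $\sigma_i(s)=(s+\tau_{i-1})/a_i$, which maps $[-\tau_i,-\tau_{i-1}]$ onto $[-\tau_i,0]$. Then $\{M,N\}=\mathcal L_1(P,Q_i,S_i,R_{ij})$ is defined by $$M(s)=\begin{bmatrix}P&\frac{\tau_K}{a_i}Q_i(\sigma_i(s))\\ \frac{\tau_K}{a_i}Q_i(\sigma_i(s))^T&\frac{\tau_K}{a_i}S_i(\sigma_i(s))\end{bmatrix},\qquad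 N(s,\theta)=\frac1{a_ia_j}R_{ij}(\sigma_i(s),\sigma_j(\theta))$$ for $s\in[-\tau_i,-\tau_{i-1}]$, $\theta\in[-\tau_j,-\tau_{j-1}]$. **The cone $\Xi_{d,q,K}$.** Let $J(s)\in\mathbb R^K$ be the vector of indicator functions of the intervals $[-\tau_i,-\tau_{i-1}]$, let $Y_d(s)$ and $Y_d(s,\theta)$ be the vectors of monomials of total degree at most $d$, and let $Y_1(s)=Y_d(s)\otimes I_q\otimes J(s)$, $Y_2(s,\theta)=Y_d(s,\theta)\otimes I_q\otimes J(s)\otimes J(\theta)$. For a weight $g$, say that $\{M,N\}$ ($q\times q$ matrix-valued) is generated by $g$ if, for some real positive semidefinite matrix $\begin{bmatrix}Q_{11}&Q_{12}\\Q_{12}^T&Q_{22}\end{bmatrix}$, $M(s)=g(s)Y_1(s)^TQ_{11}Y_1(s)$ and $$N(s,\theta)=g(s)Y_1(s)^TQ_{12}Y_2(s,\theta)+g(\theta)Y_2(\theta,s)^TQ_{12}^TY_1(\theta)+\int_{-\tau_K}^0 g(\omega)Y_2(\omega,s)^TQ_{22}Y_2(\omega,\theta)\,d\omega .$$ $\Xi_{d,q,K}$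 is the set of sums $\{M_1+M_2,N_1+N_2\}$ with $\{M_1,N_1\}$ generated by $g=1$ and $\{M_2,N_2\}$ generated by the weight $g$ equal to $-(s+\tau_i)(s+\tau_{i-1})$ on $[-\tau_i,-\tau_{i-1}]$ for each $i\in[K]$. **The spacing pairs $\Theta_{m,q,K}$.** $\{F,H\}\in\Theta_{m,q,K}$ means that there are square-integrable $T(s)\in\mathbb R^{m\times m}$ with $\int_{-\tau_K}^0T(s)\,ds=0$, and square-integrable $L_{11}(s,\theta)\in\mathbb R^{m\times m}$, $L_{12}(s,\theta)\in\mathbb R^{m\times q}$, $L_{21}(s,\theta)\in\mathbb R^{q\times m}$ with $$F(s)=\begin{bmatrix}T(s)+\frac1{\tau_K}\int_{-\tau_K}^0\!\int_{-\tau_K}^0L_{11}(\omega,t)\,d\omega\,dt&\int_{-\tau_K}^0L_{12}(\omega,s)\,d\omega\\ \int_{-\tau_K}^0L_{21}(s,\omega)\,d\omega&0\end{bmatrix},\quad H(s,\theta)=-\begin{bmatrix}L_{11}(s,\theta)&L_{12}(s,\theta)\\L_{21}(s,\theta)&0\end{bmatrix}.$$ **Theorem.** Suppose there exist $d\in\mathbb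 N$, $\epsilon>0$, $P\in\mathbb R^{n\times n}$, $Q_i,S_i\in W_2^{n\times n}[-\tau_i,0]$, $R_{ij}\in W_2^{n\times n}([-\tau_i,0]\times[-\tau_j,0])$ ($i,j\in[K]$), $\{F_1,H_1\}\in\Theta_{n,n,K}$ and $\{F_2,H_2\}\in\Theta_{n(K+1),n,K}$ such that, for all $i,j\in[K]$ and all $s,\theta$ in the respective domains, $$P=\tau_KQ_i(0)^T+\tau_KS_i(0),\quad S_i(s)=S_i(s)^T,\quad R_{ij}(s,\theta)=R_{ji}(\theta,s)^T,\quad Q_j(s)=R_{ij}(0,s),$$ and such that $$\{M,N\}\in\Xi_{d,2n,K}\qquad\text{and}\qquad\{-D,-E\}\in\Xi_{d,n(K+2),K},$$ where, with $\{M_0,N_0\}=\mathcal L_1(P-\epsilon I_n,Q_i,S_i-\epsilon I_n,R_{ij})$ and $\{D_0,E_0\}=\mathcal L_1(D_1,V_i,\dot S_i+\epsilon I_n,G_{ij})$, $$M=M_0+F_1-\epsilon I_{2n},\quad N=\begin{bmatrix}0&0\\0&N_0\end{bmatrix}+H_1,\quad D=D_0+F_2,\quad E=\begin{bmatrix}0&0\\0&E_0\end{bmatrix}+H_2,$$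 $$D_1=\begin{bmatrix}C_0+C_0^T+\epsilon I_n&C_1&\cdots&C_K\\C_1^T&-S_1(-\tau_1)&&0\\\vdots&&\ddots&\\C_K^T&0&&-S_K(-\tau_K)\end{bmatrix},\qquad V_i(s)=\begin{bmatrix}B_i(s)\\0\\\vdots\\0\end{bmatrix}\in\mathbb R^{n(K+1)\times n},$$ $$C_0=A_0P+\sum_{i=1}^K\big(\tau_KA_iQ_i(-\tau_i)^T+\tfrac12S_i(0)\big),\qquad C_i=\tau_KA_iS_i(-\tau_i),$$ $$B_i(s)=A_0Q_i(s)+\dot Q_i(s)+\sum_{j=1}^KA_jR_{ji}(-\tau_j,s),\qquad G_{ij}(s,\theta)=\frac{\partial R_{ij}}{\partial s}(s,\theta)+\frac{\partial R_{ij}}{\partial\theta}(s,\theta).$$ Then the system (1) is exponentially stable. -/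

import Mathlib

open MeasureTheory Set
open scoped Matrix ContDiff

noncomputable section

namespace DelayLMI

/-! ### The delay system and its exponential stability

Delays are indexed by `τ : Fin (K + 1) → ℝ` with `τ 0 = 0`; for `i : Fin K` the delay with
(one-based) number `i + 1` is `τ i.succ` and its predecessor is `τ i.castSucc`.
The largest delay is `τ (Fin.last K)`. -/

/-- `x` solves `x'(t) = A₀ x(t) + ∑ᵢ Aᵢ x(t - τᵢ)` for `t ≥ 0` (one-sided derivative at `t = 0`)
with continuous initial segment `φ` on `[-τ_K, 0]`. -/
def IsSolution {n K : ℕ} (τ : Fin (K + 1) → ℝ) (A₀ : Matrix (Fin n) (Fin n) ℝ)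
    (A : Fin K → Matrix (Fin n) (Fin n) ℝ)
    (φ : C(Icc (-τ (Fin.last K)) (0 : ℝ), EuclideanSpace ℝ (Fin n)))
    (x : ℝ → EuclideanSpace ℝ (Fin n)) : Prop :=
  ContinuousOn x (Ici (-τ (Fin.last K))) ∧
  (∀ s : Icc (-τ (Fin.last K)) (0 : ℝ), x s = φ s) ∧
  ∀ t : ℝ, 0 ≤ t →
    HasDerivWithinAt x
      (WithLp.toLp 2 (A₀ *ᵥ (x t).ofLp + ∑ i : Fin K, A i *ᵥ (x (t - τ i.succ)).ofLp))
      (Ici 0) t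

/-- Exponential stability of the delay system: uniform exponential decay of all solutions,
relative to the supremum norm of the initial segment. -/
def ExponentiallyStable {n K : ℕ} (τ : Fin (K + 1) → ℝ) (A₀ : Matrix (Fin n) (Fin n) ℝ)
    (A : Fin K → Matrix (Fin n) (Fin n) ℝ) : Prop :=
  ∃ C : ℝ, 0 < C ∧ ∃ α : ℝ, 0 < α ∧
    ∀ (φ : C(Icc (-τ (Fin.last K)) (0 : ℝ), EuclideanSpace ℝ (Fin n)))
      (x : ℝ → EuclideanSpace ℝ (Fin n)), IsSolution τ A₀ A φ x →
      ∀ t : ℝ, 0 ≤ t → ‖x t‖ ≤ C * Real.exp (-α * t) * ‖φ‖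

/-! ### Sobolev functions on intervals and rectangles -/

/-- `g` is a weak derivative of `f` on the open set `U` in the direction `v`. -/
def IsWeakDeriv {E : Type*} [NormedAddCommGroup E] [NormedSpace ℝ E] [MeasureSpace E]
    (U : Set E) (v : E) (f g : E → ℝ) : Prop :=
  ∀ ψ : E → ℝ, ContDiff ℝ ∞ ψ → HasCompactSupport ψ → tsupport ψ ⊆ U →
    ∫ x in U, f x * fderiv ℝ ψ x v = - ∫ x in U, g x * ψ x

/-- `f ∈ W₂[-r, 0]` (matrix-valued, continuous representative), with weak derivative `f'`. -/
def MemW2Interval {μ ν : Type*} (r : ℝ) (f f' : ℝ → Matrix μ ν ℝ) : Prop :=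
  ∀ a b,
    ContinuousOn (fun s => f s a b) (Icc (-r) 0) ∧
    MemLp (fun s => f' s a b) 2 (volume.restrict (Icc (-r) 0)) ∧
    IsWeakDeriv (Ioo (-r) 0) 1 (fun s => f s a b) (fun s => f' s a b)

/-- `R ∈ W₂([-r₁, 0] × [-r₂, 0])` (matrix-valued, continuous representative), with weak partial
derivatives `R₁` in the first and `R₂` in the second variable. -/
def MemW2Rect {μ ν : Type*} (r₁ r₂ : ℝ) (R R₁ R₂ : ℝ → ℝ → Matrix μ ν ℝ) : Prop :=
  ∀ a b,
    ContinuousOn (fun p : ℝ × ℝ => R p.1 p.2 a b) (Icc (-r₁) 0 ×ˢ Icc (-r₂) 0) ∧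
    MemLp (fun p : ℝ × ℝ => R₁ p.1 p.2 a b) 2
      (volume.restrict (Icc (-r₁) 0 ×ˢ Icc (-r₂) 0)) ∧
    MemLp (fun p : ℝ × ℝ => R₂ p.1 p.2 a b) 2
      (volume.restrict (Icc (-r₁) 0 ×ˢ Icc (-r₂) 0)) ∧
    IsWeakDeriv (Ioo (-r₁) 0 ×ˢ Ioo (-r₂) 0) ((1, 0) : ℝ × ℝ)
      (fun p => R p.1 p.2 a b) (fun p => R₁ p.1 p.2 a b) ∧
    IsWeakDeriv (Ioo (-r₁) 0 ×ˢ Ioo (-r₂) 0) ((0, 1) : ℝ × ℝ)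
      (fun p => R p.1 p.2 a b) (fun p => R₂ p.1 p.2 a b)

/-! ### Multipliers and kernels on `[-τ_K, 0]`

Multipliers and kernels are functions defined up to null sets, so the values chosen at the finitely
many break points `-τᵢ` do not matter. -/

/-- The `i`-th subinterval `[-τᵢ, -τᵢ₋₁]`, up to an end point, so that the pieces are disjoint. -/
def piece {K : ℕ} (τ : Fin (K + 1) → ℝ) (i : Fin K) : Set ℝ :=
  Ioc (-τ i.succ) (-τ i.castSucc)

/-- `aᵢ = (τᵢ - τᵢ₋₁) / τᵢ`. -/
def scale {K : ℕ} (τ : Fin (K + 1) → ℝ) (i : Fin K) : ℝ :=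
  (τ i.succ - τ i.castSucc) / τ i.succ

/-- The affine map `s ↦ (s + τᵢ₋₁) / aᵢ` of `[-τᵢ, -τᵢ₋₁]` onto `[-τᵢ, 0]`. -/
def stretch {K : ℕ} (τ : Fin (K + 1) → ℝ) (i : Fin K) (s : ℝ) : ℝ :=
  (s + τ i.castSucc) / scale τ i

/-- The multiplier `M` of `{M, N} = 𝓛₁(P, Qᵢ, Sᵢ, Rᵢⱼ)`. -/
def L1mult {K : ℕ} {μ ν : Type*} (τ : Fin (K + 1) → ℝ) (P : Matrix μ μ ℝ)
    (Q : Fin K → ℝ → Matrix μ ν ℝ) (S : Fin K → ℝ → Matrix ν ν ℝ) (s : ℝ) :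
    Matrix (μ ⊕ ν) (μ ⊕ ν) ℝ :=
  ∑ i : Fin K, (piece τ i).indicator (fun s =>
    Matrix.fromBlocks P ((τ (Fin.last K) / scale τ i) • Q i (stretch τ i s))
      ((τ (Fin.last K) / scale τ i) • (Q i (stretch τ i s))ᵀ)
      ((τ (Fin.last K) / scale τ i) • S i (stretch τ i s))) s

/-- The kernel `N` of `{M, N} = 𝓛₁(P, Qᵢ, Sᵢ, Rᵢⱼ)`. The factor `1 / (aᵢ aⱼ)` is the Jacobian of
the change of variables in both arguments. -/
def L1ker {K : ℕ} {ν : Type*} (τ : Fin (K + 1) → ℝ)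
    (R : Fin K → Fin K → ℝ → ℝ → Matrix ν ν ℝ) (s θ : ℝ) : Matrix ν ν ℝ :=
  ∑ i : Fin K, ∑ j : Fin K, (piece τ i ×ˢ piece τ j).indicator (fun p : ℝ × ℝ =>
    (1 / (scale τ i * scale τ j)) • R i j (stretch τ i p.1) (stretch τ j p.2)) (s, θ)

/-! ### The cone `Ξ` of sum-of-squares multiplier-kernel pairs -/

/-- Exponents of the monomials `s ^ a * θ ^ b` of total degree at most `d`. -/
abbrev Mon (d : ℕ) : Type :=
  {p : Fin (d + 1) × Fin (d + 1) // (p.1 : ℕ) + (p.2 : ℕ) ≤ d}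

/-- `Y₁(s) = Y_d(s) ⊗ I ⊗ J(s)`, with `Y_d` the vector of monomials of degree at most `d` and
`J` the vector of indicator functions of the pieces. -/
def Y1 {K : ℕ} (τ : Fin (K + 1) → ℝ) (d : ℕ) (ν : Type*) [DecidableEq ν] (s : ℝ) :
    Matrix ((Fin (d + 1) × ν) × Fin K) ν ℝ :=
  Matrix.of fun r c =>
    s ^ (r.1.1 : ℕ) * (1 : Matrix ν ν ℝ) r.1.2 c * (piece τ r.2).indicator 1 s

/-- `Y₂(s, θ) = Y_d(s, θ) ⊗ I ⊗ J(s) ⊗ J(θ)`. -/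
def Y2 {K : ℕ} (τ : Fin (K + 1) → ℝ) (d : ℕ) (ν : Type*) [DecidableEq ν] (s θ : ℝ) :
    Matrix (((Mon d × ν) × Fin K) × Fin K) ν ℝ :=
  Matrix.of fun r c =>
    s ^ (r.1.1.1.1.1 : ℕ) * θ ^ (r.1.1.1.1.2 : ℕ) * (1 : Matrix ν ν ℝ) r.1.1.2 c *
      (piece τ r.1.2).indicator 1 s * (piece τ r.2).indicator 1 θ

/-- `{M, N}` is generated by a positive semidefinite matrix `[Q₁₁, Q₁₂; Q₁₂ᵀ, Q₂₂]`, the bases `Y₁`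
and `Y₂` and the weight `g`. -/
def SOSPair {K : ℕ} (τ : Fin (K + 1) → ℝ) (d : ℕ) {ν : Type*} [Fintype ν] [DecidableEq ν]
    (g : ℝ → ℝ) (M : ℝ → Matrix ν ν ℝ) (N : ℝ → ℝ → Matrix ν ν ℝ) : Prop :=
  ∃ (Q₁₁ : Matrix ((Fin (d + 1) × ν) × Fin K) ((Fin (d + 1) × ν) × Fin K) ℝ)
    (Q₁₂ : Matrix ((Fin (d + 1) × ν) × Fin K) (((Mon d × ν) × Fin K) × Fin K) ℝ)
    (Q₂₂ : Matrix (((Mon d × ν) × Fin K) × Fin K) (((Mon d × ν) × Fin K) × Fin K) ℝ),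
    (Matrix.fromBlocks Q₁₁ Q₁₂ Q₁₂ᵀ Q₂₂).PosSemidef ∧
    (∀ s, M s = g s • ((Y1 τ d ν s)ᵀ * Q₁₁ * Y1 τ d ν s)) ∧
    (∀ s θ, N s θ =
      g s • ((Y1 τ d ν s)ᵀ * Q₁₂ * Y2 τ d ν s θ) +
      g θ • ((Y2 τ d ν θ s)ᵀ * Q₁₂ᵀ * Y1 τ d ν θ) +
      Matrix.of fun a b => ∫ u in Icc (-τ (Fin.last K)) 0,
        g u * ((Y2 τ d ν u s)ᵀ * Q₂₂ * Y2 τ d ν u θ) a b)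

/-- The piecewise weight `gᵢ(s) = -(s + τᵢ) (s + τᵢ₋₁)` on `[-τᵢ, -τᵢ₋₁]`. -/
def bump {K : ℕ} (τ : Fin (K + 1) → ℝ) (s : ℝ) : ℝ :=
  ∑ i : Fin K, (piece τ i).indicator (fun s => -(s + τ i.succ) * (s + τ i.castSucc)) s

/-- `{M, N} ∈ Ξ_{d, n, K}` with `n = |ν|`: on `[-τ_K, 0]`, almost everywhere, `{M, N}` is the sum of
a pair generated with `gᵢ = 1` and a pair generated with `gᵢ(s) = -(s + τᵢ) (s + τᵢ₋₁)`. -/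
def MemXi {K : ℕ} (τ : Fin (K + 1) → ℝ) (d : ℕ) {ν : Type*} [Fintype ν] [DecidableEq ν]
    (M : ℝ → Matrix ν ν ℝ) (N : ℝ → ℝ → Matrix ν ν ℝ) : Prop :=
  ∃ (M₁ M₂ : ℝ → Matrix ν ν ℝ) (N₁ N₂ : ℝ → ℝ → Matrix ν ν ℝ),
    SOSPair τ d (fun _ => 1) M₁ N₁ ∧ SOSPair τ d (bump τ) M₂ N₂ ∧
    (∀ᵐ s ∂(volume.restrict (Icc (-τ (Fin.last K)) 0)), M s = M₁ s + M₂ s) ∧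
    (∀ᵐ p : ℝ × ℝ ∂(volume.restrict
        (Icc (-τ (Fin.last K)) 0 ×ˢ Icc (-τ (Fin.last K)) 0)),
      N p.1 p.2 = N₁ p.1 p.2 + N₂ p.1 p.2)

/-! ### The spacing pairs `Θ` -/

/-- Square integrability (entrywise) on `[-r, 0] × [-r, 0]`. -/
def SqIntSquare {μ ν : Type*} (r : ℝ) (L : ℝ → ℝ → Matrix μ ν ℝ) : Prop :=
  ∀ a b, MemLp (fun p : ℝ × ℝ => L p.1 p.2 a b) 2
    (volume.restrict (Icc (-r) 0 ×ˢ Icc (-r) 0))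

/-- `{F, H} ∈ Θ_{m, n, K}` with `m = |μ|`, `n = |ν|` and `r = τ_K`. -/
def MemTheta {μ ν : Type*} (r : ℝ) (F : ℝ → Matrix (μ ⊕ ν) (μ ⊕ ν) ℝ)
    (H : ℝ → ℝ → Matrix (μ ⊕ ν) (μ ⊕ ν) ℝ) : Prop :=
  ∃ (T : ℝ → Matrix μ μ ℝ) (L₁₁ : ℝ → ℝ → Matrix μ μ ℝ) (L₁₂ : ℝ → ℝ → Matrix μ ν ℝ)
    (L₂₁ : ℝ → ℝ → Matrix ν μ ℝ),
    (∀ a b, MemLp (fun s => T s a b) 2 (volume.restrict (Icc (-r) 0))) ∧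
    SqIntSquare r L₁₁ ∧ SqIntSquare r L₁₂ ∧ SqIntSquare r L₂₁ ∧
    (∀ a b, ∫ s in Icc (-r) 0, T s a b = 0) ∧
    (∀ᵐ s ∂(volume.restrict (Icc (-r) 0)), F s = Matrix.fromBlocks
      (T s + (1 / r) • Matrix.of fun a b =>
        ∫ p in Icc (-r) 0 ×ˢ Icc (-r) 0, L₁₁ p.1 p.2 a b)
      (Matrix.of fun a b => ∫ u in Icc (-r) 0, L₁₂ u s a b)
      (Matrix.of fun a b => ∫ u in Icc (-r) 0, L₂₁ s u a b)
      0) ∧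
    (∀ᵐ p : ℝ × ℝ ∂(volume.restrict (Icc (-r) 0 ×ˢ Icc (-r) 0)),
      H p.1 p.2 = -Matrix.fromBlocks (L₁₁ p.1 p.2) (L₁₂ p.1 p.2) (L₂₁ p.1 p.2) 0)

/-! ### The data of the dual stability condition -/

/-- `C₀ = A₀ P + ∑ᵢ (τ_K Aᵢ Qᵢ(-τᵢ)ᵀ + ½ Sᵢ(0))`. -/
def C0 {n K : ℕ} (τ : Fin (K + 1) → ℝ) (A₀ : Matrix (Fin n) (Fin n) ℝ)
    (A : Fin K → Matrix (Fin n) (Fin n) ℝ) (P : Matrix (Fin n) (Fin n) ℝ)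
    (Q S : Fin K → ℝ → Matrix (Fin n) (Fin n) ℝ) : Matrix (Fin n) (Fin n) ℝ :=
  A₀ * P + ∑ i : Fin K,
    (τ (Fin.last K) • (A i * (Q i (-τ i.succ))ᵀ) + (1 / 2 : ℝ) • S i 0)

/-- `Cᵢ = τ_K Aᵢ Sᵢ(-τᵢ)`. -/
def Ci {n K : ℕ} (τ : Fin (K + 1) → ℝ) (A : Fin K → Matrix (Fin n) (Fin n) ℝ)
    (S : Fin K → ℝ → Matrix (Fin n) (Fin n) ℝ) (i : Fin K) : Matrix (Fin n) (Fin n) ℝ :=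
  τ (Fin.last K) • (A i * S i (-τ i.succ))

/-- The block row `[C₁ ⋯ C_K]`. -/
def Crow {n K : ℕ} (τ : Fin (K + 1) → ℝ) (A : Fin K → Matrix (Fin n) (Fin n) ℝ)
    (S : Fin K → ℝ → Matrix (Fin n) (Fin n) ℝ) : Matrix (Fin n) (Fin n × Fin K) ℝ :=
  Matrix.of fun a c => Ci τ A S c.2 a c.1

/-- The symmetric matrix `D₁` of size `n (K + 1)`. -/
def D1 {n K : ℕ} (τ : Fin (K + 1) → ℝ) (A₀ : Matrix (Fin n) (Fin n) ℝ)
    (A : Fin K → Matrix (Fin n) (Fin n) ℝ) (ε : ℝ) (P : Matrix (Fin n) (Fin n) ℝ)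
    (Q S : Fin K → ℝ → Matrix (Fin n) (Fin n) ℝ) :
    Matrix (Fin n ⊕ Fin n × Fin K) (Fin n ⊕ Fin n × Fin K) ℝ :=
  Matrix.fromBlocks
    (C0 τ A₀ A P Q S + (C0 τ A₀ A P Q S)ᵀ + ε • (1 : Matrix (Fin n) (Fin n) ℝ))
    (Crow τ A S)
    (Crow τ A S)ᵀ
    (Matrix.blockDiagonal fun i => -S i (-τ i.succ))

/-- `Bᵢ(s) = A₀ Qᵢ(s) + Qᵢ'(s) + ∑ⱼ Aⱼ Rⱼᵢ(-τⱼ, s)`; `Q'` is the derivative of `Q`. -/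
def B {n K : ℕ} (τ : Fin (K + 1) → ℝ) (A₀ : Matrix (Fin n) (Fin n) ℝ)
    (A : Fin K → Matrix (Fin n) (Fin n) ℝ) (Q Q' : Fin K → ℝ → Matrix (Fin n) (Fin n) ℝ)
    (R : Fin K → Fin K → ℝ → ℝ → Matrix (Fin n) (Fin n) ℝ) (i : Fin K) (s : ℝ) :
    Matrix (Fin n) (Fin n) ℝ :=
  A₀ * Q i s + Q' i s + ∑ j : Fin K, A j * R j i (-τ j.succ) s

/-- `Vᵢ(s) = [Bᵢ(s); 0; ⋯; 0]`. -/
def V {n K : ℕ} (τ : Fin (K + 1) → ℝ) (A₀ : Matrix (Fin n) (Fin n) ℝ)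
    (A : Fin K → Matrix (Fin n) (Fin n) ℝ) (Q Q' : Fin K → ℝ → Matrix (Fin n) (Fin n) ℝ)
    (R : Fin K → Fin K → ℝ → ℝ → Matrix (Fin n) (Fin n) ℝ) (i : Fin K) (s : ℝ) :
    Matrix (Fin n ⊕ Fin n × Fin K) (Fin n) ℝ :=
  Matrix.fromRows (B τ A₀ A Q Q' R i s) 0

/-- `Gᵢⱼ = ∂Rᵢⱼ/∂s + ∂Rᵢⱼ/∂θ`, from the two partial derivatives `R₁`, `R₂` of `R`. -/
def G {n K : ℕ} (R₁ R₂ : Fin K → Fin K → ℝ → ℝ → Matrix (Fin n) (Fin n) ℝ) (i j : Fin K)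
    (s θ : ℝ) : Matrix (Fin n) (Fin n) ℝ :=
  R₁ i j s θ + R₂ i j s θ

/-- The multiplier `M = M₀ + F₁ - ε I`, with `M₀` from `𝓛₁(P - ε I, Qᵢ, Sᵢ - ε I, Rᵢⱼ)`. -/
def Mfun {n K : ℕ} (τ : Fin (K + 1) → ℝ) (ε : ℝ) (P : Matrix (Fin n) (Fin n) ℝ)
    (Q S : Fin K → ℝ → Matrix (Fin n) (Fin n) ℝ)
    (F₁ : ℝ → Matrix (Fin n ⊕ Fin n) (Fin n ⊕ Fin n) ℝ) (s : ℝ) :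
    Matrix (Fin n ⊕ Fin n) (Fin n ⊕ Fin n) ℝ :=
  L1mult τ (P - ε • (1 : Matrix (Fin n) (Fin n) ℝ)) Q
      (fun i s => S i s - ε • (1 : Matrix (Fin n) (Fin n) ℝ)) s
    + F₁ s - ε • (1 : Matrix (Fin n ⊕ Fin n) (Fin n ⊕ Fin n) ℝ)

/-- The kernel `N = [0, 0; 0, N₀] + H₁`. -/
def Nfun {n K : ℕ} (τ : Fin (K + 1) → ℝ)
    (R : Fin K → Fin K → ℝ → ℝ → Matrix (Fin n) (Fin n) ℝ)
    (H₁ : ℝ → ℝ → Matrix (Fin n ⊕ Fin n) (Fin n ⊕ Fin n) ℝ) (s θ : ℝ) :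
    Matrix (Fin n ⊕ Fin n) (Fin n ⊕ Fin n) ℝ :=
  Matrix.fromBlocks 0 0 0 (L1ker τ R s θ) + H₁ s θ

/-- The multiplier `D = D₀ + F₂`, with `D₀` from `𝓛₁(D₁, Vᵢ, Sᵢ' + ε I, Gᵢⱼ)`. -/
def Dfun {n K : ℕ} (τ : Fin (K + 1) → ℝ) (A₀ : Matrix (Fin n) (Fin n) ℝ)
    (A : Fin K → Matrix (Fin n) (Fin n) ℝ) (ε : ℝ) (P : Matrix (Fin n) (Fin n) ℝ)
    (Q Q' S S' : Fin K → ℝ → Matrix (Fin n) (Fin n) ℝ)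
    (R : Fin K → Fin K → ℝ → ℝ → Matrix (Fin n) (Fin n) ℝ)
    (F₂ : ℝ → Matrix ((Fin n ⊕ Fin n × Fin K) ⊕ Fin n) ((Fin n ⊕ Fin n × Fin K) ⊕ Fin n) ℝ)
    (s : ℝ) : Matrix ((Fin n ⊕ Fin n × Fin K) ⊕ Fin n) ((Fin n ⊕ Fin n × Fin K) ⊕ Fin n) ℝ :=
  L1mult τ (D1 τ A₀ A ε P Q S) (V τ A₀ A Q Q' R)
      (fun i s => S' i s + ε • (1 : Matrix (Fin n) (Fin n) ℝ)) s
    + F₂ s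

/-- The kernel `E = [0, 0; 0, E₀] + H₂`. -/
def Efun {n K : ℕ} (τ : Fin (K + 1) → ℝ)
    (R₁ R₂ : Fin K → Fin K → ℝ → ℝ → Matrix (Fin n) (Fin n) ℝ)
    (H₂ : ℝ → ℝ →
      Matrix ((Fin n ⊕ Fin n × Fin K) ⊕ Fin n) ((Fin n ⊕ Fin n × Fin K) ⊕ Fin n) ℝ)
    (s θ : ℝ) :
    Matrix ((Fin n ⊕ Fin n × Fin K) ⊕ Fin n) ((Fin n ⊕ Fin n × Fin K) ⊕ Fin n) ℝ :=
  Matrix.fromBlocks 0 0 0 (L1ker τ (G R₁ R₂) s θ) + H₂ s θ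

end DelayLMI

end

/-! The argument is a Lyapunov argument for the dual problem: the decision variables describe the
inverse of the Lyapunov operator. On the Hilbert space `ℝⁿ × ∏ᵢ L²([-τᵢ, 0], ℝⁿ)` the data `(P, Q,
S, R)` define a bounded operator `T` whose quadratic form is `L1val`. The symmetry constraints make
`T` self-adjoint. A solution is followed through the state `y(t) = (τ_K x(t), x(t + ·))`, and the
Lyapunov function is `W = ⟪y, T⁻¹ y⟫`.

Coercivity of `T`: a pair in `Ξ` has a nonnegative quadratic form, because that form is the weighted
integral of a positive semidefinite matrix evaluated at `(Y₁ v, ∫ Y₂ v)` (`pairForm_sos`). A spacing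
pair contributes nothing when the first block of `v` is constant (`MemTheta.pairForm_eq_zero`). The
affine maps behind `𝓛₁` turn the form on `[-τ_K, 0]` into `L1val` on the original intervals
(`pairForm_L1`). Hence the first constraint gives `⟪z, T z⟫ ≥ ε τ_K ‖z‖²` (`le_L1val_of_memXi`), and
`T` is invertible by Lax–Milgram. The same constraint read pointwise gives `Sᵢ(s) ≥ ε`
(`le_quadratic_of_memXi`).

Dissipation: put `z = T⁻¹ y(t)`, so that `W' = 2 ⟪y', z⟫`. Since `Sᵢ(s)` is invertible, the equation
`T z = y` can be solved for the function components of `z`, which therefore have absolutely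
continuous representatives `ψᵢ`. The couplings `P = τ_K Qᵢ(0)ᵀ + τ_K Sᵢ(0)` and `Qⱼ = Rᵢⱼ(0, ·)`
force `ψᵢ(0)` to equal the vector component of `z`. Thus `z` lies in the domain on which integration
by parts has the expected boundary terms, and `2 ⟪y', z⟫ + ε τ_K ‖z‖²` equals the `L1val` form of
the second constraint, evaluated at `z` and its boundary values `ψᵢ(-τᵢ)` (`L1val_dissipation`).
That form is nonpositive (`L1val_nonpos_of_memXi`), so `W' ≤ -ε τ_K ‖T⁻¹ y‖²` (`inner_le_of_memXi`).

Conclusion: `W` is comparable to `‖T⁻¹ y‖²`, hence decays exponentially, and with it `‖y‖`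
(`exists_exp_decay`). The curve `y` is shown to be differentiable only for `t > τ_K`, once the whole
segment lies in positive time; the initial stretch is covered by an a priori growth bound
(`norm_le_of_delay_bound`). -/

noncomputable section
namespace DelayLMI

/-! ### Quadratic forms of sum-of-squares pairs -/

section Forms

variable {X : Type*} [MeasurableSpace X] {μ : Measure X}

/-- The quadratic form of a multiplier-kernel pair on vector-valued functions. -/
def pairForm {ν : Type*} [Fintype ν] (μ : Measure X) (M : X → Matrix ν ν ℝ)
    (N : X → X → Matrix ν ν ℝ) (v : X → ν → ℝ) : ℝ :=
  ∫ s, v s ⬝ᵥ M s *ᵥ v s ∂μ + ∫ p, v p.1 ⬝ᵥ N p.1 p.2 *ᵥ v p.2 ∂(μ.prod μ)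

theorem integrable_mul_of_bdd {f h : X → ℝ} (hf : Integrable f μ)
    (hh : Measurable h) {C : ℝ} (hC : ∀ x, |h x| ≤ C) :
    Integrable (fun x => h x * f x) μ :=
  hf.bdd_mul (c := C) hh.aestronglyMeasurable (ae_of_all _ hC)

variable [IsFiniteMeasure μ]

theorem integral_prod_mul_kernel {f f' : X → ℝ} {h : X → X → ℝ}
    (hf : Integrable f μ) (hf' : Integrable f' μ)
    (hh : Measurable (Function.uncurry h)) {C : ℝ} (hC : ∀ x y, |h x y| ≤ C) :
    Integrable (fun p : X × X => f p.1 * (h p.1 p.2 * f' p.2)) (μ.prod μ) ∧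
    ∫ p, f p.1 * (h p.1 p.2 * f' p.2) ∂(μ.prod μ) =
      ∫ s, f s * ∫ θ, h s θ * f' θ ∂μ ∂μ ∧
    Integrable (fun s => f s * ∫ θ, h s θ * f' θ ∂μ) μ := by
  have hint : Integrable (fun p : X × X => f p.1 * (h p.1 p.2 * f' p.2)) (μ.prod μ) := by
    have := integrable_mul_of_bdd (hf.mul_prod hf') hh (C := C) (fun x => hC x.1 x.2)
    refine this.congr (ae_of_all _ fun p => ?_)
    simp only [Function.uncurry]; ring
  refine ⟨hint, ?_, ?_⟩
  · rw [integral_prod _ hint]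
    simp_rw [integral_const_mul]
  · simpa only [integral_const_mul] using hint.integral_prod_left

/-- Fubini for the triple integrand, dominated by a constant times `|f(s) f'(θ)|`. Taking the
`u`-integral outside factors the double integral, which is how the `Q₂₂` part of a kernel becomes a
quadratic form in moments. -/
theorem integral_prod_triple_kernel {f f' g : X → ℝ} {h h' : X → X → ℝ}
    (hf : Integrable f μ) (hf' : Integrable f' μ) (hg : Measurable g)
    {B : ℝ} (hB : ∀ x, |g x| ≤ B)
    (hh : Measurable (Function.uncurry h)) {C : ℝ} (hC : ∀ x y, |h x y| ≤ C)
    (hh' : Measurable (Function.uncurry h')) {C' : ℝ} (hC' : ∀ x y, |h' x y| ≤ C') :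
    Integrable (fun p : X × X => f p.1 * (∫ u, g u * (h u p.1 * h' u p.2) ∂μ) * f' p.2)
      (μ.prod μ) ∧
    ∫ p, f p.1 * (∫ u, g u * (h u p.1 * h' u p.2) ∂μ) * f' p.2 ∂(μ.prod μ) =
      ∫ u, g u * ((∫ s, h u s * f s ∂μ) * ∫ θ, h' u θ * f' θ ∂μ) ∂μ ∧
    Integrable (fun u => g u * ((∫ s, h u s * f s ∂μ) * ∫ θ, h' u θ * f' θ ∂μ)) μ := by
  let F : (X × X) → X → ℝ := fun p u => f p.1 * (g u * (h u p.1 * h' u p.2)) * f' p.2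
  have hF : Integrable (Function.uncurry F) ((μ.prod μ).prod μ) := by
    have h1 : Integrable (fun q : (X × X) × X => f q.1.1 * f' q.1.2) ((μ.prod μ).prod μ) :=
      (hf.mul_prod hf').comp_fst μ
    have hm : Measurable fun q : (X × X) × X => g q.2 * (h q.2 q.1.1 * h' q.2 q.1.2) := by
      have m1 : Measurable fun q : (X × X) × X => h q.2 q.1.1 :=
        hh.comp (measurable_snd.prodMk (measurable_fst.comp measurable_fst))
      have m2 : Measurable fun q : (X × X) × X => h' q.2 q.1.2 :=
        hh'.comp (measurable_snd.prodMk (measurable_snd.comp measurable_fst))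
      exact (hg.comp measurable_snd).mul (m1.mul m2)
    have := integrable_mul_of_bdd h1 hm (C := B * (C * C')) (fun q => by
      rw [abs_mul, abs_mul]
      have := abs_nonneg (g q.2); have := abs_nonneg (h q.2 q.1.1)
      have := abs_nonneg (h' q.2 q.1.2)
      have h3 := hB q.2; have h4 := hC q.2 q.1.1; have h5 := hC' q.2 q.1.2
      gcongr
      · exact (abs_nonneg _).trans h3
      · exact (abs_nonneg _).trans h4)
    refine this.congr (ae_of_all _ fun p => ?_)
    simp only [Function.uncurry, F]; ring
  have e1 : ∀ p : X × X, f p.1 * (∫ u, g u * (h u p.1 * h' u p.2) ∂μ) * f' p.2 =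
      ∫ u, F p u ∂μ := fun p => by
    simp only [F]
    rw [integral_mul_const, integral_const_mul]
  have e2 : ∀ u, g u * ((∫ s, h u s * f s ∂μ) * ∫ θ, h' u θ * f' θ ∂μ) =
      ∫ p, F p u ∂(μ.prod μ) := fun u => by
    simp only [F]
    rw [← integral_prod_mul, ← integral_const_mul]
    refine integral_congr_ae (ae_of_all _ fun p => ?_)
    ring
  refine ⟨?_, ?_, ?_⟩
  · simp_rw [e1]
    exact hF.integral_prod_left
  · simp_rw [e1, e2]
    rw [integral_integral_swap hF]
  · simp_rw [e2]
    exact hF.integral_prod_right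

/-- Integrability of both parts of `pairForm`. -/
def PairIntegrable {ν : Type*} [Fintype ν] (μ : Measure X) (M : X → Matrix ν ν ℝ)
    (N : X → X → Matrix ν ν ℝ) (v : X → ν → ℝ) : Prop :=
  Integrable (fun s => v s ⬝ᵥ M s *ᵥ v s) μ ∧
    Integrable (fun p : X × X => v p.1 ⬝ᵥ N p.1 p.2 *ᵥ v p.2) (μ.prod μ)

/-- With `a(s) = y₁(s) v(s)` and `b(u) = ∫ y₂(u, θ) v(θ) dθ`, the whole form collapses to `∫ g (a,
b)ᵀ [Q₁₁, Q₁₂; Q₁₂ᵀ, Q₂₂] (a, b)`. Boundedness of `y₁`, `y₂` and `g` supplies every integrability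
needed for Fubini. -/
theorem pairForm_sos {ν ρ₁ ρ₂ : Type*} [Fintype ν] [Fintype ρ₁] [Fintype ρ₂]
    {y₁ : X → Matrix ρ₁ ν ℝ} {y₂ : X → X → Matrix ρ₂ ν ℝ}
    (hy₁ : ∀ r c, Measurable fun s => y₁ s r c)
    (hy₂ : ∀ r c, Measurable (Function.uncurry fun s θ => y₂ s θ r c))
    {C : ℝ} (hC₁ : ∀ s r c, |y₁ s r c| ≤ C) (hC₂ : ∀ s θ r c, |y₂ s θ r c| ≤ C)
    {g : X → ℝ} (hg : Measurable g) (hg0 : ∀ s, 0 ≤ g s) {B : ℝ} (hB : ∀ s, g s ≤ B)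
    {Q₁₁ : Matrix ρ₁ ρ₁ ℝ} {Q₁₂ : Matrix ρ₁ ρ₂ ℝ} {Q₂₂ : Matrix ρ₂ ρ₂ ℝ}
    (hQ : (Matrix.fromBlocks Q₁₁ Q₁₂ Q₁₂ᵀ Q₂₂).PosSemidef)
    {v : X → ν → ℝ} (hv : ∀ a, MemLp (fun s => v s a) 2 μ)
    {M : X → Matrix ν ν ℝ} {N : X → X → Matrix ν ν ℝ}
    (hM : ∀ s, M s = g s • ((y₁ s)ᵀ * Q₁₁ * y₁ s))
    (hN : ∀ s θ, N s θ = g s • ((y₁ s)ᵀ * Q₁₂ * y₂ s θ) + g θ • ((y₂ θ s)ᵀ * Q₁₂ᵀ * y₁ θ) +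
      Matrix.of fun a b => ∫ u, g u * ((y₂ u s)ᵀ * Q₂₂ * y₂ u θ) a b ∂μ) :
    PairIntegrable μ M N v ∧ 0 ≤ pairForm μ M N v := by
  have hv1 : ∀ a, Integrable (fun s => v s a) μ := fun a => (hv a).integrable one_le_two
  have hgB : ∀ s, |g s| ≤ B := fun s => by rw [abs_of_nonneg (hg0 s)]; exact hB s
  let a : X → ρ₁ → ℝ := fun s => y₁ s *ᵥ v s
  let b : X → ρ₂ → ℝ := fun u r => ∑ c, ∫ θ, y₂ u θ r c * v θ c ∂μ
  have ha : ∀ r, MemLp (fun s => a s r) 2 μ := by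
    intro r
    simp only [a, Matrix.mulVec, dotProduct]
    refine memLp_finsetSum _ fun c _ => ?_
    exact (hv c).of_le_mul (c := C)
      ((hy₁ r c).aestronglyMeasurable.mul (hv c).aestronglyMeasurable)
      (ae_of_all _ fun s => by rw [norm_mul]; gcongr; exact hC₁ s r c)
  -- the multiplier part
  have eM : ∀ s, v s ⬝ᵥ M s *ᵥ v s = g s * (a s ⬝ᵥ Q₁₁ *ᵥ a s) := by
    intro s
    rw [hM, Matrix.smul_mulVec, dotProduct_smul, smul_eq_mul, ← Matrix.mulVec_mulVec,
      ← Matrix.mulVec_mulVec, Matrix.dotProduct_mulVec, Matrix.vecMul_transpose]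
  have iM : Integrable (fun s => g s * (a s ⬝ᵥ Q₁₁ *ᵥ a s)) μ := by
    refine integrable_mul_of_bdd ?_ hg hgB
    simp only [dotProduct, Matrix.mulVec, Finset.mul_sum]
    refine integrable_finsetSum _ fun r _ => integrable_finsetSum _ fun r' _ => ?_
    refine (((ha r).integrable_mul (ha r')).const_mul (Q₁₁ r r')).congr (ae_of_all _ fun s => ?_)
    simp only [Pi.mul_apply]; ring
  -- the cross terms
  let f : ρ₂ → X → ℝ := fun r s => g s * (a s ᵥ* Q₁₂) r
  have hf : ∀ r, Integrable (f r) μ := by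
    intro r
    refine integrable_mul_of_bdd ?_ hg hgB
    simp only [Matrix.vecMul, dotProduct]
    exact integrable_finsetSum _ fun r' _ => ((ha r').integrable one_le_two).mul_const _
  have k2 := fun r c => integral_prod_mul_kernel (hf r) (hv1 c) (hy₂ r c) (fun s θ => hC₂ s θ r c)
  have e2 : ∀ s θ, v s ⬝ᵥ (g s • ((y₁ s)ᵀ * Q₁₂ * y₂ s θ)) *ᵥ v θ =
      ∑ r, ∑ c, f r s * (y₂ s θ r c * v θ c) := by
    intro s θ
    rw [Matrix.smul_mulVec, dotProduct_smul, smul_eq_mul, ← Matrix.mulVec_mulVec,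
      ← Matrix.mulVec_mulVec, Matrix.dotProduct_mulVec, Matrix.vecMul_transpose,
      Matrix.dotProduct_mulVec]
    have hb : ∀ r, (y₂ s θ *ᵥ v θ) r = ∑ c, y₂ s θ r c * v θ c := fun r => rfl
    simp only [f, a, dotProduct, hb, Finset.mul_sum, mul_assoc]
  have i2 : Integrable (fun p : X × X => v p.1 ⬝ᵥ (g p.1 • ((y₁ p.1)ᵀ * Q₁₂ * y₂ p.1 p.2)) *ᵥ v p.2)
      (μ.prod μ) := by
    simp_rw [e2]
    exact integrable_finsetSum _ fun r _ => integrable_finsetSum _ fun c _ => (k2 r c).1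
  have I2 : ∫ p, v p.1 ⬝ᵥ (g p.1 • ((y₁ p.1)ᵀ * Q₁₂ * y₂ p.1 p.2)) *ᵥ v p.2 ∂(μ.prod μ) =
      ∫ s, g s * (a s ⬝ᵥ Q₁₂ *ᵥ b s) ∂μ := by
    simp_rw [e2]
    rw [integral_finsetSum _ fun r _ => integrable_finsetSum _ fun c _ => (k2 r c).1]
    simp_rw [integral_finsetSum _ fun c _ => (k2 _ c).1, fun r c => (k2 r c).2.1]
    simp_rw [← integral_finsetSum _ fun c _ => (k2 _ c).2.2]
    rw [← integral_finsetSum _ fun r _ => integrable_finsetSum _ fun c _ => (k2 r c).2.2]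
    refine integral_congr_ae (ae_of_all _ fun s => ?_)
    simp only [Matrix.dotProduct_mulVec]
    simp only [f, b, dotProduct, Finset.mul_sum, mul_assoc]
  have j2 : Integrable (fun s => g s * (a s ⬝ᵥ Q₁₂ *ᵥ b s)) μ := by
    refine (integrable_finsetSum Finset.univ fun r _ =>
      integrable_finsetSum Finset.univ fun c _ => (k2 r c).2.2).congr (ae_of_all _ fun s => ?_)
    simp only [Matrix.dotProduct_mulVec]
    simp only [f, b, dotProduct, Finset.mul_sum, mul_assoc]
  -- The third term is the second one with the two variables exchanged, so its integral is the same.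
  have e3 : ∀ s θ, v s ⬝ᵥ (g θ • ((y₂ θ s)ᵀ * Q₁₂ᵀ * y₁ θ)) *ᵥ v θ =
      v θ ⬝ᵥ (g θ • ((y₁ θ)ᵀ * Q₁₂ * y₂ θ s)) *ᵥ v s := by
    intro s θ
    rw [dotProduct_comm, ← Matrix.vecMul_transpose, ← Matrix.dotProduct_mulVec]
    simp [Matrix.transpose_mul, Matrix.mul_assoc]
  have i3 : Integrable (fun p : X × X => v p.1 ⬝ᵥ (g p.2 • ((y₂ p.2 p.1)ᵀ * Q₁₂ᵀ * y₁ p.2)) *ᵥ v p.2)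
      (μ.prod μ) := by
    simp_rw [e3]; exact i2.swap
  have I3 : ∫ p, v p.1 ⬝ᵥ (g p.2 • ((y₂ p.2 p.1)ᵀ * Q₁₂ᵀ * y₁ p.2)) *ᵥ v p.2 ∂(μ.prod μ) =
      ∫ s, g s * (a s ⬝ᵥ Q₁₂ *ᵥ b s) ∂μ := by
    simp_rw [e3]
    rw [← I2]
    exact integral_prod_swap
      (fun p : X × X => v p.1 ⬝ᵥ (g p.1 • ((y₁ p.1)ᵀ * Q₁₂ * y₂ p.1 p.2)) *ᵥ v p.2)
  -- the kernel part
  have k4 := fun r c r' c' => integral_prod_triple_kernel (hv1 c) (hv1 c') hg hgB (hy₂ r c)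
    (fun s θ => hC₂ s θ r c) (hy₂ r' c') (fun s θ => hC₂ s θ r' c')
  have iu : ∀ s θ r c r' c', Integrable (fun u => g u * (y₂ u s r c * y₂ u θ r' c')) μ := by
    intro s θ r c r' c'
    have m1 : Measurable fun u => y₂ u s r c := (hy₂ r c).comp (measurable_id.prodMk measurable_const)
    have m2 : Measurable fun u => y₂ u θ r' c' :=
      (hy₂ r' c').comp (measurable_id.prodMk measurable_const)
    have := integrable_mul_of_bdd (integrable_mul_of_bdd (integrable_mul_of_bdd
      (integrable_const (μ := μ) (1 : ℝ)) m2 (fun u => hC₂ u θ r' c')) m1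
      (fun u => hC₂ u s r c)) hg hgB
    simpa only [mul_one] using this
  have e4 : ∀ s θ, v s ⬝ᵥ (Matrix.of fun a b =>
        ∫ u, g u * ((y₂ u s)ᵀ * Q₂₂ * y₂ u θ) a b ∂μ : Matrix ν ν ℝ) *ᵥ v θ =
      ∑ c, ∑ c', ∑ r', ∑ r, Q₂₂ r r' *
        (v s c * (∫ u, g u * (y₂ u s r c * y₂ u θ r' c') ∂μ) * v θ c') := by
    intro s θ
    simp only [dotProduct, Matrix.mulVec, Matrix.of_apply, Finset.mul_sum]
    refine Finset.sum_congr rfl fun c _ => Finset.sum_congr rfl fun c' _ => ?_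
    have : ∫ u, g u * ((y₂ u s)ᵀ * Q₂₂ * y₂ u θ) c c' ∂μ =
        ∑ r', ∑ r, Q₂₂ r r' * ∫ u, g u * (y₂ u s r c * y₂ u θ r' c') ∂μ := by
      simp_rw [← integral_const_mul]
      simp_rw [← integral_finsetSum _ fun r _ => (iu s θ r c _ c').const_mul (Q₂₂ r _)]
      rw [← integral_finsetSum _ fun r' _ => integrable_finsetSum _ fun r _ =>
        (iu s θ r c r' c').const_mul (Q₂₂ r r')]
      refine integral_congr_ae (ae_of_all _ fun u => ?_)
      simp only [Matrix.mul_apply, Matrix.transpose_apply, Finset.sum_mul, Finset.mul_sum]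
      refine Finset.sum_congr rfl fun r' _ => Finset.sum_congr rfl fun r _ => ?_
      ring
    rw [this, Finset.sum_mul, Finset.mul_sum]
    refine Finset.sum_congr rfl fun r' _ => ?_
    rw [Finset.sum_mul, Finset.mul_sum]
    refine Finset.sum_congr rfl fun r _ => ?_
    ring
  have E4 : ∀ u, g u * (b u ⬝ᵥ Q₂₂ *ᵥ b u) = ∑ c, ∑ c', ∑ r', ∑ r, Q₂₂ r r' *
        (g u * ((∫ s, y₂ u s r c * v s c ∂μ) * ∫ θ, y₂ u θ r' c' * v θ c' ∂μ)) := by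
    intro u
    have : ∀ F : ν → ν → ρ₂ → ρ₂ → ℝ,
        ∑ c, ∑ c', ∑ r', ∑ r, F c c' r' r = ∑ r, ∑ r', ∑ c, ∑ c', F c c' r' r := by
      intro F
      calc _ = ∑ c, ∑ r', ∑ c', ∑ r, F c c' r' r :=
            Finset.sum_congr rfl fun c _ => Finset.sum_comm
        _ = ∑ r', ∑ c, ∑ c', ∑ r, F c c' r' r := Finset.sum_comm
        _ = ∑ r', ∑ c, ∑ r, ∑ c', F c c' r' r :=
            Finset.sum_congr rfl fun r' _ => Finset.sum_congr rfl fun c _ => Finset.sum_comm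
        _ = ∑ r', ∑ r, ∑ c, ∑ c', F c c' r' r :=
            Finset.sum_congr rfl fun r' _ => Finset.sum_comm
        _ = _ := Finset.sum_comm
    rw [this]
    simp only [dotProduct, Matrix.mulVec, Finset.mul_sum]
    refine Finset.sum_congr rfl fun r _ => Finset.sum_congr rfl fun r' _ => ?_
    simp only [b, Finset.sum_mul, Finset.mul_sum]
    rw [Finset.sum_comm]
    refine Finset.sum_congr rfl fun c _ => Finset.sum_congr rfl fun c' _ => ?_
    ring
  have i4 : Integrable (fun p : X × X => v p.1 ⬝ᵥ (Matrix.of fun a b =>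
        ∫ u, g u * ((y₂ u p.1)ᵀ * Q₂₂ * y₂ u p.2) a b ∂μ : Matrix ν ν ℝ) *ᵥ v p.2) (μ.prod μ) := by
    simp_rw [e4]
    exact integrable_finsetSum _ fun c _ => integrable_finsetSum _ fun c' _ =>
      integrable_finsetSum _ fun r' _ => integrable_finsetSum _ fun r _ =>
      (k4 r c r' c').1.const_mul _
  have j4 : Integrable (fun u => g u * (b u ⬝ᵥ Q₂₂ *ᵥ b u)) μ := by
    simp_rw [E4]
    exact integrable_finsetSum _ fun c _ => integrable_finsetSum _ fun c' _ =>
      integrable_finsetSum _ fun r' _ => integrable_finsetSum _ fun r _ =>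
      (k4 r c r' c').2.2.const_mul _
  have I4 : ∫ p, v p.1 ⬝ᵥ (Matrix.of fun a b =>
        ∫ u, g u * ((y₂ u p.1)ᵀ * Q₂₂ * y₂ u p.2) a b ∂μ : Matrix ν ν ℝ) *ᵥ v p.2 ∂(μ.prod μ) =
      ∫ u, g u * (b u ⬝ᵥ Q₂₂ *ᵥ b u) ∂μ := by
    simp_rw [e4, E4]
    rw [integral_finsetSum _ fun c _ => integrable_finsetSum _ fun c' _ =>
        integrable_finsetSum _ fun r' _ => integrable_finsetSum _ fun r _ =>
        (k4 r c r' c').1.const_mul _,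
      integral_finsetSum _ fun c _ => integrable_finsetSum _ fun c' _ =>
        integrable_finsetSum _ fun r' _ => integrable_finsetSum _ fun r _ =>
        (k4 r c r' c').2.2.const_mul _]
    refine Finset.sum_congr rfl fun c _ => ?_
    rw [integral_finsetSum _ fun c' _ =>
        integrable_finsetSum _ fun r' _ => integrable_finsetSum _ fun r _ =>
        (k4 r c r' c').1.const_mul _,
      integral_finsetSum _ fun c' _ =>
        integrable_finsetSum _ fun r' _ => integrable_finsetSum _ fun r _ =>
        (k4 r c r' c').2.2.const_mul _]
    refine Finset.sum_congr rfl fun c' _ => ?_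
    rw [integral_finsetSum _ fun r' _ => integrable_finsetSum _ fun r _ =>
        (k4 r c r' c').1.const_mul _,
      integral_finsetSum _ fun r' _ => integrable_finsetSum _ fun r _ =>
        (k4 r c r' c').2.2.const_mul _]
    refine Finset.sum_congr rfl fun r' _ => ?_
    rw [integral_finsetSum _ fun r _ => (k4 r c r' c').1.const_mul _,
      integral_finsetSum _ fun r _ => (k4 r c r' c').2.2.const_mul _]
    refine Finset.sum_congr rfl fun r _ => ?_
    rw [integral_const_mul, integral_const_mul, (k4 r c r' c').2.1]
  have eN : ∀ p : X × X, v p.1 ⬝ᵥ N p.1 p.2 *ᵥ v p.2 =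
      v p.1 ⬝ᵥ (g p.1 • ((y₁ p.1)ᵀ * Q₁₂ * y₂ p.1 p.2)) *ᵥ v p.2 +
      v p.1 ⬝ᵥ (g p.2 • ((y₂ p.2 p.1)ᵀ * Q₁₂ᵀ * y₁ p.2)) *ᵥ v p.2 +
      v p.1 ⬝ᵥ (Matrix.of fun a b =>
        ∫ u, g u * ((y₂ u p.1)ᵀ * Q₂₂ * y₂ u p.2) a b ∂μ : Matrix ν ν ℝ) *ᵥ v p.2 := by
    intro p
    rw [hN, Matrix.add_mulVec, Matrix.add_mulVec, dotProduct_add, dotProduct_add]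
  have add3 : ∀ {Y : Type _} [MeasurableSpace Y] (κ : Measure Y) (f₁ f₂ f₃ : Y → ℝ),
      Integrable f₁ κ → Integrable f₂ κ → Integrable f₃ κ →
      ∫ y, f₁ y + f₂ y + f₃ y ∂κ = ∫ y, f₁ y ∂κ + ∫ y, f₂ y ∂κ + ∫ y, f₃ y ∂κ := by
    intro Y _ κ f₁ f₂ f₃ h₁ h₂ h₃
    rw [← integral_add h₁ h₂]
    exact integral_add (h₁.add h₂) h₃
  refine ⟨⟨?_, ?_⟩, ?_⟩
  · simp_rw [eM]; exact iM
  · simp_rw [eN]; exact (i2.add i3).add i4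
  · unfold pairForm
    simp_rw [eM, eN]
    rw [add3 _ _ _ _ i2 i3 i4, I2, I3, I4]
    have := add3 _ _ _ _ iM (j2.const_mul 2) j4
    rw [integral_const_mul] at this
    -- The two equal cross terms are merged, so that the sum is a single integral with a pointwise
    -- nonnegative integrand.
    have e : ∀ x y z : ℝ, x + (y + y + z) = x + 2 * y + z := fun x y z => by ring
    rw [e, ← this]
    refine integral_nonneg fun s => ?_
    have := hQ.dotProduct_mulVec_nonneg (Sum.elim (a s) (b s))
    rw [Matrix.fromBlocks_mulVec] at this
    simp only [star_trivial, Sum.elim_comp_inl, Sum.elim_comp_inr, sumElim_dotProduct_sumElim,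
      dotProduct_add] at this
    rw [Matrix.dotProduct_mulVec (b s) Q₁₂ᵀ, Matrix.vecMul_transpose,
      dotProduct_comm _ (a s)] at this
    have h2 := mul_nonneg (hg0 s) this
    simp only [Pi.zero_apply]
    linarith

end Forms


/-! ### Nonnegativity on the cone `Ξ` and neutrality of the spacing pairs -/

section Cone

variable {K : ℕ} {τ : Fin (K + 1) → ℝ}

/-- Lebesgue measure on `[-r, 0]`. -/
abbrev lebIcc (r : ℝ) : Measure ℝ := volume.restrict (Icc (-r) 0)

theorem measurableSet_piece (i : Fin K) : MeasurableSet (piece τ i) := measurableSet_Ioc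

theorem delay_nonneg (h0 : τ 0 = 0) (hτ : StrictMono τ) (i : Fin (K + 1)) : 0 ≤ τ i := by
  rw [← h0]; exact hτ.monotone (Fin.zero_le i)

theorem delay_succ_pos (h0 : τ 0 = 0) (hτ : StrictMono τ) (i : Fin K) : 0 < τ i.succ := by
  rw [← h0]; exact hτ (Fin.succ_pos i)

theorem delay_last_pos (hK : 1 ≤ K) (h0 : τ 0 = 0) (hτ : StrictMono τ) : 0 < τ (Fin.last K) := by
  rw [← h0]; exact hτ (by rw [Fin.lt_def]; exact hK)

theorem piece_subset (h0 : τ 0 = 0) (hτ : StrictMono τ) (i : Fin K) :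
    piece τ i ⊆ Icc (-τ (Fin.last K)) 0 := by
  intro s hs
  have h1 := hτ.monotone (Fin.le_last i.succ)
  have h2 := delay_nonneg h0 hτ i.castSucc
  exact ⟨by linarith [hs.1], by linarith [hs.2]⟩

/-- Pieces lie in `[-τ_K, 0]`; the maximum with `1` makes the powers increase with the exponent, so
one bound serves all degrees up to `d`. -/
theorem abs_pow_mul_indicator_piece_le (h0 : τ 0 = 0) (hτ : StrictMono τ) {k d : ℕ} (hk : k ≤ d)
    (i : Fin K) (s : ℝ) :
    |s ^ k * (piece τ i).indicator (1 : ℝ → ℝ) s| ≤ max 1 (τ (Fin.last K)) ^ d := by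
  by_cases hs : s ∈ piece τ i
  · have h1 := piece_subset h0 hτ i hs
    rw [indicator_of_mem hs, Pi.one_apply, mul_one, abs_pow]
    calc |s| ^ k ≤ max 1 (τ (Fin.last K)) ^ k := by
          gcongr
          exact (abs_le.2 ⟨h1.1, h1.2.trans (delay_nonneg h0 hτ _)⟩).trans (le_max_right _ _)
      _ ≤ _ := pow_le_pow_right₀ (le_max_left _ _) hk
  · rw [indicator_of_notMem hs, mul_zero, abs_zero]; positivity

theorem abs_one_apply_le {ν : Type*} [DecidableEq ν] (a b : ν) : |(1 : Matrix ν ν ℝ) a b| ≤ 1 := by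
  rw [Matrix.one_apply]; split_ifs <;> simp

theorem abs_Y1_le (h0 : τ 0 = 0) (hτ : StrictMono τ) {d : ℕ} {ν : Type*} [DecidableEq ν] (s : ℝ)
    (r : (Fin (d + 1) × ν) × Fin K) (c : ν) :
    |Y1 τ d ν s r c| ≤ max 1 (τ (Fin.last K)) ^ d := by
  have h1 := abs_pow_mul_indicator_piece_le h0 hτ (Nat.lt_succ_iff.1 r.1.1.2) r.2 s
  have h2 := abs_one_apply_le r.1.2 c
  calc |Y1 τ d ν s r c|
      = |s ^ (r.1.1 : ℕ) * (piece τ r.2).indicator (1 : ℝ → ℝ) s| *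
        |(1 : Matrix ν ν ℝ) r.1.2 c| := by
        rw [← abs_mul]; simp only [Y1, Matrix.of_apply]; ring_nf
    _ ≤ max 1 (τ (Fin.last K)) ^ d * 1 := by gcongr
    _ = _ := mul_one _

theorem abs_Y2_le (h0 : τ 0 = 0) (hτ : StrictMono τ) {d : ℕ} {ν : Type*} [DecidableEq ν] (s θ : ℝ)
    (r : ((Mon d × ν) × Fin K) × Fin K) (c : ν) :
    |Y2 τ d ν s θ r c| ≤ max 1 (τ (Fin.last K)) ^ d * max 1 (τ (Fin.last K)) ^ d := by
  have h1 := abs_pow_mul_indicator_piece_le h0 hτ (Nat.lt_succ_iff.1 r.1.1.1.1.1.2) r.1.2 s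
  have h1' := abs_pow_mul_indicator_piece_le h0 hτ (Nat.lt_succ_iff.1 r.1.1.1.1.2.2) r.2 θ
  have h2 := abs_one_apply_le r.1.1.2 c
  calc |Y2 τ d ν s θ r c|
      = |s ^ (r.1.1.1.1.1 : ℕ) * (piece τ r.1.2).indicator (1 : ℝ → ℝ) s| *
        |θ ^ (r.1.1.1.1.2 : ℕ) * (piece τ r.2).indicator (1 : ℝ → ℝ) θ| *
        |(1 : Matrix ν ν ℝ) r.1.1.2 c| := by
        rw [← abs_mul, ← abs_mul]; simp only [Y2, Matrix.of_apply]; ring_nf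
    _ ≤ max 1 (τ (Fin.last K)) ^ d * max 1 (τ (Fin.last K)) ^ d * 1 := by gcongr
    _ = _ := mul_one _

theorem measurable_Y1 {d : ℕ} {ν : Type*} [DecidableEq ν]
    (r : (Fin (d + 1) × ν) × Fin K) (c : ν) : Measurable fun s => Y1 τ d ν s r c := by
  simp only [Y1, Matrix.of_apply]
  exact ((measurable_id.pow_const _).mul_const _).mul
    (measurable_one.indicator (measurableSet_piece _))

theorem measurable_Y2 {d : ℕ} {ν : Type*} [DecidableEq ν]
    (r : ((Mon d × ν) × Fin K) × Fin K) (c : ν) :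
    Measurable (Function.uncurry fun s θ => Y2 τ d ν s θ r c) := by
  simp only [Y2, Matrix.of_apply, Function.uncurry_def]
  exact ((((measurable_fst.pow_const _).mul (measurable_snd.pow_const _)).mul_const _).mul
    ((measurable_one.indicator (measurableSet_piece _)).comp measurable_fst)).mul
    ((measurable_one.indicator (measurableSet_piece _)).comp measurable_snd)

theorem measurable_bump : Measurable (bump τ) := by
  unfold bump
  refine Finset.measurable_sum _ fun i _ => ?_
  refine Measurable.indicator ?_ (measurableSet_piece i)
  fun_prop

theorem bump_nonneg (s : ℝ) : 0 ≤ bump τ s := by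
  refine Finset.sum_nonneg fun i _ => indicator_nonneg (fun s hs => ?_) s
  have := hs.1; have := hs.2
  nlinarith

theorem bump_le (h0 : τ 0 = 0) (hτ : StrictMono τ) (s : ℝ) :
    bump τ s ≤ ∑ _i : Fin K, τ (Fin.last K) * τ (Fin.last K) := by
  refine Finset.sum_le_sum fun i _ => indicator_apply_le' (fun hs => ?_) (fun _ => mul_self_nonneg _)
  have h1 := piece_subset h0 hτ i hs
  have h2 := hs.1
  have h3 := hs.2
  have h4 := hτ.monotone (Fin.le_last i.succ)
  have h5 := delay_nonneg h0 hτ i.castSucc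
  have h6 := h1.1
  have h7 := h1.2
  have : (s + τ i.succ) * (-(s + τ i.castSucc)) ≤ τ (Fin.last K) * τ (Fin.last K) := by
    apply mul_le_mul <;> linarith
  linarith

theorem SOSPair.pairForm_nonneg (h0 : τ 0 = 0) (hτ : StrictMono τ) {d : ℕ} {ν : Type*} [Fintype ν]
    [DecidableEq ν] {g : ℝ → ℝ} (hg : Measurable g) (hg0 : ∀ s, 0 ≤ g s) {B : ℝ}
    (hB : ∀ s, g s ≤ B) {M : ℝ → Matrix ν ν ℝ} {N : ℝ → ℝ → Matrix ν ν ℝ}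
    (h : SOSPair τ d g M N) {v : ℝ → ν → ℝ}
    (hv : ∀ a, MemLp (fun s => v s a) 2 (lebIcc (τ (Fin.last K)))) :
    PairIntegrable (lebIcc (τ (Fin.last K))) M N v ∧
      0 ≤ pairForm (lebIcc (τ (Fin.last K))) M N v := by
  obtain ⟨Q₁₁, Q₁₂, Q₂₂, hQ, hM, hN⟩ := h
  refine pairForm_sos (C := max 1 (τ (Fin.last K)) ^ d * max 1 (τ (Fin.last K)) ^ d)
    measurable_Y1 measurable_Y2 (fun s r c => (abs_Y1_le h0 hτ s r c).trans ?_)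
    (abs_Y2_le h0 hτ) hg hg0 hB hQ hv hM hN
  have h1 : 1 ≤ max 1 (τ (Fin.last K)) ^ d := one_le_pow₀ (le_max_left _ _)
  nlinarith

/-- The positive semidefinite matrix is tested on `(Y₁ w, 0)`, which sees only `Q₁₁`. This pointwise
information, beyond nonnegativity of the integral form, is what later bounds `Sᵢ(s)` from below. -/
theorem SOSPair.mult_nonneg {d : ℕ} {ν : Type*} [Fintype ν] [DecidableEq ν] {g : ℝ → ℝ}
    (hg0 : ∀ s, 0 ≤ g s) {M : ℝ → Matrix ν ν ℝ} {N : ℝ → ℝ → Matrix ν ν ℝ}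
    (h : SOSPair τ d g M N) (s : ℝ) (w : ν → ℝ) : 0 ≤ w ⬝ᵥ M s *ᵥ w := by
  obtain ⟨Q₁₁, Q₁₂, Q₂₂, hQ, hM, -⟩ := h
  rw [hM, Matrix.smul_mulVec, dotProduct_smul, smul_eq_mul, ← Matrix.mulVec_mulVec,
      ← Matrix.mulVec_mulVec, Matrix.dotProduct_mulVec, Matrix.vecMul_transpose]
  refine mul_nonneg (hg0 s) ?_
  have := hQ.dotProduct_mulVec_nonneg (Sum.elim (Y1 τ d ν s *ᵥ w) 0)
  rw [Matrix.fromBlocks_mulVec] at this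
  simpa [sumElim_dotProduct_sumElim] using this

theorem pairForm_add {X : Type*} [MeasurableSpace X] {μ : Measure X} {ν : Type*} [Fintype ν]
    {M M' : X → Matrix ν ν ℝ} {N N' : X → X → Matrix ν ν ℝ} {v : X → ν → ℝ}
    (h : PairIntegrable μ M N v) (h' : PairIntegrable μ M' N' v) :
    PairIntegrable μ (fun s => M s + M' s) (fun s θ => N s θ + N' s θ) v ∧
    pairForm μ (fun s => M s + M' s) (fun s θ => N s θ + N' s θ) v =
      pairForm μ M N v + pairForm μ M' N' v := by
  unfold PairIntegrable pairForm
  simp_rw [Matrix.add_mulVec, dotProduct_add]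
  rw [integral_add h.1 h'.1, integral_add h.2 h'.2]
  exact ⟨⟨h.1.add h'.1, h.2.add h'.2⟩, by ring⟩

theorem pairForm_neg {X : Type*} [MeasurableSpace X] {μ : Measure X} {ν : Type*} [Fintype ν]
    (M : X → Matrix ν ν ℝ) (N : X → X → Matrix ν ν ℝ) (v : X → ν → ℝ) :
    pairForm μ (fun s => - M s) (fun s θ => - N s θ) v = - pairForm μ M N v := by
  unfold pairForm
  simp_rw [Matrix.neg_mulVec, dotProduct_neg, integral_neg]
  ring

theorem pairForm_congr {X : Type*} [MeasurableSpace X] {μ : Measure X} {ν : Type*} [Fintype ν]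
    {M M' : X → Matrix ν ν ℝ} {N N' : X → X → Matrix ν ν ℝ}
    (hM : ∀ᵐ s ∂μ, M s = M' s) (hN : ∀ᵐ p ∂(μ.prod μ), N p.1 p.2 = N' p.1 p.2) (v : X → ν → ℝ) :
    pairForm μ M N v = pairForm μ M' N' v := by
  unfold pairForm
  congr 1
  · exact integral_congr_ae (hM.mono fun s hs => by simp only [hs])
  · exact integral_congr_ae (hN.mono fun s hs => by simp only [hs])

theorem lebIcc_prod (r r' : ℝ) :
    (lebIcc r).prod (lebIcc r') = volume.restrict (Icc (-r) 0 ×ˢ Icc (-r') 0) := by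
  rw [Measure.prod_restrict]; rfl

theorem MemXi.pairForm_nonneg (h0 : τ 0 = 0) (hτ : StrictMono τ) {d : ℕ} {ν : Type*} [Fintype ν]
    [DecidableEq ν] {M : ℝ → Matrix ν ν ℝ} {N : ℝ → ℝ → Matrix ν ν ℝ}
    (h : MemXi τ d M N) {v : ℝ → ν → ℝ}
    (hv : ∀ a, MemLp (fun s => v s a) 2 (lebIcc (τ (Fin.last K)))) :
    0 ≤ pairForm (lebIcc (τ (Fin.last K))) M N v := by
  obtain ⟨M₁, M₂, N₁, N₂, h1, h2, hM, hN⟩ := h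
  obtain ⟨i1, n1⟩ := h1.pairForm_nonneg h0 hτ measurable_const (fun _ => zero_le_one)
    (fun _ => le_rfl) hv
  obtain ⟨i2, n2⟩ := h2.pairForm_nonneg h0 hτ measurable_bump bump_nonneg (bump_le h0 hτ) hv
  rw [← lebIcc_prod] at hN
  rw [pairForm_congr (N' := fun s θ => N₁ s θ + N₂ s θ) hM hN v, (pairForm_add i1 i2).2]
  exact add_nonneg n1 n2

theorem MemXi.mult_nonneg {d : ℕ} {ν : Type*} [Fintype ν]
    [DecidableEq ν] {M : ℝ → Matrix ν ν ℝ} {N : ℝ → ℝ → Matrix ν ν ℝ}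
    (h : MemXi τ d M N) :
    ∀ᵐ s ∂(lebIcc (τ (Fin.last K))), ∀ w, 0 ≤ w ⬝ᵥ M s *ᵥ w := by
  obtain ⟨M₁, M₂, N₁, N₂, h1, h2, hM, hN⟩ := h
  filter_upwards [hM] with s hs w
  rw [hs, Matrix.add_mulVec, dotProduct_add]
  exact add_nonneg (h1.mult_nonneg (fun _ => zero_le_one) s w) (h2.mult_nonneg bump_nonneg s w)

theorem integral_dotProduct_mulVec {Y α β : Type*} [MeasurableSpace Y] {κ : Measure Y} [Fintype α]
    [Fintype β] {A : Y → Matrix α β ℝ} {u : Y → α → ℝ} {v : Y → β → ℝ}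
    (h : ∀ a b, Integrable (fun y => u y a * A y a b * v y b) κ) :
    Integrable (fun y => u y ⬝ᵥ A y *ᵥ v y) κ ∧
    ∫ y, u y ⬝ᵥ A y *ᵥ v y ∂κ = ∑ a, ∑ b, ∫ y, u y a * A y a b * v y b ∂κ := by
  have e : ∀ y, u y ⬝ᵥ A y *ᵥ v y = ∑ a, ∑ b, u y a * A y a b * v y b := fun y => by
    simp only [dotProduct, Matrix.mulVec, Finset.mul_sum, mul_assoc]
  simp_rw [e]
  refine ⟨integrable_finsetSum _ fun a _ => integrable_finsetSum _ fun b _ => h a b, ?_⟩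
  rw [integral_finsetSum _ fun a _ => integrable_finsetSum _ fun b _ => h a b]
  simp_rw [integral_finsetSum _ fun b _ => h _ b]

/-- Fubini for a square-integrable kernel against an `L²` function of one variable; the measures are
finite, so that function is also square integrable on the product. -/
theorem integral_prod_mul_snd {X Y : Type*} [MeasurableSpace X] [MeasurableSpace Y] {μ : Measure X}
    {μ' : Measure Y} [IsFiniteMeasure μ] [IsFiniteMeasure μ'] {L : X → Y → ℝ} {f : Y → ℝ}
    (hL : MemLp (fun p : X × Y => L p.1 p.2) 2 (μ.prod μ')) (hf : MemLp f 2 μ') :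
    Integrable (fun p : X × Y => L p.1 p.2 * f p.2) (μ.prod μ') ∧
    Integrable (fun θ => (∫ s, L s θ ∂μ) * f θ) μ' ∧
    ∫ p, L p.1 p.2 * f p.2 ∂(μ.prod μ') = ∫ θ, (∫ s, L s θ ∂μ) * f θ ∂μ' := by
  have h1 : Integrable (fun p : X × Y => L p.1 p.2 * f p.2) (μ.prod μ') :=
    hL.integrable_mul (hf.comp_snd μ)
  refine ⟨h1, ?_, ?_⟩
  · simpa only [integral_mul_const] using h1.integral_prod_right
  · rw [integral_prod_symm _ h1]
    simp only [integral_mul_const]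

/-- The spacing pairs do not contribute to the quadratic form on functions whose first block is
constant. -/
theorem MemTheta.pairForm_eq_zero {μ ν : Type*} [Fintype μ] [Fintype ν] {r : ℝ} (hr : 0 < r)
    {F : ℝ → Matrix (μ ⊕ ν) (μ ⊕ ν) ℝ} {H : ℝ → ℝ → Matrix (μ ⊕ ν) (μ ⊕ ν) ℝ}
    (h : MemTheta r F H) (w : μ → ℝ) {φ : ℝ → ν → ℝ}
    (hφ : ∀ a, MemLp (fun s => φ s a) 2 (lebIcc r)) :
    PairIntegrable (lebIcc r) F H (fun s => Sum.elim w (φ s)) ∧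
    pairForm (lebIcc r) F H (fun s => Sum.elim w (φ s)) = 0 := by
  obtain ⟨T, L₁₁, L₁₂, L₂₁, hT, h11, h12, h21, hT0, hF, hH⟩ := h
  simp only [SqIntSquare, ← lebIcc_prod] at h11 h12 h21
  simp only [← lebIcc_prod] at hF hH
  set κ := lebIcc r with hκ
  let c : Matrix μ μ ℝ := Matrix.of fun a b => ∫ p, L₁₁ p.1 p.2 a b ∂(κ.prod κ)
  let m₁₂ : ℝ → Matrix μ ν ℝ := fun s => Matrix.of fun a b => ∫ u, L₁₂ u s a b ∂κ
  let m₂₁ : ℝ → Matrix ν μ ℝ := fun s => Matrix.of fun a b => ∫ u, L₂₁ s u a b ∂κ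
  have eF : ∀ᵐ s ∂κ, Sum.elim w (φ s) ⬝ᵥ F s *ᵥ Sum.elim w (φ s) =
      w ⬝ᵥ (T s + (1 / r) • c) *ᵥ w + w ⬝ᵥ m₁₂ s *ᵥ φ s + φ s ⬝ᵥ m₂₁ s *ᵥ w := by
    filter_upwards [hF] with s hs
    rw [hs, Matrix.fromBlocks_mulVec, sumElim_dotProduct_sumElim]
    simp only [Sum.elim_comp_inl, Sum.elim_comp_inr, dotProduct_add, Matrix.zero_mulVec,
      add_zero]
    rfl
  have eH : ∀ᵐ p ∂(κ.prod κ), Sum.elim w (φ p.1) ⬝ᵥ H p.1 p.2 *ᵥ Sum.elim w (φ p.2) =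
      -(w ⬝ᵥ L₁₁ p.1 p.2 *ᵥ w + w ⬝ᵥ L₁₂ p.1 p.2 *ᵥ φ p.2 + φ p.1 ⬝ᵥ L₂₁ p.1 p.2 *ᵥ w) := by
    filter_upwards [hH] with p hp
    rw [hp, Matrix.neg_mulVec, dotProduct_neg, Matrix.fromBlocks_mulVec, sumElim_dotProduct_sumElim]
    simp only [Sum.elim_comp_inl, Sum.elim_comp_inr, dotProduct_add, Matrix.zero_mulVec,
      add_zero]
  have hvol : ∫ _s, (1 : ℝ) ∂κ = r := by simp [hκ, hr.le]
  have A1 : ∀ a b, Integrable (fun s => w a * (T s + (1 / r) • c) a b * w b) κ := fun a b =>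
    ((((hT a b).integrable one_le_two).add (integrable_const _)).const_mul _).mul_const _
  have A2 : ∀ a b, Integrable (fun p : ℝ × ℝ => w a * L₁₁ p.1 p.2 a b * w b) (κ.prod κ) := fun a b =>
    (((h11 a b).integrable one_le_two).const_mul _).mul_const _
  have B0 := fun a b => integral_prod_mul_snd (L := fun s θ => L₁₂ s θ a b) (h12 a b) (hφ b)
  have B1 : ∀ a b, Integrable (fun s => w a * m₁₂ s a b * φ s b) κ := fun a b => by
    simp only [m₁₂, Matrix.of_apply, mul_assoc]
    exact (B0 a b).2.1.const_mul (w a)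
  have B2 : ∀ a b, Integrable (fun p : ℝ × ℝ => w a * L₁₂ p.1 p.2 a b * φ p.2 b) (κ.prod κ) :=
    fun a b => by simpa only [mul_assoc] using (B0 a b).1.const_mul (w a)
  -- The arguments of `L₂₁` are exchanged so that the integrated-out variable comes first; square
  -- integrability survives the swap.
  have C0 := fun a b => integral_prod_mul_snd (L := fun s θ => L₂₁ θ s a b)
    ((h21 a b).comp_measurePreserving Measure.measurePreserving_swap) (hφ a)
  have C1 : ∀ a b, Integrable (fun s => φ s a * m₂₁ s a b * w b) κ := fun a b => by
    refine ((C0 a b).2.1.mul_const (w b)).congr (ae_of_all _ fun s => ?_)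
    simp only [m₂₁, Matrix.of_apply]; ring
  have C2 : ∀ a b, Integrable (fun p : ℝ × ℝ => φ p.1 a * L₂₁ p.1 p.2 a b * w b) (κ.prod κ) :=
    fun a b => by
      refine ((C0 a b).1.swap.mul_const (w b)).congr (ae_of_all _ fun p => ?_)
      simp only [Function.comp, Prod.swap]; ring
  have a1 := integral_dotProduct_mulVec A1
  have a2 := integral_dotProduct_mulVec A2
  have b1 := integral_dotProduct_mulVec B1
  have b2 := integral_dotProduct_mulVec B2
  have c1 := integral_dotProduct_mulVec C1
  have c2 := integral_dotProduct_mulVec C2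
  refine ⟨⟨(((a1.1.add b1.1).add c1.1).congr (eF.mono fun _ h => h.symm)),
    (((a2.1.add b2.1).add c2.1).neg.congr (eH.mono fun _ h => h.symm))⟩, ?_⟩
  unfold pairForm
  rw [integral_congr_ae eF, integral_congr_ae eH, integral_neg,
    integral_add (by exact a1.1.add b1.1) c1.1, integral_add a1.1 b1.1,
    integral_add (by exact a2.1.add b2.1) c2.1, integral_add a2.1 b2.1,
    a1.2, a2.2, b1.2, b2.2, c1.2, c2.2]
  -- `T` has zero mean, and the constant `c / r` integrates to `c` over an interval of length `r`;
  -- what remains cancels the `L₁₁` part of `H`.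
  have d1 : ∀ a b, ∫ s, w a * (T s + (1 / r) • c) a b * w b ∂κ =
      ∫ p, w a * L₁₁ p.1 p.2 a b * w b ∂(κ.prod κ) := by
    intro a b
    rw [integral_mul_const, integral_const_mul, integral_mul_const, integral_const_mul]
    congr 2
    simp only [Matrix.add_apply, Matrix.smul_apply, smul_eq_mul]
    rw [integral_add ((hT a b).integrable one_le_two) (integrable_const _), hT0 a b]
    have : ∫ _s, (1 / r * c a b) ∂κ = (1 / r * c a b) * ∫ _s, (1 : ℝ) ∂κ := by
      rw [← integral_const_mul]; simp
    rw [this, hvol]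
    simp only [c, Matrix.of_apply]
    field_simp
    simp
  have d2 : ∀ a b, ∫ s, w a * m₁₂ s a b * φ s b ∂κ =
      ∫ p, w a * L₁₂ p.1 p.2 a b * φ p.2 b ∂(κ.prod κ) := by
    intro a b
    simp only [mul_assoc]
    rw [integral_const_mul, integral_const_mul, (B0 a b).2.2]
    rfl
  have d3 : ∀ a b, ∫ s, φ s a * m₂₁ s a b * w b ∂κ =
      ∫ p, φ p.1 a * L₂₁ p.1 p.2 a b * w b ∂(κ.prod κ) := by
    intro a b
    rw [integral_mul_const, integral_mul_const]
    congr 1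
    have := (C0 a b).2.2
    rw [← integral_prod_swap] at this
    simp only [Prod.swap] at this
    simp only [mul_comm (φ _ a), m₂₁, Matrix.of_apply]
    exact this.symm
  simp_rw [d1, d2, d3]
  ring

end Cone


/-! ### The change of variables behind `𝓛₁` -/

section Scaling

variable {K : ℕ} {τ : Fin (K + 1) → ℝ}

theorem scale_pos (h0 : τ 0 = 0) (hτ : StrictMono τ) (i : Fin K) : 0 < scale τ i :=
  div_pos (sub_pos.2 (hτ (Fin.castSucc_lt_succ))) (delay_succ_pos h0 hτ i)

theorem measurableEmbedding_stretch (h0 : τ 0 = 0) (hτ : StrictMono τ) (i : Fin K) :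
    MeasurableEmbedding (stretch τ i) := by
  have h := (scale_pos h0 hτ i).ne'
  have : stretch τ i = fun s => (scale τ i)⁻¹ * (s + τ i.castSucc) := by
    ext s; simp only [stretch]; field_simp
  rw [this]
  exact (measurableEmbedding_mulLeft₀ (inv_ne_zero h)).comp (measurableEmbedding_addRight _)

/-- The map has slope `1 / aᵢ`, so it pushes Lebesgue measure forward to `aᵢ` times Lebesgue
measure. The image of the piece is `(-τᵢ, 0]` because `aᵢ τᵢ = τᵢ - τᵢ₋₁`; the missing end point is
null. -/
theorem measurePreserving_stretch (h0 : τ 0 = 0) (hτ : StrictMono τ) (i : Fin K) :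
    MeasurePreserving (stretch τ i) (volume.restrict (piece τ i))
      (ENNReal.ofReal (scale τ i) • lebIcc (τ i.succ)) := by
  have ha := scale_pos h0 hτ i
  have he := measurableEmbedding_stretch h0 hτ i
  refine ⟨he.measurable, ?_⟩
  have hpre : piece τ i = stretch τ i ⁻¹' Ioc (-τ i.succ) 0 := by
    ext s
    have h1 : scale τ i * τ i.succ = τ i.succ - τ i.castSucc := by
      unfold scale; field_simp [(delay_succ_pos h0 hτ i).ne']
    simp only [piece, mem_Ioc, mem_preimage, stretch, lt_div_iff₀ ha, div_le_iff₀ ha]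
    constructor <;> rintro ⟨h2, h3⟩ <;> constructor <;> nlinarith
  have hmap : Measure.map (stretch τ i) volume = ENNReal.ofReal (scale τ i) • volume := by
    have : stretch τ i = (fun s => (scale τ i)⁻¹ * s) ∘ fun s => s + τ i.castSucc := by
      ext s; simp only [stretch, Function.comp]; field_simp
    rw [this, ← Measure.map_map (by fun_prop) (by fun_prop), map_add_right_eq_self,
      Real.map_volume_mul_left (inv_ne_zero ha.ne'), inv_inv, abs_of_pos ha]
  rw [hpre, ← he.restrict_map, hmap, Measure.restrict_smul, lebIcc, restrict_Ioc_eq_restrict_Icc]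

theorem integral_indicator_piece (h0 : τ 0 = 0) (hτ : StrictMono τ) (i : Fin K) {m : ℝ → ℝ}
    (hm : Integrable m (lebIcc (τ i.succ))) :
    Integrable ((piece τ i).indicator fun s => m (stretch τ i s)) (lebIcc (τ (Fin.last K))) ∧
    ∫ s, (piece τ i).indicator (fun s => m (stretch τ i s)) s ∂(lebIcc (τ (Fin.last K))) =
      scale τ i * ∫ t, m t ∂(lebIcc (τ i.succ)) := by
  have hr : (lebIcc (τ (Fin.last K))).restrict (piece τ i) = volume.restrict (piece τ i) := by
    rw [lebIcc, Measure.restrict_restrict (measurableSet_piece i),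
      inter_eq_left.2 (piece_subset h0 hτ i)]
  have hp := measurePreserving_stretch h0 hτ i
  have he := measurableEmbedding_stretch h0 hτ i
  constructor
  · rw [integrable_indicator_iff (measurableSet_piece i), IntegrableOn, hr]
    exact (hp.integrable_comp_emb he).2 (hm.smul_measure ENNReal.ofReal_ne_top)
  · rw [integral_indicator (measurableSet_piece i), hr, hp.integral_comp he, integral_smul_measure,
      ENNReal.toReal_ofReal (scale_pos h0 hτ i).le, smul_eq_mul]

theorem integral_indicator_piece_prod (h0 : τ 0 = 0) (hτ : StrictMono τ) (i j : Fin K)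
    {m : ℝ × ℝ → ℝ} (hm : Integrable m ((lebIcc (τ i.succ)).prod (lebIcc (τ j.succ)))) :
    Integrable ((piece τ i ×ˢ piece τ j).indicator fun p => m (stretch τ i p.1, stretch τ j p.2))
      ((lebIcc (τ (Fin.last K))).prod (lebIcc (τ (Fin.last K)))) ∧
    ∫ p, (piece τ i ×ˢ piece τ j).indicator (fun p => m (stretch τ i p.1, stretch τ j p.2)) p
      ∂((lebIcc (τ (Fin.last K))).prod (lebIcc (τ (Fin.last K)))) =
      scale τ i * scale τ j * ∫ p, m p ∂((lebIcc (τ i.succ)).prod (lebIcc (τ j.succ))) := by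
  have hr : ((lebIcc (τ (Fin.last K))).prod (lebIcc (τ (Fin.last K)))).restrict
      (piece τ i ×ˢ piece τ j) =
      (volume.restrict (piece τ i)).prod (volume.restrict (piece τ j)) := by
    rw [← Measure.prod_restrict, lebIcc, Measure.restrict_restrict (measurableSet_piece i),
      Measure.restrict_restrict (measurableSet_piece j),
      inter_eq_left.2 (piece_subset h0 hτ i), inter_eq_left.2 (piece_subset h0 hτ j)]
  have hms := (measurableSet_piece (τ := τ) i).prod (measurableSet_piece (τ := τ) j)
  have hp := (measurePreserving_stretch h0 hτ i).prod (measurePreserving_stretch h0 hτ j)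
  have he := (measurableEmbedding_stretch h0 hτ i).prodMap (measurableEmbedding_stretch h0 hτ j)
  rw [Measure.prod_smul_left, Measure.prod_smul_right, smul_smul,
    ← ENNReal.ofReal_mul (scale_pos h0 hτ i).le] at hp
  constructor
  · rw [integrable_indicator_iff hms, IntegrableOn, hr]
    exact (hp.integrable_comp_emb he).2 (hm.smul_measure ENNReal.ofReal_ne_top)
  · rw [integral_indicator hms, hr]
    refine (hp.integral_comp he m).trans ?_
    rw [integral_smul_measure,
      ENNReal.toReal_ofReal (mul_pos (scale_pos h0 hτ i) (scale_pos h0 hτ j)).le, smul_eq_mul]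

theorem pairwise_disjoint_piece (hτ : StrictMono τ) {i j : Fin K} {s : ℝ} (hi : s ∈ piece τ i)
    (hj : s ∈ piece τ j) : i = j := by
  by_contra hne
  rcases lt_or_gt_of_ne hne with h | h
  · have : τ i.succ ≤ τ j.castSucc := hτ.monotone (Fin.succ_le_castSucc_iff.2 h)
    have := hi.1; have := hj.2; linarith
  · have : τ j.succ ≤ τ i.castSucc := hτ.monotone (Fin.succ_le_castSucc_iff.2 h)
    have := hj.1; have := hi.2; linarith

theorem sum_indicator_piece_of_mem (hτ : StrictMono τ) {α : Type*} [AddCommMonoid α] {i : Fin K}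
    {s : ℝ} (hi : s ∈ piece τ i) (f : Fin K → ℝ → α) :
    ∑ j, (piece τ j).indicator (f j) s = f i s := by
  rw [Finset.sum_eq_single i, indicator_of_mem hi]
  · exact fun j _ hj => indicator_of_notMem (fun h => hj (pairwise_disjoint_piece hτ h hi)) _
  · exact fun h => (h (Finset.mem_univ _)).elim

theorem sum_indicator_piece_of_notMem {α : Type*} [AddCommMonoid α] {s : ℝ}
    (hs : ∀ i, s ∉ piece τ i) (f : Fin K → ℝ → α) :
    ∑ j, (piece τ j).indicator (f j) s = 0 :=
  Finset.sum_eq_zero fun j _ => indicator_of_notMem (hs j) _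

theorem sum_indicator_piece_prod_of_mem (hτ : StrictMono τ) {α : Type*} [AddCommMonoid α]
    {i j : Fin K} {p : ℝ × ℝ} (hi : p.1 ∈ piece τ i) (hj : p.2 ∈ piece τ j)
    (f : Fin K → Fin K → ℝ × ℝ → α) :
    ∑ i, ∑ j, (piece τ i ×ˢ piece τ j).indicator (f i j) p = f i j p := by
  have hp : p ∈ piece τ i ×ˢ piece τ j := ⟨hi, hj⟩
  rw [Finset.sum_eq_single i, Finset.sum_eq_single j, indicator_of_mem hp]
  · exact fun j' _ hne => indicator_of_notMem
      (fun h => hne (pairwise_disjoint_piece hτ h.2 hj)) _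
  · exact fun h => (h (Finset.mem_univ _)).elim
  · exact fun i' _ hne => Finset.sum_eq_zero fun j' _ => indicator_of_notMem
      (fun h => hne (pairwise_disjoint_piece hτ h.1 hi)) _
  · exact fun h => (h (Finset.mem_univ _)).elim

/-- The function on `[-τ_K, 0]` assembled from functions on the intervals `[-τᵢ, 0]`. -/
def glue {ν : Type*} (τ : Fin (K + 1) → ℝ) (φ : Fin K → ℝ → ν → ℝ) (s : ℝ) : ν → ℝ :=
  ∑ i : Fin K, (piece τ i).indicator (fun s => φ i (stretch τ i s)) s

/-- The quadratic form, in the original variables, of a pair `𝓛₁(P, Q, S, R)`. -/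
def L1val {μ ν : Type*} [Fintype μ] [Fintype ν] (τ : Fin (K + 1) → ℝ) (P : Matrix μ μ ℝ)
    (Q : Fin K → ℝ → Matrix μ ν ℝ) (S : Fin K → ℝ → Matrix ν ν ℝ)
    (R : Fin K → Fin K → ℝ → ℝ → Matrix ν ν ℝ) (w : μ → ℝ) (φ : Fin K → ℝ → ν → ℝ) : ℝ :=
  τ (Fin.last K) * (w ⬝ᵥ P *ᵥ w) +
    ∑ i, τ (Fin.last K) * (2 * (∫ s, w ⬝ᵥ Q i s *ᵥ φ i s ∂(lebIcc (τ i.succ))) +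
      ∫ s, φ i s ⬝ᵥ S i s *ᵥ φ i s ∂(lebIcc (τ i.succ))) +
    ∑ i, ∑ j, ∫ p, φ i p.1 ⬝ᵥ R i j p.1 p.2 *ᵥ φ j p.2
      ∂((lebIcc (τ i.succ)).prod (lebIcc (τ j.succ)))

theorem memLp_glue (h0 : τ 0 = 0) (hτ : StrictMono τ) {ν : Type*} {φ : Fin K → ℝ → ν → ℝ}
    (hφ : ∀ i a, MemLp (fun s => φ i s a) 2 (lebIcc (τ i.succ))) (a : ν) :
    MemLp (fun s => glue τ φ s a) 2 (lebIcc (τ (Fin.last K))) := by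
  have e : (fun s => glue τ φ s a) = fun s => ∑ i, (piece τ i).indicator
      (fun s => φ i (stretch τ i s) a) s := by
    ext s
    simp only [glue, Finset.sum_apply]
    refine Finset.sum_congr rfl fun i _ => ?_
    by_cases hs : s ∈ piece τ i
    · simp only [indicator_of_mem hs]
    · simp only [indicator_of_notMem hs, Pi.zero_apply]
  rw [e]
  refine memLp_finsetSum _ fun i _ => ?_
  have hr : (lebIcc (τ (Fin.last K))).restrict (piece τ i) = volume.restrict (piece τ i) := by
    rw [lebIcc, Measure.restrict_restrict (measurableSet_piece i),
      inter_eq_left.2 (piece_subset h0 hτ i)]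
  rw [memLp_indicator_iff_restrict (measurableSet_piece i), hr]
  exact ((hφ i a).smul_measure ENNReal.ofReal_ne_top).comp_measurePreserving
    (measurePreserving_stretch h0 hτ i)

/-- The Jacobian `aᵢ` cancels the factor `τ_K / aᵢ` down to `τ_K`, and `aᵢ aⱼ` cancels the factor of
the kernel. The block `P` is weighted by the total length of the pieces. Only products are assumed
integrable, so the lemma serves both `L²` functions with continuous coefficients and continuous
functions with `L²` coefficients. -/
theorem pairForm_L1 (h0 : τ 0 = 0) (hτ : StrictMono τ) {μ ν : Type*} [Fintype μ]
    [Fintype ν] {P : Matrix μ μ ℝ}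
    {Q : Fin K → ℝ → Matrix μ ν ℝ} {S : Fin K → ℝ → Matrix ν ν ℝ}
    {R : Fin K → Fin K → ℝ → ℝ → Matrix ν ν ℝ} (w : μ → ℝ) {φ : Fin K → ℝ → ν → ℝ}
    (hQ : ∀ i a b, Integrable (fun s => Q i s a b * φ i s b) (lebIcc (τ i.succ)))
    (hS : ∀ i a b, Integrable (fun s => φ i s a * S i s a b * φ i s b) (lebIcc (τ i.succ)))
    (hR : ∀ i j a b, Integrable (fun p : ℝ × ℝ => φ i p.1 a * R i j p.1 p.2 a b * φ j p.2 b)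
      ((lebIcc (τ i.succ)).prod (lebIcc (τ j.succ)))) :
    PairIntegrable (lebIcc (τ (Fin.last K))) (L1mult τ P Q S)
      (fun s θ => Matrix.fromBlocks 0 0 0 (L1ker τ R s θ)) (fun s => Sum.elim w (glue τ φ s)) ∧
    pairForm (lebIcc (τ (Fin.last K))) (L1mult τ P Q S)
      (fun s θ => Matrix.fromBlocks 0 0 0 (L1ker τ R s θ)) (fun s => Sum.elim w (glue τ φ s)) =
      L1val τ P Q S R w φ := by
  set T := τ (Fin.last K) with hT
  let m : Fin K → ℝ → ℝ := fun i t => w ⬝ᵥ P *ᵥ w + (T / scale τ i) *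
    (2 * (w ⬝ᵥ Q i t *ᵥ φ i t) + φ i t ⬝ᵥ S i t *ᵥ φ i t)
  let k : Fin K → Fin K → ℝ × ℝ → ℝ := fun i j p =>
    (1 / (scale τ i * scale τ j)) * (φ i p.1 ⬝ᵥ R i j p.1 p.2 *ᵥ φ j p.2)
  have glue_mem : ∀ {i s}, s ∈ piece τ i → glue τ φ s = φ i (stretch τ i s) := fun hi =>
    sum_indicator_piece_of_mem hτ hi _
  have em : ∀ s, Sum.elim w (glue τ φ s) ⬝ᵥ L1mult τ P Q S s *ᵥ Sum.elim w (glue τ φ s) =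
      ∑ i, (piece τ i).indicator (fun s => m i (stretch τ i s)) s := by
    intro s
    by_cases hs : ∃ i, s ∈ piece τ i
    · obtain ⟨i, hi⟩ := hs
      rw [sum_indicator_piece_of_mem hτ hi, L1mult, sum_indicator_piece_of_mem hτ hi, glue_mem hi,
        Matrix.fromBlocks_mulVec, sumElim_dotProduct_sumElim]
      simp only [Sum.elim_comp_inl, Sum.elim_comp_inr, dotProduct_add, Matrix.smul_mulVec,
        dotProduct_smul, smul_eq_mul, m]
      rw [Matrix.dotProduct_mulVec (φ i _) (Q i _)ᵀ, Matrix.vecMul_transpose, dotProduct_comm _ w]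
      ring
    -- Outside all pieces `L1mult` is zero, so both sides vanish; inside `[-τ_K, 0]` this concerns
    -- only the left end point.
    · push Not at hs
      rw [sum_indicator_piece_of_notMem hs, L1mult, sum_indicator_piece_of_notMem hs]
      simp
  have ek : ∀ p : ℝ × ℝ, Sum.elim w (glue τ φ p.1) ⬝ᵥ
      Matrix.fromBlocks 0 0 0 (L1ker τ R p.1 p.2) *ᵥ Sum.elim w (glue τ φ p.2) =
      ∑ i, ∑ j, (piece τ i ×ˢ piece τ j).indicator
        (fun p => k i j (stretch τ i p.1, stretch τ j p.2)) p := by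
    intro p
    rw [Matrix.fromBlocks_mulVec, sumElim_dotProduct_sumElim]
    simp only [Sum.elim_comp_inr, Matrix.zero_mulVec, zero_add, dotProduct_zero]
    by_cases hs : ∃ i, p.1 ∈ piece τ i
    · by_cases hθ : ∃ j, p.2 ∈ piece τ j
      · obtain ⟨i, hi⟩ := hs
        obtain ⟨j, hj⟩ := hθ
        rw [sum_indicator_piece_prod_of_mem hτ hi hj, L1ker,
          sum_indicator_piece_prod_of_mem (p := (p.1, p.2)) hτ hi hj, glue_mem hi, glue_mem hj]
        simp only [Matrix.smul_mulVec, dotProduct_smul, smul_eq_mul, k]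
      · push Not at hθ
        rw [Finset.sum_eq_zero fun i _ => Finset.sum_eq_zero fun j _ =>
          indicator_of_notMem (fun h => hθ j h.2) _]
        rw [show glue τ φ p.2 = 0 from sum_indicator_piece_of_notMem hθ _]
        simp
    · push Not at hs
      rw [Finset.sum_eq_zero fun i _ => Finset.sum_eq_zero fun j _ =>
          indicator_of_notMem (fun h => hs i h.1) _]
      rw [show glue τ φ p.1 = 0 from sum_indicator_piece_of_notMem hs _]
      simp
  have iQ : ∀ i, Integrable (fun s => w ⬝ᵥ Q i s *ᵥ φ i s) (lebIcc (τ i.succ)) := fun i =>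
    (integral_dotProduct_mulVec fun a b => by
      simpa only [mul_assoc] using (hQ i a b).const_mul (w a)).1
  have iS : ∀ i, Integrable (fun s => φ i s ⬝ᵥ S i s *ᵥ φ i s) (lebIcc (τ i.succ)) := fun i =>
    (integral_dotProduct_mulVec (hS i)).1
  have im : ∀ i, Integrable (m i) (lebIcc (τ i.succ)) := fun i =>
    (integrable_const _).add ((((iQ i).const_mul 2).add (iS i)).const_mul _)
  have ik : ∀ i j, Integrable (k i j) ((lebIcc (τ i.succ)).prod (lebIcc (τ j.succ))) := fun i j =>
    (integral_dotProduct_mulVec (hR i j)).1.const_mul _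
  have hm := fun i => integral_indicator_piece h0 hτ i (im i)
  have hk := fun i j => integral_indicator_piece_prod h0 hτ i j (ik i j)
  have hmi : ∀ i, scale τ i * ∫ t, m i t ∂(lebIcc (τ i.succ)) =
      (τ i.succ - τ i.castSucc) * (w ⬝ᵥ P *ᵥ w) +
      T * (2 * (∫ s, w ⬝ᵥ Q i s *ᵥ φ i s ∂(lebIcc (τ i.succ))) +
      ∫ s, φ i s ⬝ᵥ S i s *ᵥ φ i s ∂(lebIcc (τ i.succ))) := by
    intro i
    have hpos := delay_succ_pos h0 hτ i
    have hsc := scale_pos h0 hτ i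
    have h1 : ∫ t, m i t ∂(lebIcc (τ i.succ)) = τ i.succ * (w ⬝ᵥ P *ᵥ w) +
        (T / scale τ i) * (2 * (∫ s, w ⬝ᵥ Q i s *ᵥ φ i s ∂(lebIcc (τ i.succ))) +
        ∫ s, φ i s ⬝ᵥ S i s *ᵥ φ i s ∂(lebIcc (τ i.succ))) := by
      simp only [m]
      rw [integral_add (integrable_const _)
        (by exact (((iQ i).const_mul 2).add (iS i)).const_mul _), integral_const_mul,
        integral_add ((iQ i).const_mul 2) (iS i), integral_const_mul]
      simp [hpos.le]
    have h2 : scale τ i * τ i.succ = τ i.succ - τ i.castSucc := by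
      unfold scale; field_simp
    rw [h1, mul_add, ← mul_assoc, h2, ← mul_assoc, mul_div_cancel₀ _ hsc.ne']
  -- The lengths of the pieces telescope, and `τ₀ = 0`.
  have tel : ∑ i : Fin K, (τ i.succ - τ i.castSucc) = T := by
    rw [Finset.sum_sub_distrib]
    have e1 := Fin.sum_univ_succ τ
    have e2 := Fin.sum_univ_castSucc τ
    rw [h0] at e1
    linarith
  refine ⟨⟨?_, ?_⟩, ?_⟩
  · simp_rw [em]
    exact integrable_finsetSum _ fun i _ => (hm i).1
  · simp_rw [ek]
    exact integrable_finsetSum _ fun i _ => integrable_finsetSum _ fun j _ => (hk i j).1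
  · unfold pairForm L1val
    simp_rw [em, ek]
    rw [integral_finsetSum _ fun i _ => (hm i).1,
      integral_finsetSum _ fun i _ => integrable_finsetSum _ fun j _ => (hk i j).1]
    simp_rw [integral_finsetSum _ fun j _ => (hk _ j).1, fun i => (hm i).2, fun i j => (hk i j).2,
      hmi]
    rw [Finset.sum_add_distrib, ← Finset.sum_mul, tel]
    congr 1
    refine Finset.sum_congr rfl fun i _ => Finset.sum_congr rfl fun j _ => ?_
    simp only [k]
    rw [integral_const_mul]
    have h1 := (scale_pos h0 hτ i).ne'
    have h2 := (scale_pos h0 hτ j).ne'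
    field_simp

end Scaling


/-! ### Consequences of the two sum-of-squares constraints -/

section Inequalities

variable {n K : ℕ} {τ : Fin (K + 1) → ℝ}

theorem integral_dotProduct_self_nonneg {X ν : Type*} [MeasurableSpace X] {μ : Measure X}
    [Fintype ν] (v : X → ν → ℝ) : 0 ≤ ∫ s, v s ⬝ᵥ v s ∂μ :=
  integral_nonneg fun s => by simpa using dotProduct_star_self_nonneg (v s)

theorem integrable_dotProduct_self {X ν : Type*} [MeasurableSpace X] {μ : Measure X}
    [Fintype ν] {v : X → ν → ℝ} (hv : ∀ a, MemLp (fun s => v s a) 2 μ) :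
    Integrable (fun s => v s ⬝ᵥ v s) μ := by
  simp only [dotProduct]
  exact integrable_finsetSum _ fun a _ => (hv a).integrable_mul (hv a)

theorem memLp_of_continuousOn {r : ℝ} {f : ℝ → ℝ} (hf : ContinuousOn f (Icc (-r) 0)) :
    MemLp f 2 (lebIcc r) := by
  obtain ⟨C, hC⟩ := isCompact_Icc.exists_bound_of_continuousOn hf
  exact MemLp.of_bound (hf.aestronglyMeasurable measurableSet_Icc) C
    ((ae_restrict_mem measurableSet_Icc).mono hC)

theorem integrable_quadratic {r : ℝ} {S : ℝ → Matrix (Fin n) (Fin n) ℝ}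
    (hS : ∀ a b, ContinuousOn (fun s => S s a b) (Icc (-r) 0)) {φ : ℝ → Fin n → ℝ}
    (hφ : ∀ a, MemLp (fun s => φ s a) 2 (lebIcc r)) (a b : Fin n) :
    Integrable (fun s => φ s a * S s a b * φ s b) (lebIcc r) := by
  have : IntegrableOn (fun s => φ s a * φ s b) (Icc (-r) 0) := (hφ a).integrable_mul (hφ b)
  refine (IntegrableOn.continuousOn_mul (hS a b) this isCompact_Icc).congr (ae_of_all _ fun s => ?_)
  ring

theorem integrable_bilinear {r r' : ℝ} {R : ℝ → ℝ → Matrix (Fin n) (Fin n) ℝ}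
    (hR : ∀ a b, ContinuousOn (fun p : ℝ × ℝ => R p.1 p.2 a b) (Icc (-r) 0 ×ˢ Icc (-r') 0))
    {φ φ' : ℝ → Fin n → ℝ} (hφ : ∀ a, MemLp (fun s => φ s a) 2 (lebIcc r))
    (hφ' : ∀ a, MemLp (fun s => φ' s a) 2 (lebIcc r')) (a b : Fin n) :
    Integrable (fun p : ℝ × ℝ => φ p.1 a * R p.1 p.2 a b * φ' p.2 b)
      ((lebIcc r).prod (lebIcc r')) := by
  have h1 := ((hφ a).integrable one_le_two).mul_prod ((hφ' b).integrable one_le_two)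
  rw [lebIcc_prod] at h1 ⊢
  refine (IntegrableOn.continuousOn_mul (hR a b) h1
    (isCompact_Icc.prod isCompact_Icc)).congr (ae_of_all _ fun s => ?_)
  ring

/-- `P` and each `Sᵢ` enter `L1val` with the same factor `τ_K`, so shifting both by `ε` costs
exactly `ε τ_K` times the squared norm of the state. -/
theorem L1val_sub_smul_one {P : Matrix (Fin n) (Fin n) ℝ}
    {Q S : Fin K → ℝ → Matrix (Fin n) (Fin n) ℝ}
    {R : Fin K → Fin K → ℝ → ℝ → Matrix (Fin n) (Fin n) ℝ} (ε : ℝ) (x : Fin n → ℝ)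
    {φ : Fin K → ℝ → Fin n → ℝ}
    (hφ : ∀ i a, MemLp (fun s => φ i s a) 2 (lebIcc (τ i.succ)))
    (hS : ∀ i a b, Integrable (fun s => φ i s a * S i s a b * φ i s b) (lebIcc (τ i.succ))) :
    L1val τ (P - ε • (1 : Matrix (Fin n) (Fin n) ℝ)) Q
      (fun i s => S i s - ε • (1 : Matrix (Fin n) (Fin n) ℝ)) R x φ =
    L1val τ P Q S R x φ - ε * τ (Fin.last K) *
      (x ⬝ᵥ x + ∑ i, ∫ s, φ i s ⬝ᵥ φ i s ∂(lebIcc (τ i.succ))) := by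
  have e : ∀ (A : Matrix (Fin n) (Fin n) ℝ) (u : Fin n → ℝ),
      u ⬝ᵥ (A - ε • (1 : Matrix (Fin n) (Fin n) ℝ)) *ᵥ u = u ⬝ᵥ A *ᵥ u - ε * (u ⬝ᵥ u) := by
    intro A u
    rw [Matrix.sub_mulVec, Matrix.smul_mulVec, Matrix.one_mulVec, dotProduct_sub, dotProduct_smul,
      smul_eq_mul]
  have e2 : ∀ i, ∫ s, φ i s ⬝ᵥ (S i s - ε • (1 : Matrix (Fin n) (Fin n) ℝ)) *ᵥ φ i s
      ∂(lebIcc (τ i.succ)) = ∫ s, φ i s ⬝ᵥ S i s *ᵥ φ i s ∂(lebIcc (τ i.succ)) -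
      ε * ∫ s, φ i s ⬝ᵥ φ i s ∂(lebIcc (τ i.succ)) := by
    intro i
    simp_rw [e]
    rw [integral_sub (integral_dotProduct_mulVec (hS i)).1
      ((integrable_dotProduct_self (hφ i)).const_mul ε), integral_const_mul]
  unfold L1val
  simp_rw [e2, e]
  have e3 : ∀ i, τ (Fin.last K) * (2 * (∫ s, x ⬝ᵥ Q i s *ᵥ φ i s ∂(lebIcc (τ i.succ))) +
      (∫ s, φ i s ⬝ᵥ S i s *ᵥ φ i s ∂(lebIcc (τ i.succ)) -
      ε * ∫ s, φ i s ⬝ᵥ φ i s ∂(lebIcc (τ i.succ)))) =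
      τ (Fin.last K) * (2 * (∫ s, x ⬝ᵥ Q i s *ᵥ φ i s ∂(lebIcc (τ i.succ))) +
      ∫ s, φ i s ⬝ᵥ S i s *ᵥ φ i s ∂(lebIcc (τ i.succ))) -
      ε * τ (Fin.last K) * ∫ s, φ i s ⬝ᵥ φ i s ∂(lebIcc (τ i.succ)) := fun i => by ring
  simp_rw [e3]
  have e4 := Finset.mul_sum Finset.univ
    (fun i => ∫ s, φ i s ⬝ᵥ φ i s ∂(lebIcc (τ i.succ))) (ε * τ (Fin.last K))
  rw [Finset.sum_sub_distrib, mul_add (ε * τ (Fin.last K)), e4]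
  ring

/-- Coercivity of the operator. The form of `{M, N}` is evaluated at the constant `x` joined with
the glued function; `{F₁, H₁}` drops out, and the shifts of `P` and `Sᵢ` produce the lower bound.
The further shift `-ε I` contributes a nonpositive amount and is discarded. -/
theorem le_L1val_of_memXi (hK : 1 ≤ K) (h0 : τ 0 = 0) (hτ : StrictMono τ) {d : ℕ} {ε : ℝ}
    (hε : 0 < ε) {P : Matrix (Fin n) (Fin n) ℝ} {Q S : Fin K → ℝ → Matrix (Fin n) (Fin n) ℝ}
    {R : Fin K → Fin K → ℝ → ℝ → Matrix (Fin n) (Fin n) ℝ}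
    (hQ : ∀ i a b, ContinuousOn (fun s => Q i s a b) (Icc (-τ i.succ) 0))
    (hS : ∀ i a b, ContinuousOn (fun s => S i s a b) (Icc (-τ i.succ) 0))
    (hR : ∀ i j a b, ContinuousOn (fun p : ℝ × ℝ => R i j p.1 p.2 a b)
      (Icc (-τ i.succ) 0 ×ˢ Icc (-τ j.succ) 0))
    {F₁ : ℝ → Matrix (Fin n ⊕ Fin n) (Fin n ⊕ Fin n) ℝ}
    {H₁ : ℝ → ℝ → Matrix (Fin n ⊕ Fin n) (Fin n ⊕ Fin n) ℝ}
    (hFH₁ : MemTheta (τ (Fin.last K)) F₁ H₁)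
    (hMN : MemXi τ d (Mfun τ ε P Q S F₁) (Nfun τ R H₁))
    (x : Fin n → ℝ) {φ : Fin K → ℝ → Fin n → ℝ}
    (hφ : ∀ i a, MemLp (fun s => φ i s a) 2 (lebIcc (τ i.succ))) :
    ε * τ (Fin.last K) * (x ⬝ᵥ x + ∑ i, ∫ s, φ i s ⬝ᵥ φ i s ∂(lebIcc (τ i.succ))) ≤
      L1val τ P Q S R x φ := by
  have hT := delay_last_pos hK h0 hτ
  have hg := memLp_glue h0 hτ hφ
  have hv : ∀ a, MemLp (fun s => Sum.elim x (glue τ φ s) a) 2 (lebIcc (τ (Fin.last K))) := by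
    rintro (a | a)
    · exact memLp_const _
    · exact hg a
  have hS' : ∀ i a b, ContinuousOn
      (fun s => (S i s - ε • (1 : Matrix (Fin n) (Fin n) ℝ)) a b) (Icc (-τ i.succ) 0) :=
    fun i a b => (hS i a b).sub continuousOn_const
  obtain ⟨i1, e1⟩ := pairForm_L1 h0 hτ (P := P - ε • (1 : Matrix (Fin n) (Fin n) ℝ)) x
    (φ := φ) (Q := Q)
    (fun i a b => IntegrableOn.continuousOn_mul (hQ i a b)
      (by exact (hφ i b).integrable one_le_two) isCompact_Icc)
    (fun i => integrable_quadratic (hS' i) (hφ i))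
    (fun i j => integrable_bilinear (hR i j) (hφ i) (hφ j))
  obtain ⟨i2, e2⟩ := hFH₁.pairForm_eq_zero hT x hg
  have e3 : ∀ s, Sum.elim x (glue τ φ s) ⬝ᵥ
      (-(ε • (1 : Matrix (Fin n ⊕ Fin n) (Fin n ⊕ Fin n) ℝ))) *ᵥ Sum.elim x (glue τ φ s) =
      -(ε * (Sum.elim x (glue τ φ s) ⬝ᵥ Sum.elim x (glue τ φ s))) := by
    intro s
    rw [Matrix.neg_mulVec, Matrix.smul_mulVec, Matrix.one_mulVec, dotProduct_neg, dotProduct_smul,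
      smul_eq_mul]
  have i3 : PairIntegrable (lebIcc (τ (Fin.last K)))
      (fun _ => -(ε • (1 : Matrix (Fin n ⊕ Fin n) (Fin n ⊕ Fin n) ℝ))) (fun _ _ => 0)
      (fun s => Sum.elim x (glue τ φ s)) := by
    constructor
    · simp_rw [e3]
      exact ((integrable_dotProduct_self hv).const_mul ε).neg
    · simp
  obtain ⟨i12, e12⟩ := pairForm_add i1 i2
  have e123 := (pairForm_add i12 i3).2
  have key := hMN.pairForm_nonneg h0 hτ hv
  have hM : Mfun τ ε P Q S F₁ = fun s => L1mult τ (P - ε • (1 : Matrix (Fin n) (Fin n) ℝ)) Q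
      (fun i s => S i s - ε • (1 : Matrix (Fin n) (Fin n) ℝ)) s + F₁ s +
      -(ε • (1 : Matrix (Fin n ⊕ Fin n) (Fin n ⊕ Fin n) ℝ)) := by
    ext1 s; rw [Mfun, sub_eq_add_neg]
  have hN : Nfun τ R H₁ = fun s θ => Matrix.fromBlocks 0 0 0 (L1ker τ R s θ) + H₁ s θ + 0 := by
    ext1 s; ext1 θ; rw [Nfun, add_zero]
  rw [hM, hN, e123, e12, e1, e2, L1val_sub_smul_one ε x hφ
    (fun i => integrable_quadratic (hS i) (hφ i))] at key
  have e4 : pairForm (lebIcc (τ (Fin.last K)))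
      (fun _ => -(ε • (1 : Matrix (Fin n ⊕ Fin n) (Fin n ⊕ Fin n) ℝ))) (fun _ _ => 0)
      (fun s => Sum.elim x (glue τ φ s)) ≤ 0 := by
    unfold pairForm
    simp_rw [e3]
    simp only [Matrix.zero_mulVec, dotProduct_zero, integral_zero, add_zero]
    rw [integral_neg, integral_const_mul]
    have := mul_nonneg hε.le (integral_dotProduct_self_nonneg
      (μ := lebIcc (τ (Fin.last K))) fun s => Sum.elim x (glue τ φ s))
    linarith
  linarith

/-- The lower right block of a spacing multiplier is zero. Testing the pointwise nonnegativity of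
`M(s)` on `(0, x)` therefore isolates `(τ_K / aᵢ)(Sᵢ - ε) - ε`, first almost everywhere and then, by
continuity of `Sᵢ`, at every point including both ends. -/
theorem le_quadratic_of_memXi (hK : 1 ≤ K) (h0 : τ 0 = 0) (hτ : StrictMono τ) {d : ℕ} {ε : ℝ}
    (hε : 0 < ε) {P : Matrix (Fin n) (Fin n) ℝ} {Q S : Fin K → ℝ → Matrix (Fin n) (Fin n) ℝ}
    {R : Fin K → Fin K → ℝ → ℝ → Matrix (Fin n) (Fin n) ℝ}
    (hS : ∀ i a b, ContinuousOn (fun s => S i s a b) (Icc (-τ i.succ) 0))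
    {F₁ : ℝ → Matrix (Fin n ⊕ Fin n) (Fin n ⊕ Fin n) ℝ}
    {H₁ : ℝ → ℝ → Matrix (Fin n ⊕ Fin n) (Fin n ⊕ Fin n) ℝ}
    (hFH₁ : MemTheta (τ (Fin.last K)) F₁ H₁)
    (hMN : MemXi τ d (Mfun τ ε P Q S F₁) (Nfun τ R H₁))
    (i : Fin K) {s : ℝ} (hs : s ∈ Icc (-τ i.succ) 0) (x : Fin n → ℝ) :
    ε * (x ⬝ᵥ x) ≤ x ⬝ᵥ S i s *ᵥ x := by
  have hT := delay_last_pos hK h0 hτ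
  have hi := delay_succ_pos h0 hτ i
  have ha := scale_pos h0 hτ i
  let f : ℝ → ℝ := fun s => x ⬝ᵥ S i s *ᵥ x - ε * (x ⬝ᵥ x)
  have hf : ContinuousOn f (Icc (-τ i.succ) 0) := by
    refine ContinuousOn.sub ?_ continuousOn_const
    simp only [dotProduct, Matrix.mulVec]
    exact continuousOn_finsetSum _ fun a _ => continuousOn_const.mul
      (continuousOn_finsetSum _ fun b _ => (hS i a b).mul continuousOn_const)
  obtain ⟨T, L₁₁, L₁₂, L₂₁, -, -, -, -, -, hF, -⟩ := hFH₁
  have h1 : ∀ᵐ s ∂(volume.restrict (piece τ i)), 0 ≤ f (stretch τ i s) := by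
    have h2 := ae_restrict_of_ae_restrict_of_subset (piece_subset h0 hτ i) hMN.mult_nonneg
    have h3 := ae_restrict_of_ae_restrict_of_subset (piece_subset h0 hτ i) hF
    filter_upwards [h2, h3, ae_restrict_mem (measurableSet_piece i)] with s h2 h3 hs
    obtain ⟨X, Y, Z, h4⟩ : ∃ X Y Z, F₁ s = Matrix.fromBlocks X Y Z 0 := ⟨_, _, _, h3⟩
    have key := h2 (Sum.elim 0 x)
    rw [Mfun, L1mult, sum_indicator_piece_of_mem hτ hs, h4, Matrix.sub_mulVec, Matrix.add_mulVec,
      Matrix.smul_mulVec, Matrix.one_mulVec, Matrix.fromBlocks_mulVec, Matrix.fromBlocks_mulVec,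
      dotProduct_sub, dotProduct_add, dotProduct_smul] at key
    simp only [sumElim_dotProduct_sumElim, Sum.elim_comp_inr, Sum.elim_comp_inl, zero_dotProduct,
      zero_add, Matrix.mulVec_zero, Matrix.zero_mulVec, dotProduct_zero, add_zero,
      Matrix.smul_mulVec, Matrix.sub_mulVec, dotProduct_smul, dotProduct_sub, Matrix.one_mulVec,
      smul_eq_mul] at key
    have hxx : 0 ≤ x ⬝ᵥ x := by simpa using dotProduct_star_self_nonneg x
    have h4 : 0 ≤ τ (Fin.last K) / scale τ i * f (stretch τ i s) := by
      simp only [f]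
      have := mul_nonneg hε.le hxx
      linarith
    exact nonneg_of_mul_nonneg_right h4 (div_pos hT ha)
  have h5 : ∀ᵐ s ∂(lebIcc (τ i.succ)), 0 ≤ f s := by
    have h6 := (measurableEmbedding_stretch h0 hτ i).ae_map_iff
      (μ := volume.restrict (piece τ i)) (p := fun s => 0 ≤ f s)
    rw [(measurePreserving_stretch h0 hτ i).map_eq] at h6
    exact (Measure.ae_ennreal_smul_measure_iff (by simpa using ha)).1 (h6.2 h1)
  -- Nonnegativity almost everywhere is recast as `f = |f|` almost everywhere, an equality of
  -- continuous functions, which then holds everywhere.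
  have h7 := Measure.eqOn_Icc_of_ae_eq volume (by linarith : -τ i.succ ≠ 0)
    (f := f) (g := fun s => |f s|) (h5.mono fun s hs => (abs_of_nonneg hs).symm) hf hf.abs hs
  have : 0 ≤ f s := by rw [h7]; exact abs_nonneg _
  simp only [f] at this
  linarith

/-- Here `Sᵢ'` and `Gᵢⱼ` are merely square integrable, so `φ` is taken continuous: bounded factors
keep the quadratic terms integrable. The vector `w` is free and is later filled with boundary values
of `φ`. -/
theorem L1val_nonpos_of_memXi (hK : 1 ≤ K) (h0 : τ 0 = 0) (hτ : StrictMono τ)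
    {A₀ : Matrix (Fin n) (Fin n) ℝ} {A : Fin K → Matrix (Fin n) (Fin n) ℝ} {d : ℕ} {ε : ℝ}
    {P : Matrix (Fin n) (Fin n) ℝ}
    {Q Q' S S' : Fin K → ℝ → Matrix (Fin n) (Fin n) ℝ}
    {R R₁ R₂ : Fin K → Fin K → ℝ → ℝ → Matrix (Fin n) (Fin n) ℝ}
    (hQ : ∀ i, MemW2Interval (τ i.succ) (Q i) (Q' i))
    (hS : ∀ i, MemW2Interval (τ i.succ) (S i) (S' i))
    (hR : ∀ i j, MemW2Rect (τ i.succ) (τ j.succ) (R i j) (R₁ i j) (R₂ i j))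
    {F₂ : ℝ → Matrix ((Fin n ⊕ Fin n × Fin K) ⊕ Fin n) ((Fin n ⊕ Fin n × Fin K) ⊕ Fin n) ℝ}
    {H₂ : ℝ → ℝ → Matrix ((Fin n ⊕ Fin n × Fin K) ⊕ Fin n) ((Fin n ⊕ Fin n × Fin K) ⊕ Fin n) ℝ}
    (hFH₂ : MemTheta (τ (Fin.last K)) F₂ H₂)
    (hDE : MemXi τ d (fun s => -Dfun τ A₀ A ε P Q Q' S S' R F₂ s)
      (fun s θ => -Efun τ R₁ R₂ H₂ s θ))
    (w : Fin n ⊕ Fin n × Fin K → ℝ) {φ : Fin K → ℝ → Fin n → ℝ}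
    (hφ : ∀ i a, ContinuousOn (fun s => φ i s a) (Icc (-τ i.succ) 0)) :
    L1val τ (D1 τ A₀ A ε P Q S) (V τ A₀ A Q Q' R)
      (fun i s => S' i s + ε • (1 : Matrix (Fin n) (Fin n) ℝ)) (G R₁ R₂) w φ ≤ 0 := by
  have hT := delay_last_pos hK h0 hτ
  have hφ2 : ∀ i a, MemLp (fun s => φ i s a) 2 (lebIcc (τ i.succ)) := fun i a =>
    memLp_of_continuousOn (hφ i a)
  have hg := memLp_glue h0 hτ hφ2
  have hv : ∀ a, MemLp (fun s => Sum.elim w (glue τ φ s) a) 2 (lebIcc (τ (Fin.last K))) := by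
    rintro (a | a)
    · exact memLp_const _
    · exact hg a
  have iV : ∀ i a b, IntegrableOn (fun s => V τ A₀ A Q Q' R i s a b) (Icc (-τ i.succ) 0) := by
    rintro i (a | a) b
    · simp only [V, Matrix.fromRows_apply_inl, B, Matrix.add_apply, Matrix.mul_apply,
        Matrix.sum_apply]
      refine (Integrable.add ?_ ((hQ i a b).2.1.integrable one_le_two)).add ?_
      · exact integrable_finsetSum _ fun c _ =>
          (((hQ i c b).1.integrableOn_compact isCompact_Icc).const_mul _)
      · refine integrable_finsetSum _ fun j _ => integrable_finsetSum _ fun c _ =>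
          Integrable.const_mul ?_ _
        refine ContinuousOn.integrableOn_compact isCompact_Icc ?_
        -- The trace `Rⱼᵢ(-τⱼ, ·)` on an edge of the rectangle makes sense because `R` is the
        -- continuous representative.
        refine (hR j i c b).1.comp (f := fun s => (-τ j.succ, s)) (by fun_prop) fun s hs => ?_
        exact ⟨⟨le_rfl, by linarith [delay_succ_pos h0 hτ j]⟩, hs⟩
    · simp [V]
  have iS : ∀ i a b, IntegrableOn
      (fun s => (S' i s + ε • (1 : Matrix (Fin n) (Fin n) ℝ)) a b) (Icc (-τ i.succ) 0) :=
    fun i a b => ((hS i a b).2.1.integrable one_le_two).add (integrable_const _)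
  have iG : ∀ i j a b, IntegrableOn (fun p : ℝ × ℝ => G R₁ R₂ i j p.1 p.2 a b)
      (Icc (-τ i.succ) 0 ×ˢ Icc (-τ j.succ) 0) := fun i j a b => by
    have hf : IsFiniteMeasure ((volume : Measure (ℝ × ℝ)).restrict
        (Icc (-τ i.succ) 0 ×ˢ Icc (-τ j.succ) 0)) := by
      rw [← lebIcc_prod]; infer_instance
    exact ((hR i j a b).2.1.integrable one_le_two).add ((hR i j a b).2.2.1.integrable one_le_two)
  obtain ⟨i1, e1⟩ := pairForm_L1 h0 hτ (P := D1 τ A₀ A ε P Q S) w (φ := φ)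
    (Q := V τ A₀ A Q Q' R) (S := fun i s => S' i s + ε • (1 : Matrix (Fin n) (Fin n) ℝ))
    (R := G R₁ R₂)
    (fun i a b => (iV i a b).mul_continuousOn (hφ i b) isCompact_Icc)
    (fun i a b => (IntegrableOn.continuousOn_mul (hφ i a) (iS i a b) isCompact_Icc).mul_continuousOn
      (hφ i b) isCompact_Icc)
    (fun i j a b => by
      rw [lebIcc_prod]
      have hc := isCompact_Icc (a := -τ i.succ) (b := (0 : ℝ)) |>.prod
        (isCompact_Icc (a := -τ j.succ) (b := (0 : ℝ)))
      refine (IntegrableOn.continuousOn_mul ?_ (iG i j a b) hc).mul_continuousOn ?_ hc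
      · exact (hφ i a).comp continuousOn_fst fun p hp => hp.1
      · exact (hφ j b).comp continuousOn_snd fun p hp => hp.2)
  obtain ⟨i2, e2⟩ := hFH₂.pairForm_eq_zero hT w hg
  have key := hDE.pairForm_nonneg h0 hτ hv
  rw [pairForm_neg] at key
  have e12 := (pairForm_add i1 i2).2
  rw [e1, e2, add_zero] at e12
  have : pairForm (lebIcc (τ (Fin.last K))) (Dfun τ A₀ A ε P Q Q' S S' R F₂) (Efun τ R₁ R₂ H₂)
      (fun s => Sum.elim w (glue τ φ s)) = L1val τ (D1 τ A₀ A ε P Q S) (V τ A₀ A Q Q' R)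
      (fun i s => S' i s + ε • (1 : Matrix (Fin n) (Fin n) ℝ)) (G R₁ R₂) w φ := e12
  linarith

end Inequalities


/-! ### Weak derivatives, absolute continuity and parameter integrals -/

section WeakDerivatives

/-- Smooth functions with compact support in `U`. -/
def IsTest {E : Type*} [NormedAddCommGroup E] [NormedSpace ℝ E] (U : Set E) (ψ : E → ℝ) : Prop :=
  ContDiff ℝ ∞ ψ ∧ HasCompactSupport ψ ∧ tsupport ψ ⊆ U

theorem ae_eq_zero_of_forall_test {E : Type*} [NormedAddCommGroup E] [NormedSpace ℝ E]
    [FiniteDimensional ℝ E] [MeasureSpace E] [BorelSpace E] {U : Set E} (hU : IsOpen U)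
    {f : E → ℝ} (hf : IntegrableOn f U) (h : ∀ ψ, IsTest U ψ → ∫ x in U, f x * ψ x = 0) :
    ∀ᵐ x ∂(volume.restrict U), f x = 0 := by
  have := hU.ae_eq_zero_of_integral_contDiff_smul_eq_zero (μ := volume.restrict U) (f := f)
    (hf.locallyIntegrable.locallyIntegrableOn U) (fun ψ h1 h2 h3 => by
      simpa only [smul_eq_mul, mul_comm] using h ψ ⟨h1, h2, h3⟩)
  filter_upwards [this, ae_restrict_mem hU.measurableSet] with x h1 h2 using h1 h2

theorem exists_Icc_of_isCompact_subset_Ioo {a b : ℝ} (hab : a < b) {k : Set ℝ} (hk : IsCompact k)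
    (hs : k ⊆ Ioo a b) : ∃ a' b', a < a' ∧ b' < b ∧ k ⊆ Icc a' b' := by
  rcases k.eq_empty_or_nonempty with rfl | hne
  · exact ⟨(a + b) / 2, (a + b) / 2, by linarith, by linarith, empty_subset _⟩
  · obtain ⟨u, hu, hu'⟩ := hk.exists_isLeast hne
    obtain ⟨v, hv, hv'⟩ := hk.exists_isGreatest hne
    exact ⟨u, v, (hs hu).1, (hs hv).2, fun x hx => ⟨hu' hx, hv' hx⟩⟩

/-- The primitive starting at `a` vanishes to the left of the support of `q`, and zero mean makes it
vanish to the right as well. -/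
theorem exists_test_antideriv {a b : ℝ} (hab : a < b) {q : ℝ → ℝ} (hq : IsTest (Ioo a b) q)
    (h0 : ∫ x, q x = 0) : ∃ ψ, IsTest (Ioo a b) ψ ∧ deriv ψ = q := by
  obtain ⟨a', b', ha, hb, hk⟩ := exists_Icc_of_isCompact_subset_Ioo hab hq.2.1.isCompact hq.2.2
  have hz : ∀ x, x ∉ Icc a' b' → q x = 0 := fun x hx =>
    image_eq_zero_of_notMem_tsupport fun h => hx (hk h)
  have hc := hq.1.continuous
  have hd : ∀ x, HasDerivAt (fun x => ∫ t in a..x, q t) (q x) x := fun x =>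
    intervalIntegral.integral_hasDerivAt_right (hc.intervalIntegrable _ _)
      (hc.stronglyMeasurableAtFilter _ _) hc.continuousAt
  have hd' : deriv (fun x => ∫ t in a..x, q t) = q := funext fun x => (hd x).deriv
  have hsupp : Function.support (fun x => ∫ t in a..x, q t) ⊆ Icc a' b' := by
    intro x hx
    by_contra hn
    refine hx ?_
    rw [mem_Icc, not_and_or, not_le, not_le] at hn
    rcases hn with hn | hn
    · refine intervalIntegral.integral_zero_ae (ae_of_all _ fun t ht => hz t fun h => ?_)
      have := (uIoc_subset_uIcc ht).2
      have := h.1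
      have : max a x < a' := max_lt ha hn
      linarith
    · dsimp only
      rw [intervalIntegral.integral_eq_integral_of_support_subset, h0]
      intro t ht
      have : t ∈ Icc a' b' := by by_contra h; exact ht (hz t h)
      exact ⟨ha.trans_le this.1, this.2.trans hn.le⟩
  have hts : tsupport (fun x => ∫ t in a..x, q t) ⊆ Icc a' b' := closure_minimal hsupp isClosed_Icc
  refine ⟨_, ⟨?_, HasCompactSupport.of_support_subset_isCompact isCompact_Icc hsupp,
    hts.trans fun x hx => ⟨ha.trans_le hx.1, hx.2.trans_lt hb⟩⟩, hd'⟩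
  rw [contDiff_infty_iff_deriv, hd']
  exact ⟨fun x => (hd x).differentiableAt, hq.1⟩

theorem setIntegral_eq_integral_of_isTest {U : Set ℝ} {ψ : ℝ → ℝ} (h : IsTest U ψ)
    (f : ℝ → ℝ) : ∫ x in U, f x * ψ x = ∫ x, f x * ψ x :=
  setIntegral_eq_integral_of_forall_compl_eq_zero fun x hx => by
    rw [image_eq_zero_of_notMem_tsupport fun h' => hx (h.2.2 h'), mul_zero]

/-- The du Bois-Reymond lemma. Subtracting from a test function a multiple of a fixed bump of
integral one leaves a function of zero mean, hence the derivative of a test function; so `F` minus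
its average against the bump is orthogonal to every test function. Continuity removes the
exceptional null set. -/
theorem eq_const_of_integral_mul_deriv_eq_zero {a b : ℝ} (hab : a < b) {F : ℝ → ℝ}
    (hF : ContinuousOn F (Icc a b))
    (h : ∀ ψ, IsTest (Ioo a b) ψ → ∫ x in Ioo a b, F x * deriv ψ x = 0) :
    ∃ c, ∀ x ∈ Icc a b, F x = c := by
  have hFi : IntegrableOn F (Ioo a b) :=
    (hF.integrableOn_compact isCompact_Icc).mono_set Ioo_subset_Icc_self
  -- Any radii below half the length of the interval would do; these keep the closed support inside
  -- `Ioo a b`.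
  let bump : ContDiffBump ((a + b) / 2) :=
    ⟨(b - a) / 8, (b - a) / 4, by linarith, by linarith⟩
  let η : ℝ → ℝ := bump.normed volume
  have hη : IsTest (Ioo a b) η := by
    refine ⟨bump.contDiff_normed, bump.hasCompactSupport_normed, ?_⟩
    rw [bump.tsupport_normed_eq, Real.closedBall_eq_Icc]
    intro x hx
    have h1 : bump.rOut = (b - a) / 4 := rfl
    have h2 := hx.1
    have h3 := hx.2
    rw [h1] at h2 h3
    exact ⟨by linarith, by linarith⟩
  have hmul : ∀ ψ, IsTest (Ioo a b) ψ → IntegrableOn (fun x => F x * ψ x) (Ioo a b) := by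
    intro ψ hψ
    obtain ⟨C, hC⟩ := hψ.2.1.exists_bound_of_continuous hψ.1.continuous
    exact hFi.mul_bdd (c := C) hψ.1.continuous.aestronglyMeasurable (ae_of_all _ hC)
  let c := ∫ x in Ioo a b, F x * η x
  have key : ∀ ψ, IsTest (Ioo a b) ψ → ∫ x in Ioo a b, (F x - c) * ψ x = 0 := by
    intro ψ hψ
    let I := ∫ x, ψ x
    have hIη : IsTest (Ioo a b) fun x => I * η x :=
      ⟨contDiff_const.mul hη.1, hη.2.1.mul_left,
        (tsupport_mul_subset_right (f := fun _ => I)).trans hη.2.2⟩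
    have hq : IsTest (Ioo a b) fun x => ψ x - I * η x := by
      refine ⟨hψ.1.sub hIη.1, hψ.2.1.sub hIη.2.1, ?_⟩
      exact (tsupport_sub ψ fun x => I * η x).trans (union_subset hψ.2.2 hIη.2.2)
    have iψ : Integrable ψ := hψ.1.continuous.integrable_of_hasCompactSupport hψ.2.1
    obtain ⟨p, hp, hp'⟩ := exists_test_antideriv hab hq (by
      rw [integral_sub iψ ((bump.integrable_normed).const_mul I), integral_const_mul,
        bump.integral_normed, mul_one, sub_self])
    have h1 := h p hp
    rw [hp'] at h1
    have e1 : ∀ x, F x * (ψ x - I * η x) = F x * ψ x - I * (F x * η x) := fun x => by ring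
    simp_rw [e1] at h1
    rw [integral_sub (hmul ψ hψ) ((hmul η hη).const_mul I), integral_const_mul] at h1
    have hI : I = ∫ x in Ioo a b, ψ x := by
      simpa using (setIntegral_eq_integral_of_isTest hψ fun _ => 1).symm
    simp_rw [sub_mul]
    rw [integral_sub (hmul ψ hψ) (iψ.integrableOn.const_mul c), integral_const_mul, ← hI]
    linarith
  have hz := ae_eq_zero_of_forall_test (f := fun x => F x - c) isOpen_Ioo
    (hFi.sub (integrableOn_const (by simp))) key
  refine ⟨c, fun x hx => ?_⟩
  rw [restrict_Ioo_eq_restrict_Icc] at hz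
  exact Measure.eqOn_Icc_of_ae_eq volume hab.ne (f := F) (g := fun _ => c)
    (hz.mono fun x hx => sub_eq_zero.1 hx) hF continuousOn_const hx

theorem absolutelyContinuousOnInterval_congr {a b : ℝ} {f g : ℝ → ℝ}
    (h : ∀ x ∈ uIcc a b, f x = g x) (hf : AbsolutelyContinuousOnInterval f a b) :
    AbsolutelyContinuousOnInterval g a b := by
  rw [absolutelyContinuousOnInterval_iff] at hf ⊢
  intro ε hε
  obtain ⟨δ, hδ, H⟩ := hf ε hε
  refine ⟨δ, hδ, fun E hE hlt => ?_⟩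
  convert! H E hE hlt using 1
  refine Finset.sum_congr rfl fun i hi => ?_
  rw [h _ (hE.1 i hi).1, h _ (hE.1 i hi).2]

/-- The primitive of `g` is absolutely continuous, so integration by parts shows that `f` minus the
primitive has zero weak derivative and is constant. As `f` is continuous, the identity holds up to
the end points, which the boundary terms will need; the pointwise derivative comes from Lebesgue
differentiation. -/
theorem absolutelyContinuous_of_isWeakDeriv {a b : ℝ} (hab : a < b) {f g : ℝ → ℝ}
    (hf : ContinuousOn f (Icc a b)) (hg : IntegrableOn g (Icc a b))
    (h : IsWeakDeriv (Ioo a b) 1 f g) :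
    AbsolutelyContinuousOnInterval f a b ∧
      ∀ᵐ x ∂(volume.restrict (Icc a b)), HasDerivAt f (g x) x := by
  have hgi : IntervalIntegrable g volume a b :=
    (intervalIntegrable_iff_integrableOn_Icc_of_le hab.le).2 hg
  have hGac : AbsolutelyContinuousOnInterval (fun x => ∫ t in a..x, g t) a b :=
    hgi.absolutelyContinuousOnInterval_intervalIntegral left_mem_uIcc
  have hGd := hgi.ae_hasDerivAt_integral
  have hGc := hGac.continuousOn
  rw [uIcc_of_le hab.le] at hGc hGd
  obtain ⟨c, hc⟩ := eq_const_of_integral_mul_deriv_eq_zero hab (hf.sub hGc) (by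
    intro ψ hψ
    have h1 := h ψ hψ.1 hψ.2.1 hψ.2.2
    simp only [fderiv_apply_one_eq_deriv] at h1
    have hψac : AbsolutelyContinuousOnInterval ψ a b :=
      (hψ.1.contDiffOn.of_le (by exact_mod_cast le_top)).absolutelyContinuousOnInterval
    have h2 := hGac.integral_mul_deriv_eq_deriv_mul hψac
    have ha : ψ a = 0 := image_eq_zero_of_notMem_tsupport fun h' => (hψ.2.2 h').1.false
    have hb : ψ b = 0 := image_eq_zero_of_notMem_tsupport fun h' => (hψ.2.2 h').2.false
    rw [ha, hb, mul_zero, mul_zero, sub_zero, zero_sub,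
      intervalIntegral.integral_of_le hab.le, intervalIntegral.integral_of_le hab.le,
      restrict_Ioc_eq_restrict_Icc, ← restrict_Ioo_eq_restrict_Icc] at h2
    have h3 : ∫ x in Ioo a b, deriv (fun x => ∫ t in a..x, g t) x * ψ x =
        ∫ x in Ioo a b, g x * ψ x := by
      refine integral_congr_ae ?_
      filter_upwards [ae_restrict_of_ae hGd, ae_restrict_mem measurableSet_Ioo] with x h4 h5
      rw [(h4 (Ioo_subset_Icc_self h5) a (left_mem_Icc.2 hab.le)).deriv]
    rw [h3] at h2
    have hdc : ContinuousOn (deriv ψ) (Icc a b) :=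
      (contDiff_infty_iff_deriv.1 hψ.1).2.continuous.continuousOn
    simp only [Pi.sub_apply, sub_mul]
    rw [integral_sub, h1, h2]
    · ring
    · exact ((hf.mul hdc).integrableOn_compact isCompact_Icc).mono_set Ioo_subset_Icc_self
    · exact ((hGc.mul hdc).integrableOn_compact isCompact_Icc).mono_set Ioo_subset_Icc_self)
  have hfe : ∀ x ∈ Icc a b, (∫ t in a..x, g t) + c = f x := fun x hx => by
    have := hc x hx
    simp only [Pi.sub_apply] at this
    linarith
  have hcac : AbsolutelyContinuousOnInterval (fun _ : ℝ => c) a b :=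
    (contDiff_const.contDiffOn (n := 1)).absolutelyContinuousOnInterval
  refine ⟨absolutelyContinuousOnInterval_congr (f := fun x => (∫ t in a..x, g t) + c) ?_
    (hGac.add hcac), ?_⟩
  · rwa [uIcc_of_le hab.le]
  · rw [← restrict_Ioo_eq_restrict_Icc]
    filter_upwards [ae_restrict_of_ae hGd, ae_restrict_mem measurableSet_Ioo] with x h4 h5
    have h6 := (h4 (Ioo_subset_Icc_self h5) a (left_mem_Icc.2 hab.le)).add_const c
    refine h6.congr_of_eventuallyEq ?_
    filter_upwards [isOpen_Ioo.mem_nhds h5] with y hy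
    exact (hfe y (Ioo_subset_Icc_self hy)).symm

theorem restrict_Ioo_prod (r r' : ℝ) :
    (volume : Measure (ℝ × ℝ)).restrict (Ioo (-r) 0 ×ˢ Ioo (-r') 0) =
      (lebIcc r).prod (lebIcc r') := by
  rw [lebIcc_prod, Measure.volume_eq_prod, ← Measure.prod_restrict, ← Measure.prod_restrict,
    restrict_Ioo_eq_restrict_Icc, restrict_Ioo_eq_restrict_Icc]

theorem isTest_prod {U U' : Set ℝ} {ψ χ : ℝ → ℝ} (hψ : IsTest U ψ) (hχ : IsTest U' χ) :
    IsTest (U ×ˢ U') fun p : ℝ × ℝ => ψ p.1 * χ p.2 := by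
  have hs : Function.support (fun p : ℝ × ℝ => ψ p.1 * χ p.2) ⊆ tsupport ψ ×ˢ tsupport χ := by
    intro p hp
    exact ⟨subset_tsupport _ (left_ne_zero_of_mul hp), subset_tsupport _ (right_ne_zero_of_mul hp)⟩
  refine ⟨(hψ.1.comp contDiff_fst).mul (hχ.1.comp contDiff_snd),
    HasCompactSupport.of_support_subset_isCompact (hψ.2.1.isCompact.prod hχ.2.1.isCompact) hs, ?_⟩
  exact (closure_minimal hs ((isClosed_tsupport _).prod (isClosed_tsupport _))).trans
    (prod_mono hψ.2.2 hχ.2.2)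

theorem fderiv_prod_apply_left {ψ χ : ℝ → ℝ} (hψ : Differentiable ℝ ψ) (hχ : Differentiable ℝ χ)
    (p : ℝ × ℝ) : fderiv ℝ (fun p : ℝ × ℝ => ψ p.1 * χ p.2) p (1, 0) = deriv ψ p.1 * χ p.2 := by
  have h1 : HasFDerivAt (fun p : ℝ × ℝ => ψ p.1) _ p :=
    (hψ p.1).hasFDerivAt.comp p hasFDerivAt_fst
  have h2 : HasFDerivAt (fun p : ℝ × ℝ => χ p.2) _ p :=
    (hχ p.2).hasFDerivAt.comp p hasFDerivAt_snd
  rw [HasFDerivAt.fderiv (f := fun p : ℝ × ℝ => ψ p.1 * χ p.2) (h1.mul h2)]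
  simp [mul_comm]

theorem continuousOn_integral_mul {r r' : ℝ} {R : ℝ → ℝ → ℝ}
    (hR : ContinuousOn (fun p : ℝ × ℝ => R p.1 p.2) (Icc (-r) 0 ×ˢ Icc (-r') 0)) {z : ℝ → ℝ}
    (hz : Integrable z (lebIcc r')) :
    ContinuousOn (fun s => ∫ θ, R s θ * z θ ∂(lebIcc r')) (Icc (-r) 0) := by
  obtain ⟨C, hC⟩ := (isCompact_Icc.prod isCompact_Icc).exists_bound_of_continuousOn hR
  refine continuousOn_of_dominated (bound := fun θ => C * |z θ|) ?_ ?_ (hz.abs.const_mul C) ?_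
  · intro s hs
    have : ContinuousOn (R s) (Icc (-r') 0) :=
      hR.comp (f := fun θ => (s, θ)) (by fun_prop) fun θ hθ => ⟨hs, hθ⟩
    exact (this.aestronglyMeasurable measurableSet_Icc).mul hz.aestronglyMeasurable
  · intro s hs
    filter_upwards [ae_restrict_mem measurableSet_Icc] with θ hθ
    rw [norm_mul]
    exact mul_le_mul_of_nonneg_right (hC (s, θ) ⟨hs, hθ⟩) (norm_nonneg _)
  · filter_upwards [ae_restrict_mem measurableSet_Icc] with θ hθ
    exact (hR.comp (f := fun s => (s, θ)) (by fun_prop) fun s hs => ⟨hs, hθ⟩).mul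
      continuousOn_const

/-- Differentiation under the integral with a merely square-integrable weight `z`. Testing the weak
derivative on products `ψ(s) χ(θ)` and varying `χ` gives `∫ (R ψ' + R' ψ) ds = 0` for almost every
`θ`; multiplying by `z(θ)` and using Fubini finishes, without approximating `z` by smooth functions.
-/
theorem isWeakDeriv_integral_mul {r r' : ℝ} {R R' : ℝ → ℝ → ℝ}
    (hR : ContinuousOn (fun p : ℝ × ℝ => R p.1 p.2) (Icc (-r) 0 ×ˢ Icc (-r') 0))
    (hR' : MemLp (fun p : ℝ × ℝ => R' p.1 p.2) 2 ((lebIcc r).prod (lebIcc r')))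
    (h : IsWeakDeriv (Ioo (-r) 0 ×ˢ Ioo (-r') 0) ((1, 0) : ℝ × ℝ) (fun p => R p.1 p.2)
      (fun p => R' p.1 p.2)) {z : ℝ → ℝ} (hz : MemLp z 2 (lebIcc r')) :
    ContinuousOn (fun s => ∫ θ, R s θ * z θ ∂(lebIcc r')) (Icc (-r) 0) ∧
    Integrable (fun s => ∫ θ, R' s θ * z θ ∂(lebIcc r')) (lebIcc r) ∧
    IsWeakDeriv (Ioo (-r) 0) 1 (fun s => ∫ θ, R s θ * z θ ∂(lebIcc r'))
      (fun s => ∫ θ, R' s θ * z θ ∂(lebIcc r')) := by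
  have hz1 : Integrable z (lebIcc r') := hz.integrable one_le_two
  obtain ⟨C, hC⟩ := (isCompact_Icc.prod isCompact_Icc).exists_bound_of_continuousOn hR
  have hRi : Integrable (fun p : ℝ × ℝ => R p.1 p.2) ((lebIcc r).prod (lebIcc r')) := by
    rw [lebIcc_prod]; exact hR.integrableOn_compact (isCompact_Icc.prod isCompact_Icc)
  have hR2 : MemLp (fun p : ℝ × ℝ => R p.1 p.2) 2 ((lebIcc r).prod (lebIcc r')) := by
    refine MemLp.of_bound hRi.aestronglyMeasurable C ?_
    rw [lebIcc_prod]
    exact (ae_restrict_mem (measurableSet_Icc.prod measurableSet_Icc)).mono hC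
  refine ⟨?_, ?_, ?_⟩
  · exact continuousOn_integral_mul hR hz1
  · exact (hR'.integrable_mul (hz.comp_snd _)).integral_prod_left
  · intro ψ h1 h2 h3
    have hψ : IsTest (Ioo (-r) 0) ψ := ⟨h1, h2, h3⟩
    have hψd := (contDiff_infty_iff_deriv.1 h1)
    simp only [fderiv_apply_one_eq_deriv, restrict_Ioo_eq_restrict_Icc]
    obtain ⟨B, hB⟩ := h2.exists_bound_of_continuous h1.continuous
    obtain ⟨B', hB'⟩ := h2.deriv.exists_bound_of_continuous hψd.2.continuous
    have bψ : MemLp (fun p : ℝ × ℝ => ψ p.1) ⊤ ((lebIcc r).prod (lebIcc r')) :=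
      memLp_top_of_bound (h1.continuous.comp continuous_fst).aestronglyMeasurable B
        (ae_of_all _ fun p => hB p.1)
    have bψ' : MemLp (fun p : ℝ × ℝ => deriv ψ p.1) ⊤ ((lebIcc r).prod (lebIcc r')) :=
      memLp_top_of_bound (hψd.2.continuous.comp continuous_fst).aestronglyMeasurable B'
        (ae_of_all _ fun p => hB' p.1)
    have m1 : MemLp (fun p : ℝ × ℝ => R p.1 p.2 * deriv ψ p.1) 2 ((lebIcc r).prod (lebIcc r')) :=
      bψ'.mul hR2
    have m2 : MemLp (fun p : ℝ × ℝ => R' p.1 p.2 * ψ p.1) 2 ((lebIcc r).prod (lebIcc r')) :=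
      bψ.mul hR'
    have m3 : MemLp (fun p : ℝ × ℝ => R p.1 p.2 * deriv ψ p.1 + R' p.1 p.2 * ψ p.1) 2
        ((lebIcc r).prod (lebIcc r')) := m1.add m2
    -- The defect of the weak-derivative identity on the slice at height `θ`.
    let m : ℝ → ℝ := fun θ => ∫ s, (R s θ * deriv ψ s + R' s θ * ψ s) ∂(lebIcc r)
    have hm : ∀ᵐ θ ∂(volume.restrict (Ioo (-r') 0)), m θ = 0 := by
      refine ae_eq_zero_of_forall_test isOpen_Ioo ?_ ?_
      · rw [IntegrableOn, restrict_Ioo_eq_restrict_Icc]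
        exact (m3.integrable one_le_two).integral_prod_right
      · intro χ hχ
        obtain ⟨D, hD⟩ := hχ.2.1.exists_bound_of_continuous hχ.1.continuous
        have hχ2 : MemLp χ 2 (lebIcc r') :=
          MemLp.of_bound hχ.1.continuous.aestronglyMeasurable D (ae_of_all _ hD)
        rw [restrict_Ioo_eq_restrict_Icc]
        have := (integral_prod_mul_snd
          (L := fun s θ => R s θ * deriv ψ s + R' s θ * ψ s) m3 hχ2).2.2
        rw [← this]
        obtain ⟨t1, t2, t3⟩ := isTest_prod hψ hχ
        have h4 := h _ t1 t2 t3
        simp only [fderiv_prod_apply_left hψd.1 (hχ.1.differentiable (by simp)),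
          restrict_Ioo_prod] at h4
        have i1 := m1.integrable_mul (hχ2.comp_snd (lebIcc r))
        have i2 := m2.integrable_mul (hχ2.comp_snd (lebIcc r))
        have e : ∀ p : ℝ × ℝ, (R p.1 p.2 * deriv ψ p.1 + R' p.1 p.2 * ψ p.1) * χ p.2 =
            (R p.1 p.2 * deriv ψ p.1) * χ p.2 + (R' p.1 p.2 * ψ p.1) * χ p.2 := fun p => by ring
        simp_rw [e]
        rw [integral_add (by exact i1) (by exact i2)]
        simp_rw [← mul_assoc] at h4
        rw [h4, neg_add_cancel]
    rw [restrict_Ioo_eq_restrict_Icc] at hm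
    have h5 := (integral_prod_mul_snd
          (L := fun s θ => R s θ * deriv ψ s + R' s θ * ψ s) m3 hz).2.2
    have h6 : ∫ θ, m θ * z θ ∂(lebIcc r') = 0 := by
      rw [integral_congr_ae (hm.mono fun θ h => by rw [h, zero_mul] : _ =ᵐ[_] fun _ => (0 : ℝ)),
        integral_zero]
    have i1 := m1.integrable_mul (hz.comp_snd (lebIcc r))
    have i2 := m2.integrable_mul (hz.comp_snd (lebIcc r))
    have h7 : ∀ s, (∫ θ, R s θ * z θ ∂(lebIcc r')) * deriv ψ s =
        ∫ θ, (R s θ * deriv ψ s) * z θ ∂(lebIcc r') := fun s => by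
      rw [← integral_mul_const]; congr 1; ext θ; ring
    have h8 : ∀ s, (∫ θ, R' s θ * z θ ∂(lebIcc r')) * ψ s =
        ∫ θ, (R' s θ * ψ s) * z θ ∂(lebIcc r') := fun s => by
      rw [← integral_mul_const]; congr 1; ext θ; ring
    simp_rw [h7, h8]
    rw [← integral_prod (fun p : ℝ × ℝ => (R p.1 p.2 * deriv ψ p.1) * z p.2) i1,
      ← integral_prod (fun p : ℝ × ℝ => (R' p.1 p.2 * ψ p.1) * z p.2) i2, eq_neg_iff_add_eq_zero,
      ← integral_add (by exact i1) (by exact i2)]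
    rw [← h6, ← h5]
    congr 1; ext p; ring

/-- Uniqueness of weak derivatives, with the test function reflected along with the arguments. It
transfers the symmetry `Rᵢⱼ(s, θ) = Rⱼᵢ(θ, s)ᵀ` to the partial derivatives, which are given only as
`L²` functions. -/
theorem ae_eq_swap_of_isWeakDeriv {r r' : ℝ} {R R₁ T T₂ : ℝ → ℝ → ℝ}
    (hR₁ : MemLp (fun p : ℝ × ℝ => R₁ p.1 p.2) 2 ((lebIcc r).prod (lebIcc r')))
    (hT₂ : MemLp (fun p : ℝ × ℝ => T₂ p.1 p.2) 2 ((lebIcc r').prod (lebIcc r)))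
    (hR : IsWeakDeriv (Ioo (-r) 0 ×ˢ Ioo (-r') 0) ((1, 0) : ℝ × ℝ) (fun p => R p.1 p.2)
      (fun p => R₁ p.1 p.2))
    (hT : IsWeakDeriv (Ioo (-r') 0 ×ˢ Ioo (-r) 0) ((0, 1) : ℝ × ℝ) (fun p => T p.1 p.2)
      (fun p => T₂ p.1 p.2))
    (h : ∀ s ∈ Icc (-r) 0, ∀ θ ∈ Icc (-r') 0, R s θ = T θ s) :
    ∀ᵐ p ∂((lebIcc r).prod (lebIcc r')), R₁ p.1 p.2 = T₂ p.2 p.1 := by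
  have i1 := hR₁.integrable one_le_two
  have i2 : Integrable (fun p : ℝ × ℝ => T₂ p.2 p.1) ((lebIcc r).prod (lebIcc r')) :=
    (hT₂.comp_measurePreserving Measure.measurePreserving_swap).integrable one_le_two
  have key := ae_eq_zero_of_forall_test (isOpen_Ioo.prod isOpen_Ioo)
    (U := Ioo (-r) 0 ×ˢ Ioo (-r') 0) (f := fun p : ℝ × ℝ => R₁ p.1 p.2 - T₂ p.2 p.1)
    (by rw [IntegrableOn, restrict_Ioo_prod]; exact i1.sub i2) (by
      intro ψ hψ
      rw [restrict_Ioo_prod]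
      obtain ⟨C, hC⟩ := hψ.2.1.exists_bound_of_continuous hψ.1.continuous
      simp_rw [sub_mul]
      rw [integral_sub
        (i1.mul_bdd (c := C) hψ.1.continuous.aestronglyMeasurable (ae_of_all _ hC))
        (i2.mul_bdd (c := C) hψ.1.continuous.aestronglyMeasurable (ae_of_all _ hC))]
      have hψ' : IsTest (Ioo (-r') 0 ×ˢ Ioo (-r) 0) fun p : ℝ × ℝ => ψ p.swap := by
        have hs : Function.support (fun p : ℝ × ℝ => ψ p.swap) ⊆ Prod.swap ⁻¹' tsupport ψ :=
          fun p hp => subset_tsupport _ hp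
        refine ⟨hψ.1.comp (contDiff_snd.prodMk contDiff_fst), ?_, ?_⟩
        · exact hψ.2.1.comp_homeomorph (Homeomorph.prodComm ℝ ℝ)
        · exact (closure_minimal hs ((isClosed_tsupport _).preimage continuous_swap)).trans
            fun p hp => ⟨(hψ.2.2 hp).2, (hψ.2.2 hp).1⟩
      have h1 := hR ψ hψ.1 hψ.2.1 hψ.2.2
      have h2 := hT _ hψ'.1 hψ'.2.1 hψ'.2.2
      rw [restrict_Ioo_prod] at h1
      rw [restrict_Ioo_prod, ← integral_prod_swap,
        ← integral_prod_swap (fun p : ℝ × ℝ => T₂ p.1 p.2 * ψ p.swap)] at h2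
      have h3 : ∀ p : ℝ × ℝ, fderiv ℝ (fun p : ℝ × ℝ => ψ p.swap) p.swap (0, 1) =
          fderiv ℝ ψ p (1, 0) := by
        intro p
        have hd := (hψ.1.differentiable (by simp) p).hasFDerivAt
        have hsw : HasFDerivAt (Prod.swap : ℝ × ℝ → ℝ × ℝ)
          ((ContinuousLinearEquiv.prodComm ℝ ℝ ℝ : ℝ × ℝ →L[ℝ] ℝ × ℝ)) p.swap :=
          (ContinuousLinearEquiv.prodComm ℝ ℝ ℝ).hasFDerivAt
        have := HasFDerivAt.comp (g := ψ) p.swap (by simpa using hd) hsw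
        rw [HasFDerivAt.fderiv (f := fun p : ℝ × ℝ => ψ p.swap) this]
        simp
      simp only [h3, Prod.swap_swap, Prod.fst_swap, Prod.snd_swap] at h2
      have h4 : ∫ p, R p.1 p.2 * fderiv ℝ ψ p (1, 0) ∂((lebIcc r).prod (lebIcc r')) =
          ∫ p, T p.2 p.1 * fderiv ℝ ψ p (1, 0) ∂((lebIcc r).prod (lebIcc r')) := by
        refine integral_congr_ae ?_
        rw [lebIcc_prod]
        filter_upwards [ae_restrict_mem (measurableSet_Icc.prod measurableSet_Icc)] with p hp
        rw [h _ hp.1 _ hp.2]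
      rw [h4] at h1
      linarith)
  rw [restrict_Ioo_prod] at key
  exact key.mono fun p hp => sub_eq_zero.1 hp

end WeakDerivatives


/-! ### The state space and its bounded operators -/

section StateSpace

theorem exists_mul_clm {r : ℝ} {S : ℝ → ℝ} (hS : ContinuousOn S (Icc (-r) 0)) :
    ∃ T : Lp ℝ 2 (lebIcc r) →L[ℝ] Lp ℝ 2 (lebIcc r), ∀ z, T z =ᵐ[lebIcc r] fun s => S s * z s := by
  obtain ⟨C, hC⟩ := isCompact_Icc.exists_bound_of_continuousOn hS
  have hm : MemLp S ⊤ (lebIcc r) := memLp_top_of_bound (hS.aestronglyMeasurable measurableSet_Icc) C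
    ((ae_restrict_mem measurableSet_Icc).mono hC)
  refine ⟨(ContinuousLinearMap.mul ℝ ℝ).holderL (lebIcc r) ⊤ 2 2 (hm.toLp S), fun z => ?_⟩
  rw [ContinuousLinearMap.holderL_apply_apply]
  filter_upwards [(ContinuousLinearMap.mul ℝ ℝ).coeFn_holder (r := 2) (hm.toLp S) z, hm.coeFn_toLp]
    with s h1 h2
  rw [h1, ContinuousLinearMap.mul_apply', h2]

theorem exists_integral_clm {r : ℝ} {Q : ℝ → ℝ} (hQ : ContinuousOn Q (Icc (-r) 0)) :
    ∃ T : Lp ℝ 2 (lebIcc r) →L[ℝ] ℝ, ∀ z : Lp ℝ 2 (lebIcc r), T z = ∫ s, Q s * z s ∂(lebIcc r) := by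
  have hm := memLp_of_continuousOn hQ
  refine ⟨innerSL ℝ (hm.toLp Q), fun z => ?_⟩
  rw [innerSL_apply_apply, L2.inner_def]
  refine integral_congr_ae ?_
  filter_upwards [hm.coeFn_toLp] with s hs
  simp [hs, mul_comm]

/-- The norm of the constant function `1` in `L²([-r, 0])`. -/
def lebNorm (r : ℝ) : ℝ := (measureUnivNNReal (lebIcc r) : ℝ) ^ (2 : ENNReal).toReal⁻¹

theorem abs_integral_mul_le {r C : ℝ} (hC0 : 0 ≤ C) {k : ℝ → ℝ} (hk : MemLp k 2 (lebIcc r))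
    (hC : ∀ s ∈ Icc (-r) 0, |k s| ≤ C) (z : Lp ℝ 2 (lebIcc r)) :
    |∫ s, k s * z s ∂(lebIcc r)| ≤ lebNorm r * C * ‖z‖ := by
  have : ∫ s, k s * z s ∂(lebIcc r) = inner ℝ (hk.toLp k) z := by
    rw [L2.inner_def]
    refine integral_congr_ae ?_
    filter_upwards [hk.coeFn_toLp] with s hs
    simp [hs, mul_comm]
  rw [this]
  refine (abs_real_inner_le_norm _ _).trans (mul_le_mul_of_nonneg_right ?_ (norm_nonneg _))
  refine Lp.norm_le_of_ae_bound (f := hk.toLp k) hC0 ?_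
  filter_upwards [hk.coeFn_toLp, ae_restrict_mem measurableSet_Icc] with s h1 h2
  rw [h1]; exact hC s h2

theorem lebNorm_nonneg (r : ℝ) : 0 ≤ lebNorm r := Real.rpow_nonneg NNReal.zero_le_coe _

/-- Cauchy–Schwarz bounds the image at every `s` by a multiple of `‖z‖`, and a bounded function on a
bounded interval has controlled `L²` norm; hence the product of two `lebNorm` factors. -/
theorem exists_kernel_clm {r r' : ℝ} {R : ℝ → ℝ → ℝ}
    (hR : ContinuousOn (fun p : ℝ × ℝ => R p.1 p.2) (Icc (-r) 0 ×ˢ Icc (-r') 0)) :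
    ∃ T : Lp ℝ 2 (lebIcc r') →L[ℝ] Lp ℝ 2 (lebIcc r),
      ∀ z : Lp ℝ 2 (lebIcc r'), T z =ᵐ[lebIcc r] fun s => ∫ θ, R s θ * z θ ∂(lebIcc r') := by
  obtain ⟨C', hC'⟩ := (isCompact_Icc.prod isCompact_Icc).exists_bound_of_continuousOn hR
  obtain ⟨C, hC0, hC⟩ : ∃ C, 0 ≤ C ∧ ∀ s ∈ Icc (-r) 0, ∀ θ ∈ Icc (-r') 0, |R s θ| ≤ C :=
    ⟨max C' 0, le_max_right _ _, fun s hs θ hθ => (hC' (s, θ) ⟨hs, hθ⟩).trans (le_max_left _ _)⟩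
  have hzi : ∀ z : Lp ℝ 2 (lebIcc r'), Integrable z (lebIcc r') := fun z =>
    (Lp.memLp z).integrable one_le_two
  have hm : ∀ z : Lp ℝ 2 (lebIcc r'), MemLp (fun s => ∫ θ, R s θ * z θ ∂(lebIcc r')) 2 (lebIcc r) :=
    fun z => memLp_of_continuousOn (continuousOn_integral_mul hR (hzi z))
  have hRm : ∀ s ∈ Icc (-r) 0, MemLp (R s) 2 (lebIcc r') := fun s hs =>
    memLp_of_continuousOn (hR.comp (f := fun θ => (s, θ)) (by fun_prop) fun θ hθ => ⟨hs, hθ⟩)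
  let T : Lp ℝ 2 (lebIcc r') →ₗ[ℝ] Lp ℝ 2 (lebIcc r) :=
    { toFun := fun z => (hm z).toLp _
      map_add' := fun z w => by
        rw [← MemLp.toLp_add]
        refine MemLp.toLp_congr _ _ ?_
        filter_upwards [ae_restrict_mem measurableSet_Icc] with s hs
        rw [Pi.add_apply, ← integral_add (by exact (hRm s hs).integrable_mul (Lp.memLp z))
          (by exact (hRm s hs).integrable_mul (Lp.memLp w))]
        refine integral_congr_ae ?_
        filter_upwards [Lp.coeFn_add z w] with θ h
        rw [h, Pi.add_apply, mul_add]
      map_smul' := fun c z => by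
        rw [RingHom.id_apply, ← MemLp.toLp_const_smul]
        refine MemLp.toLp_congr _ _ (ae_of_all _ fun s => ?_)
        rw [Pi.smul_apply, smul_eq_mul, ← integral_const_mul]
        refine integral_congr_ae ?_
        filter_upwards [Lp.coeFn_smul c z] with θ h
        rw [h, Pi.smul_apply, smul_eq_mul, mul_left_comm] }
  refine ⟨T.mkContinuousOfExistsBound ⟨lebNorm r * (lebNorm r' * C), fun z => ?_⟩,
    fun z => (hm z).coeFn_toLp⟩
  rw [mul_assoc]
  refine Lp.norm_le_of_ae_bound (f := (hm z).toLp _)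
    (mul_nonneg (mul_nonneg (lebNorm_nonneg r') hC0) (norm_nonneg z)) ?_
  filter_upwards [(hm z).coeFn_toLp, ae_restrict_mem measurableSet_Icc] with s h1 h2
  rw [h1]
  exact abs_integral_mul_le hC0 (hRm s h2) (hC s h2) z

theorem coeFn_sum {X ι : Type*} [MeasurableSpace X] {μ : Measure X} (s : Finset ι)
    {f : ι → Lp ℝ 2 μ} {g : ι → X → ℝ} (h : ∀ i, f i =ᵐ[μ] g i) :
    (∑ i ∈ s, f i : Lp ℝ 2 μ) =ᵐ[μ] fun x => ∑ i ∈ s, g i x := by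
  classical
  induction s using Finset.induction_on with
  | empty =>
    simp only [Finset.sum_empty]
    exact Lp.coeFn_zero ℝ 2 μ
  | insert i s hi ih =>
    rw [Finset.sum_insert hi]
    filter_upwards [Lp.coeFn_add (f i) (∑ i ∈ s, f i), ih, h i] with x h1 h2 h3
    rw [h1, Pi.add_apply, h2, h3, Finset.sum_insert hi]

/-- The state space `ℝⁿ × ∏ᵢ L²([-τᵢ, 0], ℝⁿ)`. -/
abbrev State (n : ℕ) {K : ℕ} (τ : Fin (K + 1) → ℝ) : Type :=
  WithLp 2 (EuclideanSpace ℝ (Fin n) ×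
    PiLp 2 fun p : Fin K × Fin n => Lp ℝ 2 (lebIcc (τ p.1.succ)))

variable {n K : ℕ} {τ : Fin (K + 1) → ℝ}

theorem State.inner_def (z w : State n τ) :
    inner ℝ z w = z.fst.ofLp ⬝ᵥ w.fst.ofLp +
      ∑ i, ∫ s, (fun a => z.snd (i, a) s) ⬝ᵥ (fun a => w.snd (i, a) s) ∂(lebIcc (τ i.succ)) := by
  rw [WithLp.prod_inner_apply, PiLp.inner_apply, PiLp.inner_apply, Fintype.sum_prod_type]
  congr 1
  · simp [dotProduct, mul_comm]
  · refine Finset.sum_congr rfl fun i _ => ?_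
    simp only [dotProduct]
    rw [integral_finsetSum]
    · refine Finset.sum_congr rfl fun a _ => ?_
      rw [L2.inner_def]
      simp [mul_comm]
    · intro a _
      exact (Lp.memLp _).integrable_mul (Lp.memLp _)

theorem exists_state_clm (f : Fin n → State n τ →L[ℝ] ℝ)
    (g : ∀ p : Fin K × Fin n, State n τ →L[ℝ] Lp ℝ 2 (lebIcc (τ p.1.succ))) :
    ∃ T : State n τ →L[ℝ] State n τ, ∀ z, (∀ a, (T z).fst a = f a z) ∧
      ∀ p, (T z).snd p = g p z := by
  refine ⟨(WithLp.prodContinuousLinearEquiv 2 ℝ _ _).symm.toContinuousLinearMap ∘L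
    (((PiLp.continuousLinearEquiv 2 ℝ _).symm.toContinuousLinearMap ∘L
      ContinuousLinearMap.pi f).prod
    ((PiLp.continuousLinearEquiv 2 ℝ _).symm.toContinuousLinearMap ∘L
      ContinuousLinearMap.pi g)), fun z => ⟨fun a => ?_, fun p => ?_⟩⟩
  · rfl
  · rfl

/-- In scalar coordinates every entry of the operator is built from multiplication by a continuous
function, an integral functional, or a continuous kernel, whose boundedness is known. The indices of
`Q` are exchanged in the function components because that column is the adjoint of the row in the
first component. -/
theorem exists_stateOp {P : Matrix (Fin n) (Fin n) ℝ}
    {Q S : Fin K → ℝ → Matrix (Fin n) (Fin n) ℝ}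
    {R : Fin K → Fin K → ℝ → ℝ → Matrix (Fin n) (Fin n) ℝ}
    (hQ : ∀ i a b, ContinuousOn (fun s => Q i s a b) (Icc (-τ i.succ) 0))
    (hS : ∀ i a b, ContinuousOn (fun s => S i s a b) (Icc (-τ i.succ) 0))
    (hR : ∀ i j a b, ContinuousOn (fun p : ℝ × ℝ => R i j p.1 p.2 a b)
      (Icc (-τ i.succ) 0 ×ˢ Icc (-τ j.succ) 0)) :
    ∃ T : State n τ →L[ℝ] State n τ, ∀ z,
      (∀ a, (T z).fst a = τ (Fin.last K) * (∑ b, P a b * z.fst b +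
        ∑ i, ∑ b, ∫ s, Q i s a b * z.snd (i, b) s ∂(lebIcc (τ i.succ)))) ∧
      ∀ i a, (T z).snd (i, a) =ᵐ[lebIcc (τ i.succ)] fun s =>
        τ (Fin.last K) * (∑ b, Q i s b a * z.fst b) +
        τ (Fin.last K) * (∑ b, S i s a b * z.snd (i, b) s) +
        ∑ j, ∑ b, ∫ θ, R i j s θ a b * z.snd (j, b) θ ∂(lebIcc (τ j.succ)) := by
  choose MS hMS using fun i a b => exists_mul_clm (hS i a b)
  choose IQ hIQ using fun i a b => exists_integral_clm (hQ i a b)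
  choose KR hKR using fun i j a b =>
    exists_kernel_clm (R := fun s θ => R i j s θ a b) (hR i j a b)
  have mQ := fun i a b => memLp_of_continuousOn (hQ i a b)
  let px : Fin n → State n τ →L[ℝ] ℝ := fun b =>
    EuclideanSpace.proj b ∘L WithLp.fstL 2 ℝ _ _
  let pz : ∀ p : Fin K × Fin n, State n τ →L[ℝ] Lp ℝ 2 (lebIcc (τ p.1.succ)) := fun p =>
    PiLp.proj 2 _ p ∘L WithLp.sndL 2 ℝ _ _
  obtain ⟨T, hT⟩ := exists_state_clm (n := n) (τ := τ)
    (fun a => τ (Fin.last K) • (∑ b, P a b • px b + ∑ i, ∑ b, IQ i a b ∘L pz (i, b)))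
    (fun p => τ (Fin.last K) • (∑ b, (px b).smulRight ((mQ p.1 b p.2).toLp _)) +
      τ (Fin.last K) • (∑ b, MS p.1 p.2 b ∘L pz (p.1, b)) +
      ∑ j, ∑ b, KR p.1 j p.2 b ∘L pz (j, b))
  refine ⟨T, fun z => ⟨fun a => ?_, fun i a => ?_⟩⟩
  · rw [(hT z).1]
    simp [px, pz, hIQ, mul_add]
  · rw [(hT z).2]
    simp only [add_apply, smul_apply, sum_apply,
      ContinuousLinearMap.comp_apply, ContinuousLinearMap.smulRight_apply]
    have h1 : (∑ b, px b z • (mQ i b a).toLp _ : Lp ℝ 2 (lebIcc (τ i.succ)))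
        =ᵐ[lebIcc (τ i.succ)] fun s => ∑ b, Q i s b a * z.fst b := by
      refine coeFn_sum _ fun b => ?_
      filter_upwards [Lp.coeFn_smul (px b z) ((mQ i b a).toLp _), (mQ i b a).coeFn_toLp]
        with s h1 h2
      rw [h1, Pi.smul_apply, h2, smul_eq_mul, mul_comm]
      rfl
    have h2 : (∑ b, MS i a b (pz (i, b) z) : Lp ℝ 2 (lebIcc (τ i.succ)))
        =ᵐ[lebIcc (τ i.succ)] fun s => ∑ b, S i s a b * z.snd (i, b) s :=
      coeFn_sum _ fun b => hMS i a b _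
    have h3 : (∑ j, ∑ b, KR i j a b (pz (j, b) z) : Lp ℝ 2 (lebIcc (τ i.succ)))
        =ᵐ[lebIcc (τ i.succ)] fun s =>
          ∑ j, ∑ b, ∫ θ, R i j s θ a b * z.snd (j, b) θ ∂(lebIcc (τ j.succ)) :=
      coeFn_sum _ fun j => coeFn_sum _ fun b => hKR i j a b _
    filter_upwards [h1, h2, h3,
      Lp.coeFn_add (τ (Fin.last K) • (∑ b, px b z • (mQ i b a).toLp _) +
        τ (Fin.last K) • ∑ b, MS i a b (pz (i, b) z)) (∑ j, ∑ b, KR i j a b (pz (j, b) z)),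
      Lp.coeFn_add (τ (Fin.last K) • (∑ b, px b z • (mQ i b a).toLp _))
        (τ (Fin.last K) • ∑ b, MS i a b (pz (i, b) z)),
      Lp.coeFn_smul (τ (Fin.last K)) (∑ b, px b z • (mQ i b a).toLp _),
      Lp.coeFn_smul (τ (Fin.last K)) (∑ b, MS i a b (pz (i, b) z))] with s h1 h2 h3 h4 h5 h6 h7
    rw [h4, Pi.add_apply, h5, Pi.add_apply, h6, h7, h3, Pi.smul_apply, Pi.smul_apply, h1, h2]
    rfl

end StateSpace


/-! ### Self-adjointness and invertibility of the state operator -/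

section StateOperator

/-- The integral operator with matrix kernel `R`. -/
def kernelApply {X Y : Type*} [MeasurableSpace Y] {α β : Type*} [Fintype β] (μ : Measure Y)
    (R : X → Y → Matrix α β ℝ) (φ : Y → β → ℝ) (s : X) (a : α) : ℝ :=
  ∑ b, ∫ θ, R s θ a b * φ θ b ∂μ

theorem integral_dotProduct_kernelApply {X Y : Type*} [MeasurableSpace X] [MeasurableSpace Y]
    {μ : Measure X} {μ' : Measure Y} [SFinite μ] [SFinite μ'] {α β : Type*} [Fintype α] [Fintype β]
    {R : X → Y → Matrix α β ℝ} {ψ : X → α → ℝ} {φ : Y → β → ℝ}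
    (h : ∀ a b, Integrable (fun p : X × Y => ψ p.1 a * R p.1 p.2 a b * φ p.2 b) (μ.prod μ')) :
    Integrable (fun s => ψ s ⬝ᵥ kernelApply μ' R φ s) μ ∧
    ∫ s, ψ s ⬝ᵥ kernelApply μ' R φ s ∂μ =
      ∫ p, ψ p.1 ⬝ᵥ R p.1 p.2 *ᵥ φ p.2 ∂(μ.prod μ') := by
  have e : ∀ s a b, ψ s a * ∫ θ, R s θ a b * φ θ b ∂μ' =
      ∫ θ, ψ s a * R s θ a b * φ θ b ∂μ' := fun s a b => by
    rw [← integral_const_mul]; simp only [mul_assoc]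
  have hi : ∀ a b, Integrable (fun s => ψ s a * ∫ θ, R s θ a b * φ θ b ∂μ') μ := fun a b => by
    simp_rw [e]; exact (h a b).integral_prod_left
  rw [(integral_dotProduct_mulVec h).2]
  simp only [dotProduct, kernelApply, Finset.mul_sum]
  refine ⟨integrable_finsetSum _ fun a _ => integrable_finsetSum _ fun b _ => hi a b, ?_⟩
  rw [integral_finsetSum _ fun a _ => integrable_finsetSum _ fun b _ => hi a b]
  refine Finset.sum_congr rfl fun a _ => ?_
  rw [integral_finsetSum _ fun b _ => hi a b]
  refine Finset.sum_congr rfl fun b _ => ?_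
  simp_rw [e]
  exact (integral_prod _ (h a b)).symm

variable {n K : ℕ} {τ : Fin (K + 1) → ℝ}

/-- The function component of a state. -/
def State.fn (z : State n τ) (i : Fin K) (s : ℝ) (a : Fin n) : ℝ := z.snd (i, a) s

theorem State.memLp_fn (z : State n τ) (i : Fin K) (a : Fin n) :
    MemLp (fun s => z.fn i s a) 2 (lebIcc (τ i.succ)) := Lp.memLp _

theorem State.inner_eq (z w : State n τ) :
    inner ℝ z w = z.fst.ofLp ⬝ᵥ w.fst.ofLp +
      ∑ i, ∫ s, z.fn i s ⬝ᵥ w.fn i s ∂(lebIcc (τ i.succ)) := State.inner_def z w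

/-- The operator `𝓛₁(P, Q, S, R)` on the state space. -/
def IsStateOp (P : Matrix (Fin n) (Fin n) ℝ) (Q S : Fin K → ℝ → Matrix (Fin n) (Fin n) ℝ)
    (R : Fin K → Fin K → ℝ → ℝ → Matrix (Fin n) (Fin n) ℝ) (T : State n τ →L[ℝ] State n τ) : Prop :=
  ∀ z, ((T z).fst.ofLp = τ (Fin.last K) • (P *ᵥ z.fst.ofLp +
        ∑ i, fun a => ∑ b, ∫ s, Q i s a b * z.fn i s b ∂(lebIcc (τ i.succ)))) ∧
      ∀ i, ∀ᵐ s ∂(lebIcc (τ i.succ)), (T z).fn i s =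
        τ (Fin.last K) • ((Q i s)ᵀ *ᵥ z.fst.ofLp) + τ (Fin.last K) • (S i s *ᵥ z.fn i s) +
        ∑ j, kernelApply (lebIcc (τ j.succ)) (R i j) (z.fn j) s

theorem exists_isStateOp {P : Matrix (Fin n) (Fin n) ℝ}
    {Q S : Fin K → ℝ → Matrix (Fin n) (Fin n) ℝ}
    {R : Fin K → Fin K → ℝ → ℝ → Matrix (Fin n) (Fin n) ℝ}
    (hQ : ∀ i a b, ContinuousOn (fun s => Q i s a b) (Icc (-τ i.succ) 0))
    (hS : ∀ i a b, ContinuousOn (fun s => S i s a b) (Icc (-τ i.succ) 0))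
    (hR : ∀ i j a b, ContinuousOn (fun p : ℝ × ℝ => R i j p.1 p.2 a b)
      (Icc (-τ i.succ) 0 ×ˢ Icc (-τ j.succ) 0)) :
    ∃ T : State n τ →L[ℝ] State n τ, IsStateOp P Q S R T := by
  obtain ⟨T, hT⟩ := exists_stateOp (P := P) hQ hS hR
  refine ⟨T, fun z => ⟨?_, fun i => ?_⟩⟩
  · ext a
    rw [(hT z).1 a]
    simp [Matrix.mulVec, dotProduct, State.fn]
  · filter_upwards [ae_all_iff.2 fun a => (hT z).2 i a] with s hs
    ext a
    rw [State.fn, hs a]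
    simp [Matrix.mulVec, dotProduct, State.fn, kernelApply]

variable {P : Matrix (Fin n) (Fin n) ℝ} {Q S : Fin K → ℝ → Matrix (Fin n) (Fin n) ℝ}
  {R : Fin K → Fin K → ℝ → ℝ → Matrix (Fin n) (Fin n) ℝ} {T : State n τ →L[ℝ] State n τ}

/-- The polarised version of `L1val`, in which the two `Q` terms stay separate so that the symmetry
in `z` and `w` becomes visible. -/
theorem IsStateOp.inner_eq (hT : IsStateOp P Q S R T)
    (hQ : ∀ i a b, ContinuousOn (fun s => Q i s a b) (Icc (-τ i.succ) 0))
    (hS : ∀ i a b, ContinuousOn (fun s => S i s a b) (Icc (-τ i.succ) 0))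
    (hR : ∀ i j a b, ContinuousOn (fun p : ℝ × ℝ => R i j p.1 p.2 a b)
      (Icc (-τ i.succ) 0 ×ˢ Icc (-τ j.succ) 0)) (z w : State n τ) :
    inner ℝ w (T z) = τ (Fin.last K) * (w.fst.ofLp ⬝ᵥ P *ᵥ z.fst.ofLp) +
      ∑ i, τ (Fin.last K) * ((∫ s, w.fst.ofLp ⬝ᵥ Q i s *ᵥ z.fn i s ∂(lebIcc (τ i.succ))) +
        (∫ s, z.fst.ofLp ⬝ᵥ Q i s *ᵥ w.fn i s ∂(lebIcc (τ i.succ))) +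
        ∫ s, w.fn i s ⬝ᵥ S i s *ᵥ z.fn i s ∂(lebIcc (τ i.succ))) +
      ∑ i, ∑ j, ∫ p, w.fn i p.1 ⬝ᵥ R i j p.1 p.2 *ᵥ z.fn j p.2
        ∂((lebIcc (τ i.succ)).prod (lebIcc (τ j.succ))) := by
  have iQ : ∀ (x : Fin n → ℝ) (v : State n τ) i a b,
      Integrable (fun s => x a * Q i s a b * v.fn i s b) (lebIcc (τ i.succ)) := by
    intro x v i a b
    simp_rw [mul_assoc]
    exact ((memLp_of_continuousOn (hQ i a b)).integrable_mul (v.memLp_fn i b)).const_mul _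
  have iS : ∀ i a b,
      Integrable (fun s => w.fn i s a * S i s a b * z.fn i s b) (lebIcc (τ i.succ)) := by
    intro i a b
    have : IntegrableOn (fun s => w.fn i s a * z.fn i s b) (Icc (-τ i.succ) 0) :=
      (w.memLp_fn i a).integrable_mul (z.memLp_fn i b)
    refine (IntegrableOn.continuousOn_mul (hS i a b) this isCompact_Icc).congr
      (ae_of_all _ fun s => ?_)
    ring
  have iR := fun i j => integral_dotProduct_kernelApply (R := R i j) (ψ := w.fn i) (φ := z.fn j)
    (integrable_bilinear (hR i j) (w.memLp_fn i) (z.memLp_fn j))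
  have h1 : w.fst.ofLp ⬝ᵥ (T z).fst.ofLp = τ (Fin.last K) * (w.fst.ofLp ⬝ᵥ P *ᵥ z.fst.ofLp) +
      ∑ i, τ (Fin.last K) * ∫ s, w.fst.ofLp ⬝ᵥ Q i s *ᵥ z.fn i s ∂(lebIcc (τ i.succ)) := by
    rw [(hT z).1, dotProduct_smul, dotProduct_add, smul_eq_mul, mul_add, dotProduct_sum,
      Finset.mul_sum]
    congr 1
    refine Finset.sum_congr rfl fun i _ => ?_
    rw [(integral_dotProduct_mulVec (iQ _ z i)).2]
    simp only [dotProduct, Finset.mul_sum, mul_assoc, integral_const_mul]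
  have h2 : ∀ i, ∫ s, w.fn i s ⬝ᵥ (T z).fn i s ∂(lebIcc (τ i.succ)) =
      τ (Fin.last K) * ((∫ s, z.fst.ofLp ⬝ᵥ Q i s *ᵥ w.fn i s ∂(lebIcc (τ i.succ))) +
        ∫ s, w.fn i s ⬝ᵥ S i s *ᵥ z.fn i s ∂(lebIcc (τ i.succ))) +
      ∑ j, ∫ p, w.fn i p.1 ⬝ᵥ R i j p.1 p.2 *ᵥ z.fn j p.2
        ∂((lebIcc (τ i.succ)).prod (lebIcc (τ j.succ))) := by
    intro i
    have h3 : ∀ᵐ s ∂(lebIcc (τ i.succ)), w.fn i s ⬝ᵥ (T z).fn i s =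
        τ (Fin.last K) * (z.fst.ofLp ⬝ᵥ Q i s *ᵥ w.fn i s) +
        τ (Fin.last K) * (w.fn i s ⬝ᵥ S i s *ᵥ z.fn i s) +
        ∑ j, w.fn i s ⬝ᵥ kernelApply (lebIcc (τ j.succ)) (R i j) (z.fn j) s := by
      filter_upwards [(hT z).2 i] with s hs
      rw [hs, dotProduct_add, dotProduct_add, dotProduct_smul, dotProduct_smul, dotProduct_sum,
        smul_eq_mul, smul_eq_mul, Matrix.mulVec_transpose, dotProduct_comm (w.fn i s),
        ← Matrix.dotProduct_mulVec]
    have i1 := ((integral_dotProduct_mulVec (iQ z.fst.ofLp w i)).1).const_mul (τ (Fin.last K))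
    have i2 := ((integral_dotProduct_mulVec (iS i)).1).const_mul (τ (Fin.last K))
    rw [integral_congr_ae h3, integral_add (by exact i1.add i2)
      (integrable_finsetSum _ fun j _ => (iR i j).1), integral_add i1 i2, integral_const_mul,
      integral_const_mul, integral_finsetSum _ fun j _ => (iR i j).1, mul_add]
    simp_rw [(iR i _).2]
  rw [State.inner_eq, h1]
  simp_rw [h2, mul_add, Finset.sum_add_distrib]
  ring

/-- The two `Q` terms trade places, `P` and `Sᵢ` are symmetric, and the `R` terms match after
exchanging both the indices and the variables of integration. -/
theorem IsStateOp.inner_comm (hT : IsStateOp P Q S R T)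
    (hQ : ∀ i a b, ContinuousOn (fun s => Q i s a b) (Icc (-τ i.succ) 0))
    (hS : ∀ i a b, ContinuousOn (fun s => S i s a b) (Icc (-τ i.succ) 0))
    (hR : ∀ i j a b, ContinuousOn (fun p : ℝ × ℝ => R i j p.1 p.2 a b)
      (Icc (-τ i.succ) 0 ×ˢ Icc (-τ j.succ) 0))
    (hP : Pᵀ = P) (hSsymm : ∀ i, ∀ s ∈ Icc (-τ i.succ) 0, S i s = (S i s)ᵀ)
    (hRsymm : ∀ i j, ∀ s ∈ Icc (-τ i.succ) 0, ∀ θ ∈ Icc (-τ j.succ) 0,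
      R i j s θ = (R j i θ s)ᵀ) (z w : State n τ) :
    inner ℝ w (T z) = inner ℝ z (T w) := by
  have hsw : ∀ (A : Matrix (Fin n) (Fin n) ℝ) (u v : Fin n → ℝ), u ⬝ᵥ Aᵀ *ᵥ v = v ⬝ᵥ A *ᵥ u := by
    intro A u v
    rw [Matrix.mulVec_transpose, dotProduct_comm, ← Matrix.dotProduct_mulVec]
  rw [hT.inner_eq hQ hS hR, hT.inner_eq hQ hS hR]
  congr 1
  · congr 1
    · rw [← hsw, hP]
    · refine Finset.sum_congr rfl fun i _ => ?_
      congr 1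
      have : ∫ s, w.fn i s ⬝ᵥ S i s *ᵥ z.fn i s ∂(lebIcc (τ i.succ)) =
          ∫ s, z.fn i s ⬝ᵥ S i s *ᵥ w.fn i s ∂(lebIcc (τ i.succ)) := by
        refine integral_congr_ae ?_
        filter_upwards [ae_restrict_mem measurableSet_Icc] with s hs
        rw [← hsw, ← hSsymm i s hs]
      rw [this]
      ring
  · rw [Finset.sum_comm]
    refine Finset.sum_congr rfl fun j _ => Finset.sum_congr rfl fun i _ => ?_
    rw [← integral_prod_swap]
    refine integral_congr_ae ?_
    rw [lebIcc_prod]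
    filter_upwards [ae_restrict_mem (measurableSet_Icc.prod measurableSet_Icc)] with p hp
    rw [Prod.fst_swap, Prod.snd_swap, ← hsw, hRsymm i j _ hp.2 _ hp.1, Matrix.transpose_transpose]

theorem IsStateOp.inner_self (hT : IsStateOp P Q S R T)
    (hQ : ∀ i a b, ContinuousOn (fun s => Q i s a b) (Icc (-τ i.succ) 0))
    (hS : ∀ i a b, ContinuousOn (fun s => S i s a b) (Icc (-τ i.succ) 0))
    (hR : ∀ i j a b, ContinuousOn (fun p : ℝ × ℝ => R i j p.1 p.2 a b)
      (Icc (-τ i.succ) 0 ×ˢ Icc (-τ j.succ) 0)) (z : State n τ) :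
    inner ℝ z (T z) = L1val τ P Q S R z.fst.ofLp z.fn := by
  rw [hT.inner_eq hQ hS hR, L1val]
  simp_rw [two_mul]

/-- The Lax–Milgram argument: the lower bound on the quadratic form makes `T` a unit in the algebra
of bounded operators. -/
theorem exists_inverse_of_coercive {E : Type*} [NormedAddCommGroup E] [InnerProductSpace ℝ E]
    [CompleteSpace E] (T : E →L[ℝ] E) {c : ℝ} (hc : 0 < c)
    (h : ∀ z, c * inner ℝ z z ≤ inner ℝ z (T z)) :
    ∃ T' : E →L[ℝ] E, ∀ z, T (T' z) = z ∧ T' (T z) = z := by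
  have hu : IsUnit T := by
    refine ContinuousLinearMap.isUnit_of_forall_le_norm_inner_map T (c := ⟨c, hc.le⟩) hc fun z => ?_
    have := h z
    rw [real_inner_self_eq_norm_sq] at this
    rw [real_inner_comm, mul_comm]
    exact this.trans (le_abs_self _)
  obtain ⟨u, rfl⟩ := hu
  refine ⟨u.inv, fun z => ⟨?_, ?_⟩⟩
  · have := u.val_inv
    exact DFunLike.congr_fun this z
  · have := u.inv_val
    exact DFunLike.congr_fun this z

end StateOperator


/-! ### Integration by parts on the segments -/

section Dissipation

variable {n K : ℕ} {τ : Fin (K + 1) → ℝ}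

theorem ae_lebIcc_mem_Ioo (r : ℝ) : ∀ᵐ s ∂(lebIcc r), s ∈ Ioo (-r) 0 := by
  rw [lebIcc, ← restrict_Ioo_eq_restrict_Icc]
  exact ae_restrict_mem measurableSet_Ioo

theorem absolutelyContinuousOnInterval_const (a b c : ℝ) :
    AbsolutelyContinuousOnInterval (fun _ : ℝ => c) a b :=
  (contDiff_const.contDiffOn (n := 1)).absolutelyContinuousOnInterval

theorem absolutelyContinuousOnInterval_sum {ι : Type*} (t : Finset ι) {f : ι → ℝ → ℝ} {a b : ℝ}
    (h : ∀ i ∈ t, AbsolutelyContinuousOnInterval (f i) a b) :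
    AbsolutelyContinuousOnInterval (fun s => ∑ i ∈ t, f i s) a b := by
  classical
  induction t using Finset.induction_on with
  | empty => simpa using absolutelyContinuousOnInterval_const a b 0
  | insert i t hi ih =>
    simp_rw [Finset.sum_insert hi]
    exact (h i (Finset.mem_insert_self i t)).add
      (ih fun j hj => h j (Finset.mem_insert_of_mem hj))

theorem MemW2Interval.absolutelyContinuous {r : ℝ} (hr : 0 < r)
    {f f' : ℝ → Matrix (Fin n) (Fin n) ℝ} (h : MemW2Interval r f f') (a b : Fin n) :
    AbsolutelyContinuousOnInterval (fun s => f s a b) (-r) 0 ∧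
      ∀ᵐ s ∂(lebIcc r), HasDerivAt (fun s => f s a b) (f' s a b) s :=
  absolutelyContinuous_of_isWeakDeriv (neg_lt_zero.2 hr) (h a b).1
    ((h a b).2.1.integrable one_le_two) (h a b).2.2

theorem continuousOn_of_absolutelyContinuous {r : ℝ} (hr : 0 < r) {f : ℝ → ℝ}
    (h : AbsolutelyContinuousOnInterval f (-r) 0) : ContinuousOn f (Icc (-r) 0) := by
  have := h.continuousOn
  rwa [uIcc_of_le (neg_nonpos.2 hr.le)] at this

theorem ae_hasDerivAt_of_absolutelyContinuous {r : ℝ} (hr : 0 < r) {f : ℝ → ℝ}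
    (h : AbsolutelyContinuousOnInterval f (-r) 0) :
    ∀ᵐ s ∂(lebIcc r), HasDerivAt f (deriv f s) s := by
  have h1 := h.ae_differentiableAt
  rw [uIcc_of_le (neg_nonpos.2 hr.le)] at h1
  filter_upwards [ae_restrict_of_ae h1, ae_restrict_mem measurableSet_Icc] with s h2 h3
  exact (h2 h3).hasDerivAt

theorem integral_deriv_of_absolutelyContinuous {r : ℝ} (hr : 0 < r) {f : ℝ → ℝ}
    (h : AbsolutelyContinuousOnInterval f (-r) 0) :
    Integrable (deriv f) (lebIcc r) ∧ ∫ s, deriv f s ∂(lebIcc r) = f 0 - f (-r) := by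
  have hr' : -r ≤ 0 := neg_nonpos.2 hr.le
  refine ⟨(intervalIntegrable_iff_integrableOn_Icc_of_le hr').1 h.intervalIntegrable_deriv, ?_⟩
  rw [← h.integral_deriv_eq_sub, intervalIntegral.integral_of_le hr', restrict_Ioc_eq_restrict_Icc]

theorem hasDerivAt_mulVec {A : ℝ → Matrix (Fin n) (Fin n) ℝ} {A' : Matrix (Fin n) (Fin n) ℝ}
    {u : ℝ → Fin n → ℝ} {u' : Fin n → ℝ} {s : ℝ}
    (hA : ∀ a b, HasDerivAt (fun s => A s a b) (A' a b) s)
    (hu : ∀ a, HasDerivAt (fun s => u s a) (u' a) s) (a : Fin n) :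
    HasDerivAt (fun s => (A s *ᵥ u s) a) ((A' *ᵥ u s + A s *ᵥ u') a) s := by
  simp only [Matrix.mulVec, dotProduct, Pi.add_apply, ← Finset.sum_add_distrib]
  exact HasDerivAt.fun_sum fun b _ => (hA a b).mul (hu b)

theorem hasDerivAt_dotProduct {u v : ℝ → Fin n → ℝ} {u' v' : Fin n → ℝ} {s : ℝ}
    (hu : ∀ a, HasDerivAt (fun s => u s a) (u' a) s)
    (hv : ∀ a, HasDerivAt (fun s => v s a) (v' a) s) :
    HasDerivAt (fun s => u s ⬝ᵥ v s) (u' ⬝ᵥ v s + u s ⬝ᵥ v') s := by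
  simp only [dotProduct, ← Finset.sum_add_distrib]
  exact HasDerivAt.fun_sum fun b _ => (hu b).mul (hv b)

theorem dotProduct_mulVec_symm {A : Matrix (Fin n) (Fin n) ℝ} (hA : A = Aᵀ) (u v : Fin n → ℝ) :
    u ⬝ᵥ A *ᵥ v = v ⬝ᵥ A *ᵥ u := by
  conv_lhs => rw [hA]
  rw [Matrix.mulVec_transpose, dotProduct_comm, ← Matrix.dotProduct_mulVec]

theorem absolutelyContinuous_quadratic {a b : ℝ} {S : ℝ → Matrix (Fin n) (Fin n) ℝ}
    {ψ : ℝ → Fin n → ℝ} (hS : ∀ i j, AbsolutelyContinuousOnInterval (fun s => S s i j) a b)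
    (hψ : ∀ i, AbsolutelyContinuousOnInterval (fun s => ψ s i) a b) :
    AbsolutelyContinuousOnInterval (fun s => ψ s ⬝ᵥ S s *ᵥ ψ s) a b := by
  simp only [dotProduct, Matrix.mulVec]
  exact absolutelyContinuousOnInterval_sum _ fun i _ => (hψ i).mul
    (absolutelyContinuousOnInterval_sum _ fun j _ => (hS i j).mul (hψ j))

/-- The product rule for `η = c Qᵀ x + c S ψ + k`. By symmetry of `S`, `2 ψ·Sψ' = (ψ·Sψ)' - ψ·S'ψ`,
so `ψ'` disappears into a total derivative and `S'` survives once instead of twice. -/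
theorem dotProduct_deriv_segment {c s : ℝ} {x : Fin n → ℝ} {ψ k η : ℝ → Fin n → ℝ}
    {Q S : ℝ → Matrix (Fin n) (Fin n) ℝ} {Q' S' : Matrix (Fin n) (Fin n) ℝ} {ψ' k' η' : Fin n → ℝ}
    (hS : S s = (S s)ᵀ) (h1 : ∀ a, HasDerivAt (fun s => ψ s a) (ψ' a) s)
    (h2 : ∀ a b, HasDerivAt (fun s => S s a b) (S' a b) s)
    (h3 : ∀ a b, HasDerivAt (fun s => Q s a b) (Q' a b) s)
    (h4 : ∀ a, HasDerivAt (fun s => k s a) (k' a) s)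
    (h5 : ∀ a, HasDerivAt (fun s => η s a) (η' a) s)
    (he : ∀ᶠ t in nhds s, η t = c • ((Q t)ᵀ *ᵥ x) + c • (S t *ᵥ ψ t) + k t) :
    2 * (ψ s ⬝ᵥ η') = 2 * c * (x ⬝ᵥ Q' *ᵥ ψ s) +
      c * (ψ s ⬝ᵥ S' *ᵥ ψ s + deriv (fun s => ψ s ⬝ᵥ S s *ᵥ ψ s) s) + 2 * (ψ s ⬝ᵥ k') := by
  have d1 := hasDerivAt_mulVec h2 h1
  have d3 := hasDerivAt_mulVec (A := fun s => (Q s)ᵀ) (A' := Q'ᵀ) (u := fun _ => x) (u' := 0)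
    (fun a b => h3 b a) (fun a => hasDerivAt_const s (x a))
  have d4 : η' = c • (Q'ᵀ *ᵥ x) + c • (S' *ᵥ ψ s + S s *ᵥ ψ') + k' := by
    ext a
    refine (h5 a).unique ?_
    have := (((d3 a).const_mul c).add ((d1 a).const_mul c)).add (h4 a)
    refine HasDerivAt.congr_of_eventuallyEq (this.congr_deriv ?_) ?_
    · simp [mul_add]
    · filter_upwards [he] with t ht
      rw [ht]
      simp
  rw [(hasDerivAt_dotProduct h1 d1).deriv, d4]
  simp only [dotProduct_add, dotProduct_smul, smul_eq_mul]
  rw [dotProduct_mulVec_symm hS ψ', Matrix.mulVec_transpose,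
    dotProduct_comm (ψ s) (x ᵥ* Q'), ← Matrix.dotProduct_mulVec]
  ring

/-- Integration by parts along a segment of the form `c Qᵀ x + c S ψ + k`. -/
theorem integral_dotProduct_deriv {r c : ℝ} (hr : 0 < r) {x : Fin n → ℝ} {ψ : ℝ → Fin n → ℝ}
    {Q Q' S S' : ℝ → Matrix (Fin n) (Fin n) ℝ} (hQ : MemW2Interval r Q Q')
    (hS : MemW2Interval r S S') (hSsymm : ∀ s ∈ Icc (-r) 0, S s = (S s)ᵀ)
    (hψ : ∀ a, AbsolutelyContinuousOnInterval (fun s => ψ s a) (-r) 0)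
    {k k' : ℝ → Fin n → ℝ} (hk : ∀ a, ∀ᵐ s ∂(lebIcc r), HasDerivAt (fun s => k s a) (k' s a) s)
    (hki : Integrable (fun s => ψ s ⬝ᵥ k' s) (lebIcc r)) {η η' : ℝ → Fin n → ℝ}
    (hη : ∀ a, ∀ s ∈ Ioo (-r) 0, HasDerivAt (fun s => η s a) (η' s a) s)
    (hηeq : ∀ s ∈ Icc (-r) 0, η s = c • ((Q s)ᵀ *ᵥ x) + c • (S s *ᵥ ψ s) + k s) :
    2 * ∫ s, ψ s ⬝ᵥ η' s ∂(lebIcc r) = 2 * c * (∫ s, x ⬝ᵥ Q' s *ᵥ ψ s ∂(lebIcc r)) +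
      c * ((∫ s, ψ s ⬝ᵥ S' s *ᵥ ψ s ∂(lebIcc r)) +
        (ψ 0 ⬝ᵥ S 0 *ᵥ ψ 0 - ψ (-r) ⬝ᵥ S (-r) *ᵥ ψ (-r))) +
      2 * ∫ s, ψ s ⬝ᵥ k' s ∂(lebIcc r) := by
  have hψc := fun a => continuousOn_of_absolutelyContinuous hr (hψ a)
  -- `ψ·Sψ` is absolutely continuous, so its derivative integrates to the boundary terms at `0` and
  -- `-r`.
  obtain ⟨hfi, hfe⟩ := integral_deriv_of_absolutelyContinuous hr (absolutelyContinuous_quadratic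
    (fun a b => (hS.absolutelyContinuous hr a b).1) hψ)
  have iQ : Integrable (fun s => x ⬝ᵥ Q' s *ᵥ ψ s) (lebIcc r) :=
    (integral_dotProduct_mulVec (u := fun _ => x) fun a b => by
      simp_rw [mul_assoc]
      exact ((hQ a b).2.1.integrable_mul (memLp_of_continuousOn (hψc b))).const_mul _).1
  have iS : Integrable (fun s => ψ s ⬝ᵥ S' s *ᵥ ψ s) (lebIcc r) :=
    (integral_dotProduct_mulVec fun a b => by
      have : IntegrableOn (fun s => S' s a b) (Icc (-r) 0) := (hS a b).2.1.integrable one_le_two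
      exact (this.continuousOn_mul (hψc a) isCompact_Icc).mul_continuousOn (hψc b) isCompact_Icc).1
  have key : ∀ᵐ s ∂(lebIcc r), 2 * (ψ s ⬝ᵥ η' s) = 2 * c * (x ⬝ᵥ Q' s *ᵥ ψ s) +
      c * (ψ s ⬝ᵥ S' s *ᵥ ψ s + deriv (fun s => ψ s ⬝ᵥ S s *ᵥ ψ s) s) + 2 * (ψ s ⬝ᵥ k' s) := by
    have e1 := ae_all_iff.2 fun a => ae_hasDerivAt_of_absolutelyContinuous hr (hψ a)
    have e2 := ae_all_iff.2 fun a => ae_all_iff.2 fun b => (hS.absolutelyContinuous hr a b).2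
    have e3 := ae_all_iff.2 fun a => ae_all_iff.2 fun b => (hQ.absolutelyContinuous hr a b).2
    have e4 := ae_all_iff.2 hk
    filter_upwards [e1, e2, e3, e4, ae_lebIcc_mem_Ioo r] with s h1 h2 h3 h4 hs
    refine dotProduct_deriv_segment (hSsymm s (Ioo_subset_Icc_self hs)) h1 h2 h3 h4
      (fun a => hη a s hs) ?_
    filter_upwards [isOpen_Ioo.mem_nhds hs] with t ht using hηeq t (Ioo_subset_Icc_self ht)
  rw [← integral_const_mul, integral_congr_ae key, integral_add (by
    exact (iQ.const_mul (2 * c)).add ((iS.add hfi).const_mul c)) (hki.const_mul 2),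
    integral_add (iQ.const_mul _) (by exact (iS.add hfi).const_mul c), integral_const_mul,
    integral_const_mul, integral_const_mul, integral_add iS hfi, hfe]

theorem kernelApply_deriv {r r' : ℝ} (hr : 0 < r) {R R₁ R₂ : ℝ → ℝ → Matrix (Fin n) (Fin n) ℝ}
    (hR : MemW2Rect r r' R R₁ R₂) {φ : ℝ → Fin n → ℝ}
    (hφ : ∀ b, MemLp (fun s => φ s b) 2 (lebIcc r')) (a : Fin n) :
    AbsolutelyContinuousOnInterval (fun s => kernelApply (lebIcc r') R φ s a) (-r) 0 ∧
    ∀ᵐ s ∂(lebIcc r), HasDerivAt (fun s => kernelApply (lebIcc r') R φ s a)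
      (kernelApply (lebIcc r') R₁ φ s a) s := by
  have h : ∀ b, AbsolutelyContinuousOnInterval (fun s => ∫ θ, R s θ a b * φ θ b ∂(lebIcc r')) (-r) 0
      ∧ ∀ᵐ s ∂(lebIcc r), HasDerivAt (fun s => ∫ θ, R s θ a b * φ θ b ∂(lebIcc r'))
        (∫ θ, R₁ s θ a b * φ θ b ∂(lebIcc r')) s := fun b => by
    obtain ⟨h1, h2, h3⟩ := isWeakDeriv_integral_mul (R := fun s θ => R s θ a b)
      (R' := fun s θ => R₁ s θ a b) (hR a b).1 (by rw [lebIcc_prod]; exact (hR a b).2.1)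
      (hR a b).2.2.2.1 (hφ b)
    exact absolutelyContinuous_of_isWeakDeriv (neg_lt_zero.2 hr) h1 h2 h3
  refine ⟨absolutelyContinuousOnInterval_sum _ fun b _ => (h b).1, ?_⟩
  filter_upwards [ae_all_iff.2 fun b => (h b).2] with s hs
  exact HasDerivAt.fun_sum fun b _ => hs b

theorem integrable_bilinear_of_memLp {r r' : ℝ} {R : ℝ → ℝ → Matrix (Fin n) (Fin n) ℝ}
    (hR : ∀ a b, MemLp (fun p : ℝ × ℝ => R p.1 p.2 a b) 2 ((lebIcc r).prod (lebIcc r')))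
    {ψ φ : ℝ → Fin n → ℝ} (hψ : ∀ a, ContinuousOn (fun s => ψ s a) (Icc (-r) 0))
    (hφ : ∀ a, ContinuousOn (fun s => φ s a) (Icc (-r') 0)) (a b : Fin n) :
    Integrable (fun p : ℝ × ℝ => ψ p.1 a * R p.1 p.2 a b * φ p.2 b)
      ((lebIcc r).prod (lebIcc r')) := by
  have h := (hR a b).integrable one_le_two
  rw [lebIcc_prod] at h ⊢
  have h' : IntegrableOn (fun p : ℝ × ℝ => R p.1 p.2 a b) (Icc (-r) 0 ×ˢ Icc (-r') 0) := h
  exact (h'.continuousOn_mul ((hψ a).comp continuousOn_fst fun p hp => hp.1)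
    (isCompact_Icc.prod isCompact_Icc)).mul_continuousOn
    ((hφ b).comp continuousOn_snd fun p hp => hp.2) (isCompact_Icc.prod isCompact_Icc)

/-- By the symmetry of `R`, the `θ`-derivative of `Rᵢⱼ` is the transposed, swapped `s`-derivative of
`Rⱼᵢ`. After exchanging indices, the two halves of `Gᵢⱼ` contribute equally to the double sum. -/
theorem sum_integral_G {R R₁ R₂ : Fin K → Fin K → ℝ → ℝ → Matrix (Fin n) (Fin n) ℝ}
    (hR : ∀ i j, MemW2Rect (τ i.succ) (τ j.succ) (R i j) (R₁ i j) (R₂ i j))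
    (hRsymm : ∀ i j, ∀ s ∈ Icc (-τ i.succ) 0, ∀ θ ∈ Icc (-τ j.succ) 0,
      R i j s θ = (R j i θ s)ᵀ) {ψ : Fin K → ℝ → Fin n → ℝ}
    (hψ : ∀ i a, ContinuousOn (fun s => ψ i s a) (Icc (-τ i.succ) 0)) :
    ∑ i, ∑ j, ∫ p, ψ i p.1 ⬝ᵥ G R₁ R₂ i j p.1 p.2 *ᵥ ψ j p.2
      ∂((lebIcc (τ i.succ)).prod (lebIcc (τ j.succ))) =
    2 * ∑ i, ∑ j, ∫ p, ψ i p.1 ⬝ᵥ R₁ i j p.1 p.2 *ᵥ ψ j p.2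
      ∂((lebIcc (τ i.succ)).prod (lebIcc (τ j.succ))) := by
  have m1 : ∀ i j a b, MemLp (fun p : ℝ × ℝ => R₁ i j p.1 p.2 a b) 2
      ((lebIcc (τ i.succ)).prod (lebIcc (τ j.succ))) := fun i j a b => by
    rw [lebIcc_prod]; exact (hR i j a b).2.1
  have m2 : ∀ i j a b, MemLp (fun p : ℝ × ℝ => R₂ i j p.1 p.2 a b) 2
      ((lebIcc (τ i.succ)).prod (lebIcc (τ j.succ))) := fun i j a b => by
    rw [lebIcc_prod]; exact (hR i j a b).2.2.1
  have i1 := fun i j => (integral_dotProduct_mulVec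
    (integrable_bilinear_of_memLp (m1 i j) (hψ i) (hψ j))).1
  have i2 := fun i j => (integral_dotProduct_mulVec
    (integrable_bilinear_of_memLp (m2 i j) (hψ i) (hψ j))).1
  have e : ∀ i j, ∫ p, ψ i p.1 ⬝ᵥ G R₁ R₂ i j p.1 p.2 *ᵥ ψ j p.2
      ∂((lebIcc (τ i.succ)).prod (lebIcc (τ j.succ))) =
      ∫ p, ψ i p.1 ⬝ᵥ R₁ i j p.1 p.2 *ᵥ ψ j p.2
        ∂((lebIcc (τ i.succ)).prod (lebIcc (τ j.succ))) +
      ∫ p, ψ i p.1 ⬝ᵥ R₂ i j p.1 p.2 *ᵥ ψ j p.2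
        ∂((lebIcc (τ i.succ)).prod (lebIcc (τ j.succ))) := fun i j => by
    rw [← integral_add (i1 i j) (i2 i j)]
    simp only [G, Matrix.add_mulVec, dotProduct_add]
  have sw : ∀ i j, ∫ p, ψ i p.1 ⬝ᵥ R₂ i j p.1 p.2 *ᵥ ψ j p.2
        ∂((lebIcc (τ i.succ)).prod (lebIcc (τ j.succ))) =
      ∫ p, ψ j p.1 ⬝ᵥ R₁ j i p.1 p.2 *ᵥ ψ i p.2
        ∂((lebIcc (τ j.succ)).prod (lebIcc (τ i.succ))) := fun i j => by
    rw [← integral_prod_swap]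
    refine integral_congr_ae ?_
    have := ae_all_iff.2 fun a => ae_all_iff.2 fun b => ae_eq_swap_of_isWeakDeriv
      (R := fun s θ => R j i s θ a b) (T := fun s θ => R i j s θ b a)
      (R₁ := fun s θ => R₁ j i s θ a b) (T₂ := fun s θ => R₂ i j s θ b a)
      (m1 j i a b) (m2 i j b a) (hR j i a b).2.2.2.1 (hR i j b a).2.2.2.2
      (fun s hs θ hθ => by rw [hRsymm j i s hs θ hθ, Matrix.transpose_apply])
    filter_upwards [this] with p hp
    have e : R₂ i j p.2 p.1 = (R₁ j i p.1 p.2)ᵀ := by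
      ext b a
      exact (hp a b).symm
    rw [Prod.fst_swap, Prod.snd_swap, e, Matrix.mulVec_transpose, dotProduct_comm,
      ← Matrix.dotProduct_mulVec]
  simp_rw [e, Finset.sum_add_distrib, sw]
  rw [Finset.sum_comm (f := fun i j => ∫ p, ψ j p.1 ⬝ᵥ R₁ j i p.1 p.2 *ᵥ ψ i p.2
        ∂((lebIcc (τ j.succ)).prod (lebIcc (τ i.succ)))), two_mul]

end Dissipation


/-! ### The second constraint as the derivative of the Lyapunov function -/

section DissipationForm

variable {n K : ℕ} {τ : Fin (K + 1) → ℝ}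

theorem dotProduct_integral_mulVec {X α β : Type*} [MeasurableSpace X] {μ : Measure X}
    [Fintype α] [Fintype β] {A : X → Matrix α β ℝ} {φ : X → β → ℝ}
    (h : ∀ a b, Integrable (fun s => A s a b * φ s b) μ) (y : α → ℝ) :
    Integrable (fun s => y ⬝ᵥ A s *ᵥ φ s) μ ∧
    y ⬝ᵥ (fun a => ∑ b, ∫ s, A s a b * φ s b ∂μ) = ∫ s, y ⬝ᵥ A s *ᵥ φ s ∂μ := by
  have h' := integral_dotProduct_mulVec (u := fun _ => y) (A := A) (v := φ) (κ := μ) fun a b => by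
    simp_rw [mul_assoc]
    exact (h a b).const_mul (y a)
  refine ⟨h'.1, ?_⟩
  rw [h'.2]
  simp only [dotProduct, Finset.mul_sum, mul_assoc, integral_const_mul]

theorem dotProduct_blockDiagonal {ι κ : Type*} [Fintype ι] [Fintype κ] [DecidableEq κ]
    (M : κ → Matrix ι ι ℝ) (u : κ → ι → ℝ) :
    (fun p : ι × κ => u p.2 p.1) ⬝ᵥ Matrix.blockDiagonal M *ᵥ (fun p : ι × κ => u p.2 p.1) =
      ∑ k, u k ⬝ᵥ M k *ᵥ u k := by
  simp only [dotProduct, Matrix.mulVec, Fintype.sum_prod_type, Matrix.blockDiagonal_apply, ite_mul,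
    zero_mul, Finset.sum_ite_eq, Finset.mem_univ, if_true]
  rw [Finset.sum_comm]

/-- The vectors `u i` stand for the boundary values `ψᵢ(-τᵢ)`. Since `C₀` enters with its transpose,
its `½ Sᵢ(0)` becomes the full boundary term at `0`, while the diagonal blocks carry the boundary
terms at `-τᵢ`. The matrices `A` are moved onto `x` to match the pairing of `x` with the right-hand
side of the delay equation. -/
theorem dotProduct_D1 (A₀ : Matrix (Fin n) (Fin n) ℝ) (A : Fin K → Matrix (Fin n) (Fin n) ℝ)
    (ε : ℝ) (P : Matrix (Fin n) (Fin n) ℝ) (Q S : Fin K → ℝ → Matrix (Fin n) (Fin n) ℝ)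
    (x : Fin n → ℝ) (u : Fin K → Fin n → ℝ) :
    (Sum.elim x fun p : Fin n × Fin K => u p.2 p.1) ⬝ᵥ D1 τ A₀ A ε P Q S *ᵥ
      (Sum.elim x fun p : Fin n × Fin K => u p.2 p.1) =
    2 * ((x ᵥ* A₀) ⬝ᵥ P *ᵥ x) + ∑ i, (2 * τ (Fin.last K) *
      ((x ᵥ* A i) ⬝ᵥ (Q i (-τ i.succ))ᵀ *ᵥ x) + x ⬝ᵥ S i 0 *ᵥ x +
      2 * τ (Fin.last K) * ((x ᵥ* A i) ⬝ᵥ S i (-τ i.succ) *ᵥ u i) -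
      u i ⬝ᵥ S i (-τ i.succ) *ᵥ u i) + ε * (x ⬝ᵥ x) := by
  have hC : Crow τ A S *ᵥ (fun p : Fin n × Fin K => u p.2 p.1) = ∑ i, Ci τ A S i *ᵥ u i := by
    ext a
    simp only [Matrix.mulVec, dotProduct, Fintype.sum_prod_type, Crow, Matrix.of_apply,
      Finset.sum_apply]
    rw [Finset.sum_comm]
  have hCt : (fun p : Fin n × Fin K => u p.2 p.1) ⬝ᵥ (Crow τ A S)ᵀ *ᵥ x =
      x ⬝ᵥ Crow τ A S *ᵥ (fun p : Fin n × Fin K => u p.2 p.1) := by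
    rw [Matrix.mulVec_transpose, dotProduct_comm, ← Matrix.dotProduct_mulVec]
  have hx : x ⬝ᵥ (C0 τ A₀ A P Q S)ᵀ *ᵥ x = x ⬝ᵥ C0 τ A₀ A P Q S *ᵥ x := by
    rw [Matrix.mulVec_transpose, dotProduct_comm, ← Matrix.dotProduct_mulVec]
  rw [D1, Matrix.fromBlocks_mulVec, sumElim_dotProduct_sumElim]
  simp only [Sum.elim_comp_inl, Sum.elim_comp_inr, dotProduct_add, hCt, dotProduct_blockDiagonal,
    hC, Matrix.add_mulVec, hx, Matrix.smul_mulVec, Matrix.one_mulVec, dotProduct_smul, smul_eq_mul,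
    Matrix.neg_mulVec, dotProduct_neg, dotProduct_sum]
  simp only [C0, Ci, Matrix.add_mulVec, Matrix.sum_mulVec, Matrix.smul_mulVec, dotProduct_add,
    dotProduct_sum, dotProduct_smul, smul_eq_mul, ← Matrix.mulVec_mulVec]
  simp only [Matrix.dotProduct_mulVec x, Finset.sum_add_distrib, Finset.sum_sub_distrib,
    Finset.sum_neg_distrib, ← Finset.mul_sum]
  ring

/-- The hypotheses say that `(x, ψ)` is mapped by the state operator to `(τ_K η(0), η)`, where `η`
obeys the delay equation at time `0`. The right-hand side is then `2 ⟪(τ_K η'(0), η'), (x, ψ)⟫` plus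
`ε τ_K` times the squared norm. Integration by parts on each segment yields `Q'`, `S'`, `∂R/∂s` and
the boundary terms; the delay equation, with `η(0)` and `η(-τᵢ)` expressed through `(x, ψ)`, yields
the terms containing `A`. The condition `ψᵢ(0) = x` turns the boundary values at `0` into the
`Sᵢ(0)` terms of `D₁`. -/
theorem L1val_dissipation (h0 : τ 0 = 0) (hτ : StrictMono τ)
    {A₀ : Matrix (Fin n) (Fin n) ℝ} {A : Fin K → Matrix (Fin n) (Fin n) ℝ}
    {ε : ℝ} {P : Matrix (Fin n) (Fin n) ℝ} {Q Q' S S' : Fin K → ℝ → Matrix (Fin n) (Fin n) ℝ}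
    {R R₁ R₂ : Fin K → Fin K → ℝ → ℝ → Matrix (Fin n) (Fin n) ℝ}
    (hQ : ∀ i, MemW2Interval (τ i.succ) (Q i) (Q' i))
    (hS : ∀ i, MemW2Interval (τ i.succ) (S i) (S' i))
    (hR : ∀ i j, MemW2Rect (τ i.succ) (τ j.succ) (R i j) (R₁ i j) (R₂ i j))
    (hSsymm : ∀ i, ∀ s ∈ Icc (-τ i.succ) 0, S i s = (S i s)ᵀ)
    (hRsymm : ∀ i j, ∀ s ∈ Icc (-τ i.succ) 0, ∀ θ ∈ Icc (-τ j.succ) 0,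
      R i j s θ = (R j i θ s)ᵀ)
    {x : Fin n → ℝ} {ψ : Fin K → ℝ → Fin n → ℝ}
    (hψ : ∀ i a, AbsolutelyContinuousOnInterval (fun s => ψ i s a) (-τ i.succ) 0)
    (hψ0 : ∀ i, ψ i 0 = x) {η η' : ℝ → Fin n → ℝ}
    (hη : ∀ a, ∀ s ∈ Ioo (-τ (Fin.last K)) 0, HasDerivAt (fun s => η s a) (η' s a) s)
    (hη0 : η 0 = P *ᵥ x + ∑ i, fun a => ∑ b, ∫ s, Q i s a b * ψ i s b ∂(lebIcc (τ i.succ)))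
    (hηs : ∀ i, ∀ s ∈ Icc (-τ i.succ) 0, η s = τ (Fin.last K) • ((Q i s)ᵀ *ᵥ x) +
      τ (Fin.last K) • (S i s *ᵥ ψ i s) + ∑ j, kernelApply (lebIcc (τ j.succ)) (R i j) (ψ j) s)
    (hdyn : η' 0 = A₀ *ᵥ η 0 + ∑ i, A i *ᵥ η (-τ i.succ)) :
    L1val τ (D1 τ A₀ A ε P Q S) (V τ A₀ A Q Q' R)
      (fun i s => S' i s + ε • (1 : Matrix (Fin n) (Fin n) ℝ)) (G R₁ R₂)
      (Sum.elim x fun p : Fin n × Fin K => ψ p.2 (-τ p.2.succ) p.1) ψ =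
    2 * (τ (Fin.last K) * (x ⬝ᵥ η' 0) + ∑ i, ∫ s, ψ i s ⬝ᵥ η' s ∂(lebIcc (τ i.succ))) +
      ε * τ (Fin.last K) * (x ⬝ᵥ x + ∑ i, ∫ s, ψ i s ⬝ᵥ ψ i s ∂(lebIcc (τ i.succ))) := by
  have hpos := delay_succ_pos h0 hτ
  have hψc := fun i a => continuousOn_of_absolutelyContinuous (hpos i) (hψ i a)
  have hψm := fun i a => memLp_of_continuousOn (hψc i a)
  have hle : ∀ i : Fin K, τ i.succ ≤ τ (Fin.last K) := fun i => hτ.monotone (Fin.le_last _)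
  have hmem : ∀ i : Fin K, -τ i.succ ∈ Icc (-τ i.succ) 0 := fun i =>
    ⟨le_rfl, neg_nonpos.2 (hpos i).le⟩
  -- integrability
  have iQ := fun i => dotProduct_integral_mulVec (μ := lebIcc (τ i.succ)) (A := Q i) (φ := ψ i)
    fun a b => (memLp_of_continuousOn (hQ i a b).1).integrable_mul (hψm i b)
  have iQ' := fun i => dotProduct_integral_mulVec (μ := lebIcc (τ i.succ)) (A := Q' i) (φ := ψ i)
    fun a b => (hQ i a b).2.1.integrable_mul (hψm i b)
  have iR := fun j i => dotProduct_integral_mulVec (μ := lebIcc (τ i.succ))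
    (A := R j i (-τ j.succ)) (φ := ψ i)
    fun a b => (memLp_of_continuousOn ((hR j i a b).1.comp (f := fun θ => (-τ j.succ, θ))
      (by fun_prop) fun θ hθ => ⟨hmem j, hθ⟩)).integrable_mul (hψm i b)
  have iS : ∀ i, Integrable (fun s => ψ i s ⬝ᵥ S' i s *ᵥ ψ i s) (lebIcc (τ i.succ)) := fun i =>
    (integral_dotProduct_mulVec fun a b => by
      have : IntegrableOn (fun s => S' i s a b) (Icc (-τ i.succ) 0) :=
        (hS i a b).2.1.integrable one_le_two
      exact (this.continuousOn_mul (hψc i a) isCompact_Icc).mul_continuousOn (hψc i b)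
        isCompact_Icc).1
  have iR₁ := fun i j => integral_dotProduct_kernelApply (integrable_bilinear_of_memLp
    (fun a b => by rw [lebIcc_prod]; exact (hR i j a b).2.1) (hψc i) (hψc j))
  -- integration by parts on each segment
  have seg : ∀ i, 2 * ∫ s, ψ i s ⬝ᵥ η' s ∂(lebIcc (τ i.succ)) =
      2 * τ (Fin.last K) * (∫ s, x ⬝ᵥ Q' i s *ᵥ ψ i s ∂(lebIcc (τ i.succ))) +
      τ (Fin.last K) * ((∫ s, ψ i s ⬝ᵥ S' i s *ᵥ ψ i s ∂(lebIcc (τ i.succ))) +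
        (x ⬝ᵥ S i 0 *ᵥ x -
          ψ i (-τ i.succ) ⬝ᵥ S i (-τ i.succ) *ᵥ ψ i (-τ i.succ))) +
      2 * ∑ j, ∫ p, ψ i p.1 ⬝ᵥ R₁ i j p.1 p.2 *ᵥ ψ j p.2
        ∂((lebIcc (τ i.succ)).prod (lebIcc (τ j.succ))) := by
    intro i
    have hk : ∀ a, ∀ᵐ s ∂(lebIcc (τ i.succ)), HasDerivAt
        (fun s => (∑ j, kernelApply (lebIcc (τ j.succ)) (R i j) (ψ j) s) a)
        ((∑ j, kernelApply (lebIcc (τ j.succ)) (R₁ i j) (ψ j) s) a) s := fun a => by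
      filter_upwards [ae_all_iff.2 fun j => (kernelApply_deriv (hpos i) (hR i j) (hψm j) a).2]
        with s hs
      simp only [Finset.sum_apply]
      exact HasDerivAt.fun_sum fun j _ => hs j
    have hki : Integrable (fun s => ψ i s ⬝ᵥ
        ∑ j, kernelApply (lebIcc (τ j.succ)) (R₁ i j) (ψ j) s) (lebIcc (τ i.succ)) := by
      simp only [dotProduct_sum]
      exact integrable_finsetSum _ fun j _ => (iR₁ i j).1
    have := integral_dotProduct_deriv (hpos i) (hQ i) (hS i) (hSsymm i) (hψ i) hk hki
      (fun a s hs => hη a s ⟨(neg_le_neg (hle i)).trans_lt hs.1, hs.2⟩) (hηs i)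
    rw [this, hψ0]
    simp only [dotProduct_sum]
    rw [integral_finsetSum _ fun j _ => (iR₁ i j).1]
    simp_rw [(iR₁ i _).2]
  -- the value of the derivative at the right end point
  have dyn : x ⬝ᵥ η' 0 = (x ᵥ* A₀) ⬝ᵥ P *ᵥ x +
      ∑ i, (∫ s, (x ᵥ* A₀) ⬝ᵥ Q i s *ᵥ ψ i s ∂(lebIcc (τ i.succ))) +
      ∑ i, (τ (Fin.last K) * ((x ᵥ* A i) ⬝ᵥ (Q i (-τ i.succ))ᵀ *ᵥ x) +
        τ (Fin.last K) * ((x ᵥ* A i) ⬝ᵥ S i (-τ i.succ) *ᵥ ψ i (-τ i.succ))) +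
      ∑ i, ∑ j, ∫ s, (x ᵥ* A j) ⬝ᵥ R j i (-τ j.succ) s *ᵥ ψ i s ∂(lebIcc (τ i.succ)) := by
    rw [hdyn, dotProduct_add, dotProduct_sum, Matrix.dotProduct_mulVec, hη0, dotProduct_add,
      dotProduct_sum]
    simp_rw [Matrix.dotProduct_mulVec x, hηs _ _ (hmem _), dotProduct_add, dotProduct_sum,
      dotProduct_smul, (iQ _ _).2]
    rw [Finset.sum_add_distrib]
    conv_rhs => rw [Finset.sum_comm]
    rw [← add_assoc]
    congr 1
    refine Finset.sum_congr rfl fun j _ => Finset.sum_congr rfl fun i _ => ?_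
    exact (iR j i _).2
  -- the multiplier `V`
  have hV : ∀ i, ∫ s, (Sum.elim x fun p : Fin n × Fin K => ψ p.2 (-τ p.2.succ) p.1) ⬝ᵥ
      V τ A₀ A Q Q' R i s *ᵥ ψ i s ∂(lebIcc (τ i.succ)) =
      (∫ s, (x ᵥ* A₀) ⬝ᵥ Q i s *ᵥ ψ i s ∂(lebIcc (τ i.succ))) +
      (∫ s, x ⬝ᵥ Q' i s *ᵥ ψ i s ∂(lebIcc (τ i.succ))) +
      ∑ j, ∫ s, (x ᵥ* A j) ⬝ᵥ R j i (-τ j.succ) s *ᵥ ψ i s ∂(lebIcc (τ i.succ)) := by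
    intro i
    rw [← integral_finsetSum _ fun j _ => (iR j i _).1, ← integral_add (iQ i _).1 (iQ' i _).1,
      ← integral_add (by exact (iQ i _).1.add (iQ' i _).1)
        (integrable_finsetSum _ fun j _ => (iR j i _).1)]
    congr 1
    ext s
    rw [V, Matrix.fromRows_mulVec, sumElim_dotProduct_sumElim, Matrix.zero_mulVec, dotProduct_zero,
      add_zero, B, Matrix.add_mulVec, Matrix.add_mulVec, dotProduct_add, dotProduct_add,
      ← Matrix.mulVec_mulVec, Matrix.dotProduct_mulVec x A₀, Matrix.sum_mulVec, dotProduct_sum]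
    simp_rw [← Matrix.mulVec_mulVec, Matrix.dotProduct_mulVec x (A _)]
  have hSε : ∀ i, ∫ s, ψ i s ⬝ᵥ (S' i s + ε • (1 : Matrix (Fin n) (Fin n) ℝ)) *ᵥ ψ i s
      ∂(lebIcc (τ i.succ)) = (∫ s, ψ i s ⬝ᵥ S' i s *ᵥ ψ i s ∂(lebIcc (τ i.succ))) +
      ε * ∫ s, ψ i s ⬝ᵥ ψ i s ∂(lebIcc (τ i.succ)) := by
    intro i
    simp_rw [Matrix.add_mulVec, Matrix.smul_mulVec, Matrix.one_mulVec, dotProduct_add,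
      dotProduct_smul, smul_eq_mul]
    rw [integral_add (iS i) ((integrable_dotProduct_self (hψm i)).const_mul ε), integral_const_mul]
  unfold L1val
  rw [sum_integral_G hR hRsymm hψc, dotProduct_D1 A₀ A ε P Q S x fun i => ψ i (-τ i.succ)]
  simp_rw [hV, hSε]
  rw [mul_add (2 : ℝ) (τ (Fin.last K) * (x ⬝ᵥ η' 0)), Finset.mul_sum Finset.univ
    (fun i => ∫ s, ψ i s ⬝ᵥ η' s ∂(lebIcc (τ i.succ))), Finset.sum_congr rfl fun i _ => seg i, dyn]
  simp only [mul_add, mul_sub, Finset.sum_add_distrib, Finset.sum_sub_distrib, ← Finset.mul_sum]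
  ring

end DissipationForm


/-! ### Regularity of the inverse image of a segment -/

section InverseSegment

variable {n K : ℕ} {τ : Fin (K + 1) → ℝ}

theorem absolutelyContinuousOnInterval_of_dist_le {ι : Type*} (t : Finset ι) {f : ℝ → ℝ}
    {g : ι → ℝ → ℝ} {a b M : ℝ} (hg : ∀ i ∈ t, AbsolutelyContinuousOnInterval (g i) a b)
    (h : ∀ u ∈ uIcc a b, ∀ v ∈ uIcc a b, dist (f u) (f v) ≤ M * ∑ i ∈ t, dist (g i u) (g i v)) :
    AbsolutelyContinuousOnInterval f a b := by
  have h1 := (tendsto_finsetSum t hg).const_mul M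
  simp only [Finset.sum_const_zero, mul_zero] at h1
  refine squeeze_zero' (Filter.Eventually.of_forall fun E => Finset.sum_nonneg fun _ _ => dist_nonneg)
    ?_ h1
  filter_upwards [Filter.mem_inf_of_right (Filter.mem_principal_self _)] with E hE
  rw [Finset.sum_comm, Finset.mul_sum]
  exact Finset.sum_le_sum fun i hi => h _ (hE.1 i hi).1 _ (hE.1 i hi).2

theorem isUnit_of_le_quadratic {S : Matrix (Fin n) (Fin n) ℝ} {ε : ℝ} (hε : 0 < ε)
    (h : ∀ x : Fin n → ℝ, ε * (x ⬝ᵥ x) ≤ x ⬝ᵥ S *ᵥ x) : IsUnit S := by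
  rw [← Matrix.mulVec_injective_iff_isUnit]
  refine (injective_iff_map_eq_zero (Matrix.mulVecLin S)).2 fun x hx => ?_
  have h1 := h x
  rw [Matrix.mulVecLin_apply] at hx
  rw [hx, dotProduct_zero] at h1
  have h2 : x ⬝ᵥ x ≤ 0 := by nlinarith
  have h3 : 0 ≤ x ⬝ᵥ x := by simpa using dotProduct_star_self_nonneg x
  exact dotProduct_self_eq_zero.1 (le_antisymm h2 h3)

/-- The column `v = S⁻¹ e_b` satisfies `ε |v|² ≤ v·Sv = v_b`. Comparing with `v_b² ≤ |v|²` gives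
`v_b ≤ 1/ε`, and then `v_a² ≤ v_b/ε ≤ 1/ε²`. -/
theorem abs_inv_apply_le {S : Matrix (Fin n) (Fin n) ℝ} {ε : ℝ} (hε : 0 < ε)
    (h : ∀ x : Fin n → ℝ, ε * (x ⬝ᵥ x) ≤ x ⬝ᵥ S *ᵥ x) (a b : Fin n) : |S⁻¹ a b| ≤ 1 / ε := by
  have hu := (Matrix.isUnit_iff_isUnit_det S).1 (isUnit_of_le_quadratic hε h)
  let v : Fin n → ℝ := S⁻¹ *ᵥ Pi.single b 1
  have hv : ∀ a, v a = S⁻¹ a b := fun a => by simp [v]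
  have h1 := h v
  have h2 : S *ᵥ v = Pi.single b 1 := by
    simp only [v, Matrix.mulVec_mulVec, Matrix.mul_nonsing_inv _ hu, Matrix.one_mulVec]
  rw [h2, dotProduct_single, mul_one] at h1
  have h3 : ∀ a, v a ^ 2 ≤ v ⬝ᵥ v := fun a => by
    rw [dotProduct, sq]
    exact Finset.single_le_sum (f := fun i => v i * v i) (fun i _ => mul_self_nonneg (v i))
      (Finset.mem_univ a)
  have h4 : v b ≤ 1 / ε := by
    rw [le_div_iff₀ hε]
    by_contra hc
    have : 0 < v b := by
      by_contra h5
      nlinarith [h3 b]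
    nlinarith [h3 b]
  rw [← hv]
  refine abs_le_of_sq_le_sq ?_ (by positivity)
  have h6 : v a ^ 2 ≤ v b / ε := by
    rw [le_div_iff₀ hε]
    nlinarith [h3 a]
  calc v a ^ 2 ≤ v b / ε := h6
    _ ≤ (1 / ε) / ε := by gcongr
    _ = (1 / ε) ^ 2 := by ring

/-- The identity `S(u)⁻¹ - S(v)⁻¹ = S(u)⁻¹ (S(v) - S(u)) S(v)⁻¹`, with inverses bounded entrywise by
`1/ε`, controls the increments of the inverse by those of the entries of `S`. -/
theorem absolutelyContinuous_inv {a b ε : ℝ} (hε : 0 < ε) {S : ℝ → Matrix (Fin n) (Fin n) ℝ}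
    (hS : ∀ i j, AbsolutelyContinuousOnInterval (fun s => S s i j) a b)
    (h : ∀ s ∈ uIcc a b, ∀ x : Fin n → ℝ, ε * (x ⬝ᵥ x) ≤ x ⬝ᵥ S s *ᵥ x) (i j : Fin n) :
    AbsolutelyContinuousOnInterval (fun s => (S s)⁻¹ i j) a b := by
  refine absolutelyContinuousOnInterval_of_dist_le (Finset.univ : Finset (Fin n × Fin n))
    (g := fun p s => S s p.1 p.2) (M := (1 / ε) * (1 / ε)) (fun p _ => hS p.1 p.2) fun u hu v hv => ?_
  have h1 := (Matrix.isUnit_iff_isUnit_det _).1 (isUnit_of_le_quadratic hε (h u hu))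
  have h2 := (Matrix.isUnit_iff_isUnit_det _).1 (isUnit_of_le_quadratic hε (h v hv))
  have e : (S u)⁻¹ - (S v)⁻¹ = (S u)⁻¹ * ((S v - S u) * (S v)⁻¹) := by
    rw [sub_mul, mul_sub, Matrix.mul_nonsing_inv _ h2, mul_one, ← mul_assoc,
      Matrix.nonsing_inv_mul _ h1, one_mul]
  have e2 : (S u)⁻¹ i j - (S v)⁻¹ i j =
      ∑ p : Fin n × Fin n, (S u)⁻¹ i p.1 * ((S v p.1 p.2 - S u p.1 p.2) * (S v)⁻¹ p.2 j) := by
    rw [← Matrix.sub_apply, e, Matrix.mul_apply, Fintype.sum_prod_type]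
    simp only [Matrix.mul_apply, Finset.mul_sum, Matrix.sub_apply]
  rw [Real.dist_eq, e2, Finset.mul_sum]
  refine (Finset.abs_sum_le_sum_abs _ _).trans (Finset.sum_le_sum fun p _ => ?_)
  rw [abs_mul, abs_mul, dist_comm, Real.dist_eq]
  have b1 := abs_inv_apply_le hε (h u hu) i p.1
  have b2 := abs_inv_apply_le hε (h v hv) p.2 j
  calc |(S u)⁻¹ i p.1| * (|S v p.1 p.2 - S u p.1 p.2| * |(S v)⁻¹ p.2 j|)
      ≤ (1 / ε) * (|S v p.1 p.2 - S u p.1 p.2| * (1 / ε)) := by gcongr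
    _ = _ := by ring

theorem absolutelyContinuous_of_hasDerivAt {r : ℝ} (hr : 0 < r) {f f' : ℝ → ℝ}
    (hf : ∀ s ∈ Icc (-r) 0, HasDerivAt f (f' s) s) (hf' : ContinuousOn f' (Icc (-r) 0)) :
    AbsolutelyContinuousOnInterval f (-r) 0 := by
  obtain ⟨C, hC⟩ := isCompact_Icc.exists_bound_of_continuousOn hf'
  refine LipschitzOnWith.absolutelyContinuousOnInterval (K := C.toNNReal) ?_
  rw [uIcc_of_le (neg_nonpos.2 hr.le)]
  exact (convex_Icc _ _).lipschitzOnWith_of_nnnorm_hasDerivWithin_le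
    (fun s hs => (hf s hs).hasDerivWithinAt) fun s hs => by
      rw [← NNReal.coe_le_coe, coe_nnnorm]
      exact (hC s hs).trans (Real.le_coe_toNNReal C)

theorem kernelApply_congr {r : ℝ} {R : ℝ → ℝ → Matrix (Fin n) (Fin n) ℝ} {φ ψ : ℝ → Fin n → ℝ}
    (h : ∀ᵐ s ∂(lebIcc r), φ s = ψ s) : kernelApply (lebIcc r) R φ = kernelApply (lebIcc r) R ψ := by
  ext s a
  refine Finset.sum_congr rfl fun b _ => integral_congr_ae ?_
  filter_upwards [h] with θ hθ
  rw [hθ]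

/-- The decay inequality for `z = T⁻¹ y`, with `y = (τ_K η(0), η)` and `w = (τ_K η'(0), η')`. A
priori `z` is only an `L²` object; solving the function part of `T z = y` for it gives absolutely
continuous representatives with the right value at `0`, after which the dissipation identity and the
second constraint apply. -/
theorem inner_le_of_memXi (hK : 1 ≤ K) (h0 : τ 0 = 0) (hτ : StrictMono τ)
    {A₀ : Matrix (Fin n) (Fin n) ℝ} {A : Fin K → Matrix (Fin n) (Fin n) ℝ} {d : ℕ}
    {ε : ℝ} (hε : 0 < ε) {P : Matrix (Fin n) (Fin n) ℝ}
    {Q Q' S S' : Fin K → ℝ → Matrix (Fin n) (Fin n) ℝ}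
    {R R₁ R₂ : Fin K → Fin K → ℝ → ℝ → Matrix (Fin n) (Fin n) ℝ}
    (hQ : ∀ i, MemW2Interval (τ i.succ) (Q i) (Q' i))
    (hS : ∀ i, MemW2Interval (τ i.succ) (S i) (S' i))
    (hR : ∀ i j, MemW2Rect (τ i.succ) (τ j.succ) (R i j) (R₁ i j) (R₂ i j))
    {F₁ : ℝ → Matrix (Fin n ⊕ Fin n) (Fin n ⊕ Fin n) ℝ}
    {H₁ : ℝ → ℝ → Matrix (Fin n ⊕ Fin n) (Fin n ⊕ Fin n) ℝ}
    (hFH₁ : MemTheta (τ (Fin.last K)) F₁ H₁)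
    {F₂ : ℝ → Matrix ((Fin n ⊕ Fin n × Fin K) ⊕ Fin n) ((Fin n ⊕ Fin n × Fin K) ⊕ Fin n) ℝ}
    {H₂ : ℝ → ℝ → Matrix ((Fin n ⊕ Fin n × Fin K) ⊕ Fin n) ((Fin n ⊕ Fin n × Fin K) ⊕ Fin n) ℝ}
    (hFH₂ : MemTheta (τ (Fin.last K)) F₂ H₂)
    (hMN : MemXi τ d (Mfun τ ε P Q S F₁) (Nfun τ R H₁))
    (hDE : MemXi τ d (fun s => -Dfun τ A₀ A ε P Q Q' S S' R F₂ s)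
      (fun s θ => -Efun τ R₁ R₂ H₂ s θ))
    (hP : ∀ i, P = τ (Fin.last K) • (Q i 0)ᵀ + τ (Fin.last K) • S i 0)
    (hSsymm : ∀ i, ∀ s ∈ Icc (-τ i.succ) 0, S i s = (S i s)ᵀ)
    (hRsymm : ∀ i j, ∀ s ∈ Icc (-τ i.succ) 0, ∀ θ ∈ Icc (-τ j.succ) 0,
      R i j s θ = (R j i θ s)ᵀ)
    (hQR : ∀ i j, ∀ s ∈ Icc (-τ j.succ) 0, Q j s = R i j 0 s)
    {T : State n τ →L[ℝ] State n τ} (hT : IsStateOp P Q S R T) {η η' : ℝ → Fin n → ℝ}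
    (hη : ∀ a, ∀ s ∈ Icc (-τ (Fin.last K)) 0, HasDerivAt (fun s => η s a) (η' s a) s)
    (hη' : ∀ a, ContinuousOn (fun s => η' s a) (Icc (-τ (Fin.last K)) 0))
    (hdyn : η' 0 = A₀ *ᵥ η 0 + ∑ i, A i *ᵥ η (-τ i.succ)) {z w : State n τ}
    (hz0 : (T z).fst.ofLp = τ (Fin.last K) • η 0)
    (hz : ∀ i, ∀ᵐ s ∂(lebIcc (τ i.succ)), (T z).fn i s = η s)
    (hw0 : w.fst.ofLp = τ (Fin.last K) • η' 0)
    (hw : ∀ i, ∀ᵐ s ∂(lebIcc (τ i.succ)), w.fn i s = η' s) :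
    inner ℝ w z ≤ -(ε * τ (Fin.last K) / 2) * inner ℝ z z := by
  have hpos := delay_succ_pos h0 hτ
  have hc := delay_last_pos hK h0 hτ
  have hc' := hc.ne'
  have hle : ∀ i : Fin K, Icc (-τ i.succ) 0 ⊆ Icc (-τ (Fin.last K)) 0 := fun i =>
    Icc_subset_Icc_left (neg_le_neg (hτ.monotone (Fin.le_last _)))
  have hmem0 : ∀ i : Fin K, (0 : ℝ) ∈ Icc (-τ i.succ) 0 := fun i =>
    ⟨neg_nonpos.2 (hpos i).le, le_rfl⟩
  have hSq := fun i s (hs : s ∈ Icc (-τ i.succ) 0) =>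
    le_quadratic_of_memXi hK h0 hτ hε (fun i a b => (hS i a b).1) hFH₁ hMN i hs
  have hSu := fun i s (hs : s ∈ Icc (-τ i.succ) 0) =>
    (Matrix.isUnit_iff_isUnit_det _).1 (isUnit_of_le_quadratic hε (hSq i s hs))
  let x := z.fst.ofLp
  let k : Fin K → ℝ → Fin n → ℝ := fun i s =>
    ∑ j, kernelApply (lebIcc (τ j.succ)) (R i j) (z.fn j) s
  -- What `Sᵢ(s) z(s)` must equal according to the `i`-th function component. It is defined at every
  -- `s`, and its kernel term needs only the `L²` class of `z`, so there is no circularity.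
  let u : Fin K → ℝ → Fin n → ℝ := fun i s =>
    (τ (Fin.last K))⁻¹ • (η s - k i s) - (Q i s)ᵀ *ᵥ x
  let ψ : Fin K → ℝ → Fin n → ℝ := fun i s => (S i s)⁻¹ *ᵥ u i s
  have hSψ : ∀ i, ∀ s ∈ Icc (-τ i.succ) 0, S i s *ᵥ ψ i s = u i s := fun i s hs => by
    simp only [ψ, Matrix.mulVec_mulVec, Matrix.mul_nonsing_inv _ (hSu i s hs), Matrix.one_mulVec]
  -- `ψ` is a representative of the function component of `z`
  have hψz : ∀ i, ∀ᵐ s ∂(lebIcc (τ i.succ)), z.fn i s = ψ i s := by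
    intro i
    filter_upwards [hz i, (hT z).2 i, ae_restrict_mem measurableSet_Icc] with s h1 h2 hs
    rw [h1] at h2
    have : u i s = S i s *ᵥ z.fn i s := by
      simp only [u, k]
      rw [h2, add_sub_cancel_right, ← smul_add, inv_smul_smul₀ hc', add_sub_cancel_left]
    simp only [ψ, this, Matrix.mulVec_mulVec, Matrix.nonsing_inv_mul _ (hSu i s hs),
      Matrix.one_mulVec]
  -- absolute continuity
  have hk : ∀ i a, AbsolutelyContinuousOnInterval (fun s => k i s a) (-τ i.succ) 0 := by
    intro i a
    simp only [k, Finset.sum_apply]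
    exact absolutelyContinuousOnInterval_sum _ fun j _ =>
      (kernelApply_deriv (hpos i) (hR i j) (z.memLp_fn j) a).1
  have hu : ∀ i a, AbsolutelyContinuousOnInterval (fun s => u i s a) (-τ i.succ) 0 := by
    intro i a
    have h1 := absolutelyContinuous_of_hasDerivAt (hpos i) (fun s hs => hη a s (hle i hs))
      ((hη' a).mono (hle i))
    have h2 : AbsolutelyContinuousOnInterval (fun s => ∑ b, Q i s b a * x b) (-τ i.succ) 0 :=
      absolutelyContinuousOnInterval_sum _ fun b _ =>
        ((hQ i).absolutelyContinuous (hpos i) b a).1.mul (absolutelyContinuousOnInterval_const _ _ _)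
    exact ((h1.sub (hk i a)).const_mul _).sub h2
  have hψ : ∀ i a, AbsolutelyContinuousOnInterval (fun s => ψ i s a) (-τ i.succ) 0 := by
    intro i a
    simp only [ψ, Matrix.mulVec, dotProduct]
    refine absolutelyContinuousOnInterval_sum _ fun b _ => AbsolutelyContinuousOnInterval.mul ?_
      (hu i b)
    refine absolutelyContinuous_inv hε
      (fun a b => ((hS i).absolutelyContinuous (hpos i) a b).1) ?_ a b
    rw [uIcc_of_le (neg_nonpos.2 (hpos i).le)]
    exact hSq i
  have hη0 : η 0 = P *ᵥ x + ∑ i, fun a => ∑ b, ∫ s, Q i s a b * ψ i s b ∂(lebIcc (τ i.succ)) := by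
    have h1 := (hT z).1
    rw [hz0] at h1
    rw [smul_right_injective _ hc' h1]
    congr 1
    refine Finset.sum_congr rfl fun i _ => ?_
    ext a
    refine Finset.sum_congr rfl fun b _ => integral_congr_ae ?_
    filter_upwards [hψz i] with s hs
    rw [hs]
  have hηs : ∀ i, ∀ s ∈ Icc (-τ i.succ) 0, η s = τ (Fin.last K) • ((Q i s)ᵀ *ᵥ x) +
      τ (Fin.last K) • (S i s *ᵥ ψ i s) +
      ∑ j, kernelApply (lebIcc (τ j.succ)) (R i j) (ψ j) s := by
    intro i s hs
    rw [hSψ i s hs]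
    simp_rw [← kernelApply_congr (R := R i _) (hψz _)]
    simp only [u, k]
    rw [smul_sub, smul_inv_smul₀ hc']
    abel
  -- At `s = 0` the kernel term becomes the integral term of `η(0)`, since `Rᵢⱼ(0, ·) = Qⱼ`. The
  -- formula for `P` then leaves `Sᵢ(0) x = Sᵢ(0) ψᵢ(0)`, and `Sᵢ(0)` is injective.
  have hψ0 : ∀ i, ψ i 0 = x := by
    intro i
    have h1 := hηs i 0 (hmem0 i)
    have h2 : (∑ j, kernelApply (lebIcc (τ j.succ)) (R i j) (ψ j) 0) =
        ∑ i, fun a => ∑ b, ∫ s, Q i s a b * ψ i s b ∂(lebIcc (τ i.succ)) := by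
      refine Finset.sum_congr rfl fun j _ => ?_
      ext a
      refine Finset.sum_congr rfl fun b _ => integral_congr_ae ?_
      filter_upwards [ae_restrict_mem measurableSet_Icc] with s hs
      rw [hQR i j s hs]
    rw [h2, hη0, hP i, Matrix.add_mulVec, Matrix.smul_mulVec, Matrix.smul_mulVec] at h1
    have h3 : S i 0 *ᵥ x = S i 0 *ᵥ ψ i 0 :=
      smul_right_injective _ hc' (add_left_cancel (add_right_cancel h1))
    exact ((Matrix.mulVec_injective_iff_isUnit.2
      (isUnit_of_le_quadratic hε (hSq i 0 (hmem0 i)))) h3).symm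
  have key := L1val_nonpos_of_memXi hK h0 hτ hQ hS hR hFH₂ hDE
    (Sum.elim x fun p : Fin n × Fin K => ψ p.2 (-τ p.2.succ) p.1)
    (fun i a => continuousOn_of_absolutelyContinuous (hpos i) (hψ i a))
  rw [L1val_dissipation h0 hτ hQ hS hR hSsymm hRsymm hψ hψ0
    (fun a s hs => hη a s (Ioo_subset_Icc_self hs)) hη0 hηs hdyn] at key
  have e1 : inner ℝ w z = τ (Fin.last K) * (x ⬝ᵥ η' 0) +
      ∑ i, ∫ s, ψ i s ⬝ᵥ η' s ∂(lebIcc (τ i.succ)) := by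
    rw [State.inner_eq, hw0, smul_dotProduct, smul_eq_mul, dotProduct_comm (η' 0)]
    congr 1
    refine Finset.sum_congr rfl fun i _ => integral_congr_ae ?_
    filter_upwards [hw i, hψz i] with s h1 h2
    rw [h1, h2, dotProduct_comm]
  have e2 : inner ℝ z z = x ⬝ᵥ x + ∑ i, ∫ s, ψ i s ⬝ᵥ ψ i s ∂(lebIcc (τ i.succ)) := by
    rw [State.inner_eq]
    congr 1
    refine Finset.sum_congr rfl fun i _ => integral_congr_ae ?_
    filter_upwards [hψz i] with s h2
    rw [h2]
  rw [e1, e2]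
  linarith

end InverseSegment


/-! ### Exponential decay from the Lyapunov inequality -/

section Lyapunov

/-- For `W = ⟪y, T' y⟫` with `T'` self-adjoint, `W' = 2 ⟪y', T' y⟫ ≤ -2c' ‖T' y‖²`. Boundedness of
`T` gives `W ≤ M ‖T' y‖²`, hence `W' ≤ -2βW`; coercivity gives `c ‖T' y‖² ≤ W`, which returns the
decay to `y = T (T' y)`. The constants depend only on the operators, `c` and `c'`, not on the curve.
-/
theorem exists_exp_decay {E : Type*} [NormedAddCommGroup E] [InnerProductSpace ℝ E]
    {T T' : E →L[ℝ] E} (hTT' : ∀ z, T (T' z) = z ∧ T' (T z) = z)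
    (hsymm : ∀ z w, inner ℝ w (T z) = inner ℝ z (T w)) {c c' : ℝ} (hc : 0 < c) (hc' : 0 < c')
    (hcoer : ∀ z, c * inner ℝ z z ≤ inner ℝ z (T z)) :
    ∃ C : ℝ, 0 < C ∧ ∃ β : ℝ, 0 < β ∧ ∀ (y y' : ℝ → E) (t₀ : ℝ),
      (∀ t, t₀ ≤ t → HasDerivAt y (y' t) t) →
      (∀ t, t₀ ≤ t → inner ℝ (y' t) (T' (y t)) ≤ -c' * inner ℝ (T' (y t)) (T' (y t))) →
      ∀ t, t₀ ≤ t → ‖y t‖ ≤ C * Real.exp (-β * (t - t₀)) * ‖y t₀‖ := by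
  have hsymm' : ∀ a b, inner ℝ a (T' b) = inner ℝ (T' a) b := fun a b => by
    have := hsymm (T' a) (T' b)
    rw [(hTT' a).1, (hTT' b).1] at this
    rw [real_inner_comm, this]
  -- The added `1` keeps `M` positive even on a trivial space.
  let M := ‖T‖ + 1
  have hM : 0 < M := by positivity
  let β := c' / M
  have hβ : 0 < β := by positivity
  refine ⟨M * Real.sqrt ((‖T'‖ + 1) / c), by positivity, β, hβ, fun y y' t₀ hy hd t ht => ?_⟩
  let W : ℝ → ℝ := fun t => inner ℝ (y t) (T' (y t))
  have hW : ∀ t, t₀ ≤ t → HasDerivAt W (2 * inner ℝ (y' t) (T' (y t))) t := fun t ht => by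
    refine ((hy t ht).inner ℝ (T'.hasFDerivAt.comp_hasDerivAt t (hy t ht))).congr_deriv ?_
    rw [hsymm', real_inner_comm, Function.comp_apply]
    ring
  have hWle : ∀ t, W t ≤ M * inner ℝ (T' (y t)) (T' (y t)) := fun t => by
    have h1 : W t = inner ℝ (T (T' (y t))) (T' (y t)) := by rw [(hTT' _).1]
    rw [h1, real_inner_self_eq_norm_sq]
    calc inner ℝ (T (T' (y t))) (T' (y t)) ≤ ‖T (T' (y t))‖ * ‖T' (y t)‖ := real_inner_le_norm _ _
      _ ≤ (‖T‖ * ‖T' (y t)‖) * ‖T' (y t)‖ := by gcongr; exact T.le_opNorm _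
      _ ≤ (M * ‖T' (y t)‖) * ‖T' (y t)‖ := by gcongr; simp [M]
      _ = M * ‖T' (y t)‖ ^ 2 := by ring
  have hleW : ∀ t, c * ‖T' (y t)‖ ^ 2 ≤ W t := fun t => by
    have := hcoer (T' (y t))
    rwa [(hTT' _).1, real_inner_self_eq_norm_sq, real_inner_comm] at this
  have hanti : AntitoneOn (fun t => Real.exp (2 * β * (t - t₀)) * W t) (Ici t₀) := by
    have hg : ∀ t, t₀ ≤ t → HasDerivAt (fun t => Real.exp (2 * β * (t - t₀)) * W t)
        (Real.exp (2 * β * (t - t₀)) * (2 * β) * W t +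
          Real.exp (2 * β * (t - t₀)) * (2 * inner ℝ (y' t) (T' (y t)))) t := fun t ht => by
      have h1 : HasDerivAt (fun t => 2 * β * (t - t₀)) (2 * β) t := by
        simpa using ((hasDerivAt_id t).sub_const t₀).const_mul (2 * β)
      exact h1.exp.mul (hW t ht)
    refine antitoneOn_of_deriv_nonpos (convex_Ici t₀)
      (fun t ht => (hg t ht).continuousAt.continuousWithinAt)
      (fun t ht => ?_) fun t ht => ?_
    · rw [interior_Ici] at ht
      exact (hg t (le_of_lt ht)).differentiableAt.differentiableWithinAt
    · rw [interior_Ici] at ht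
      rw [(hg t (le_of_lt ht)).deriv]
      have h1 := hd t (le_of_lt ht)
      have h2 : β * W t ≤ c' * inner ℝ (T' (y t)) (T' (y t)) := by
        calc β * W t ≤ β * (M * inner ℝ (T' (y t)) (T' (y t))) := by gcongr; exact hWle t
          _ = _ := by simp only [β]; field_simp
      have h3 := Real.exp_pos (2 * β * (t - t₀))
      have h4 : β * W t + inner ℝ (y' t) (T' (y t)) ≤ 0 := by linarith
      nlinarith
  have h1 := hanti (mem_Ici.2 le_rfl) (mem_Ici.2 ht) ht
  simp only [sub_self, mul_zero, Real.exp_zero, one_mul] at h1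
  have h2 : W t₀ ≤ (‖T'‖ + 1) * ‖y t₀‖ ^ 2 := by
    calc W t₀ ≤ ‖y t₀‖ * ‖T' (y t₀)‖ := real_inner_le_norm _ _
      _ ≤ ‖y t₀‖ * (‖T'‖ * ‖y t₀‖) := by gcongr; exact T'.le_opNorm _
      _ ≤ ‖y t₀‖ * ((‖T'‖ + 1) * ‖y t₀‖) := by gcongr; simp
      _ = _ := by ring
  have h3 : W t ≤ Real.exp (-β * (t - t₀)) ^ 2 * ((‖T'‖ + 1) * ‖y t₀‖ ^ 2) := by
    have e : Real.exp (-β * (t - t₀)) ^ 2 * Real.exp (2 * β * (t - t₀)) = 1 := by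
      rw [← Real.exp_nat_mul, ← Real.exp_add]
      norm_num
      ring
    calc W t = Real.exp (-β * (t - t₀)) ^ 2 * (Real.exp (2 * β * (t - t₀)) * W t) := by
          rw [← mul_assoc, e, one_mul]
      _ ≤ _ := mul_le_mul_of_nonneg_left (h1.trans h2) (by positivity)
  have h4 : ‖T' (y t)‖ ≤
      Real.sqrt ((‖T'‖ + 1) / c) * (Real.exp (-β * (t - t₀)) * ‖y t₀‖) := by
    refine le_of_sq_le_sq ?_ (by positivity)
    rw [mul_pow, Real.sq_sqrt (by positivity), div_mul_eq_mul_div, le_div_iff₀ hc]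
    have := hleW t
    nlinarith
  calc ‖y t‖ = ‖T (T' (y t))‖ := by rw [(hTT' _).1]
    _ ≤ ‖T‖ * ‖T' (y t)‖ := T.le_opNorm _
    _ ≤ M * (Real.sqrt ((‖T'‖ + 1) / c) * (Real.exp (-β * (t - t₀)) * ‖y t₀‖)) := by
        gcongr; simp [M]
    _ = _ := by ring

end Lyapunov

/-! ### Segments of a differentiable function as a curve in `L²` -/

section Segments

theorem memLp_translate {f : ℝ → ℝ} (hf : Continuous f) (r t : ℝ) :
    MemLp (fun s => f (t + s)) 2 (lebIcc r) :=
  memLp_of_continuousOn (by fun_prop)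

/-- The segment `s ↦ f (t + s)` in `L²([-r, 0])`. -/
def seg {f : ℝ → ℝ} (hf : Continuous f) (r t : ℝ) : Lp ℝ 2 (lebIcc r) :=
  (memLp_translate hf r t).toLp _

theorem coeFn_seg {f : ℝ → ℝ} (hf : Continuous f) (r t : ℝ) :
    seg hf r t =ᵐ[lebIcc r] fun s => f (t + s) := (memLp_translate hf r t).coeFn_toLp

theorem norm_seg_le {f : ℝ → ℝ} (hf : Continuous f) {r t B : ℝ} (hB : 0 ≤ B)
    (h : ∀ s ∈ Icc (-r) 0, |f (t + s)| ≤ B) : ‖seg hf r t‖ ≤ lebNorm r * B := by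
  refine Lp.norm_le_of_ae_bound hB ?_
  filter_upwards [coeFn_seg hf r t, ae_restrict_mem measurableSet_Icc] with s h1 h2
  rw [h1]
  exact h s h2

/-- The difference quotients converge uniformly in `s`, by the mean value inequality and uniform
continuity of `f'` on a compact interval, and uniform convergence implies `L²` convergence. The
condition `r < t` keeps every point `t + s` at positive times, where `f` is differentiable. -/
theorem hasDerivAt_seg {f f' : ℝ → ℝ} (hf : Continuous f) (hf' : Continuous f')
    (hd : ∀ u, 0 < u → HasDerivAt f (f' u) u) {r t : ℝ} (ht : r < t) :
    HasDerivAt (seg hf r) (seg hf' r t) t := by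
  rw [hasDerivAt_iff_isLittleO_nhds_zero, Asymptotics.isLittleO_iff]
  intro c hc
  let c' := c / (lebNorm r + 1)
  have hl := lebNorm_nonneg r
  have hc' : 0 < c' := by positivity
  -- The window `[t - r, t]` widened by `t - r` on both sides; its left end is `0`, and increments
  -- `|h| < t - r` stay inside.
  have huc := (isCompact_Icc (a := t - r - (t - r)) (b := t + (t - r))).uniformContinuousOn_of_continuous
    hf'.continuousOn
  obtain ⟨δ, hδ, hδ'⟩ := Metric.uniformContinuousOn_iff_le.1 huc c' hc'
  have hev : ∀ᶠ h in nhds (0 : ℝ), |h| < min δ (t - r) := by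
    have := Metric.ball_mem_nhds (0 : ℝ) (lt_min hδ (sub_pos.2 ht))
    filter_upwards [this] with h hh
    simpa using hh
  filter_upwards [hev] with h hh
  have hh1 := hh.trans_le (min_le_left _ _)
  have hh2 := hh.trans_le (min_le_right _ _)
  have key : ∀ s ∈ Icc (-r) 0, |f (t + h + s) - f (t + s) - h * f' (t + s)| ≤ c' * |h| := by
    intro s hs
    have hmem : ∀ v ∈ uIcc (t + s) (t + h + s), 0 < v ∧ |v - (t + s)| ≤ |h| := by
      intro v hv
      have h1 := Set.abs_sub_left_of_mem_uIcc hv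
      have e : t + h + s - (t + s) = h := by ring
      rw [e] at h1
      refine ⟨?_, h1⟩
      have h2 := (abs_le.1 (h1.trans hh2.le)).1
      have h3 := (abs_lt.1 (h1.trans_lt hh2)).1
      linarith [hs.1]
    have hs' : |h| ≤ t - r := hh2.le
    -- The mean value inequality is applied to `f` minus its linear part at `t + s`, whose
    -- derivative is the oscillation of `f'`.
    have := (convex_uIcc (t + s) (t + h + s)).norm_image_sub_le_of_norm_hasDerivWithin_le
      (f := fun v => f v - v * f' (t + s)) (f' := fun v => f' v - 1 * f' (t + s)) (C := c')
      (fun v hv => ((hd v (hmem v hv).1).sub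
        ((hasDerivAt_id v).mul_const _)).hasDerivWithinAt)
      (fun v hv => by
        have h1 := hmem v hv
        have h2 := abs_le.1 h1.2
        have h4 := abs_le.1 hs'
        rw [one_mul, ← dist_eq_norm]
        refine hδ' _ ⟨?_, ?_⟩ _ ⟨?_, ?_⟩ ?_
        · linarith [h1.1]
        · linarith [hs.2]
        · linarith [hs.1, hs.2]
        · linarith [hs.1, hs.2]
        · rw [Real.dist_eq]; exact h1.2.trans hh1.le)
      left_mem_uIcc right_mem_uIcc
    have e1 : t + h + s - (t + s) = h := by ring
    rw [Real.norm_eq_abs, Real.norm_eq_abs, e1] at this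
    convert! this using 2
    ring
  have hb : ‖seg hf r (t + h) - seg hf r t - h • seg hf' r t‖ ≤ lebNorm r * (c' * |h|) := by
    refine Lp.norm_le_of_ae_bound (by positivity) ?_
    filter_upwards [coeFn_seg hf r (t + h), coeFn_seg hf r t, coeFn_seg hf' r t,
      Lp.coeFn_sub (seg hf r (t + h) - seg hf r t) (h • seg hf' r t),
      Lp.coeFn_sub (seg hf r (t + h)) (seg hf r t), Lp.coeFn_smul h (seg hf' r t),
      ae_restrict_mem measurableSet_Icc] with s h1 h2 h3 h4 h5 h6 hs
    rw [h4, Pi.sub_apply, h5, Pi.sub_apply, h6, Pi.smul_apply, h1, h2, h3]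
    exact key s hs
  refine hb.trans ?_
  rw [Real.norm_eq_abs, ← mul_assoc]
  refine mul_le_mul_of_nonneg_right ?_ (abs_nonneg h)
  simp only [c']
  rw [mul_div_assoc', div_le_iff₀ (by positivity)]
  nlinarith

end Segments


/-! ### Growth of solutions and the state curve -/

section Solutions

/-- A Gronwall bound by a weighted maximum: let `m` be the maximum of `exp(-2Ls) ‖x(s)‖`, attained
at `u`. If `u ≤ 0`, the initial data bound `m`. Otherwise `‖x'(s)‖ ≤ L m exp(2Ls)` integrates to
`‖x(u)‖ ≤ B + (m/2) exp(2Lu)`; since `‖x(u)‖ = m exp(2Lu)`, half of it is absorbed. The rate `2L` is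
chosen to produce that factor one half. -/
theorem norm_le_of_delay_bound {E : Type*} [NormedAddCommGroup E] [NormedSpace ℝ E] {r L B : ℝ}
    (hr : 0 ≤ r) (hL : 0 < L) {x x' : ℝ → E} (hx : Continuous x)
    (hB : ∀ s ∈ Icc (-r) 0, ‖x s‖ ≤ B)
    (hd : ∀ t, 0 ≤ t → HasDerivWithinAt x (x' t) (Ici t) t)
    (hb : ∀ t, 0 ≤ t → ∀ m, (∀ s ∈ Icc (-r) t, ‖x s‖ ≤ m) → ‖x' t‖ ≤ L * m) (t : ℝ) (ht : 0 ≤ t) :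
    ‖x t‖ ≤ 2 * Real.exp (2 * L * (t + r)) * B := by
  have hB0 : 0 ≤ B := (norm_nonneg _).trans (hB 0 ⟨by linarith, le_rfl⟩)
  obtain ⟨u, hu, hmax⟩ := (isCompact_Icc (a := -r) (b := t)).exists_isMaxOn
    ⟨t, ⟨by linarith, le_rfl⟩⟩
    (f := fun s => Real.exp (-(2 * L * s)) * ‖x s‖) (by fun_prop)
  let m := Real.exp (-(2 * L * u)) * ‖x u‖
  have hm0 : 0 ≤ m := by positivity
  have hm : ∀ s ∈ Icc (-r) t, ‖x s‖ ≤ m * Real.exp (2 * L * s) := fun s hs => by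
    have h1 : Real.exp (-(2 * L * s)) * ‖x s‖ ≤ m := hmax hs
    rw [Real.exp_neg, inv_mul_le_iff₀ (Real.exp_pos _)] at h1
    linarith
  have hxu : ‖x u‖ = m * Real.exp (2 * L * u) := by
    simp only [m]
    rw [mul_right_comm, ← Real.exp_add, neg_add_cancel, Real.exp_zero, one_mul]
  have hexp : 1 ≤ Real.exp (2 * L * r) := Real.one_le_exp (by positivity)
  have hmB : m ≤ 2 * Real.exp (2 * L * r) * B := by
    rcases le_or_gt u 0 with hu0 | hu0
    · calc m ≤ Real.exp (2 * L * r) * B := by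
            simp only [m]
            gcongr
            · nlinarith [hu.1]
            · exact hB u ⟨hu.1, hu0⟩
        _ ≤ _ := by nlinarith [mul_nonneg (Real.exp_pos (2 * L * r)).le hB0]
    · have h1 := image_norm_le_of_norm_deriv_right_le_deriv_boundary (a := 0) (b := u) (f := x)
        (f' := x') hx.continuousOn (fun s hs => hd s hs.1)
        (B := fun s => B + m / 2 * Real.exp (2 * L * s))
        (B' := fun s => m / 2 * (Real.exp (2 * L * s) * (2 * L)))
        (by
          have := hB 0 ⟨by linarith, le_rfl⟩
          have h2 : 0 ≤ m / 2 * Real.exp (2 * L * 0) := by positivity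
          linarith)
        (fun s => by
          have h2 : HasDerivAt (fun s => 2 * L * s) (2 * L) s := by
            simpa using (hasDerivAt_id s).const_mul (2 * L)
          exact (h2.exp.const_mul (m / 2)).const_add B)
        (fun s hs => by
          refine (hb s hs.1 (m * Real.exp (2 * L * s)) fun v hv => ?_).trans_eq (by ring)
          refine (hm v ⟨hv.1, hv.2.trans (hs.2.le.trans hu.2)⟩).trans ?_
          gcongr
          exact hv.2)
        (right_mem_Icc.2 hu0.le)
      have h2 : 1 ≤ Real.exp (2 * L * u) := Real.one_le_exp (by positivity)
      have h1' : ‖x u‖ ≤ B + m / 2 * Real.exp (2 * L * u) := h1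
      rw [hxu] at h1'
      have h3 : m ≤ 2 * B := by nlinarith
      nlinarith
  calc ‖x t‖ ≤ m * Real.exp (2 * L * t) := hm t ⟨by linarith, le_rfl⟩
    _ ≤ 2 * Real.exp (2 * L * r) * B * Real.exp (2 * L * t) := by gcongr
    _ = 2 * Real.exp (2 * L * (t + r)) * B := by
      rw [mul_add, Real.exp_add]; ring

variable {n K : ℕ} {τ : Fin (K + 1) → ℝ}

/-- Freezing `x` to the left of `-τ_K` makes the curve and the right-hand side continuous on the
whole line, so segments exist at every time. The function `X'` is defined by the delay equation and
is a derivative of `X` only for `t ≥ 0`. -/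
theorem IsSolution.exists_extension (hr : 0 ≤ τ (Fin.last K)) {A₀ : Matrix (Fin n) (Fin n) ℝ}
    {A : Fin K → Matrix (Fin n) (Fin n) ℝ}
    (hle : ∀ i, τ i ≤ τ (Fin.last K))
    {φ : C(Icc (-τ (Fin.last K)) (0 : ℝ), EuclideanSpace ℝ (Fin n))}
    {x : ℝ → EuclideanSpace ℝ (Fin n)} (hx : IsSolution τ A₀ A φ x) :
    ∃ X X' : ℝ → EuclideanSpace ℝ (Fin n), Continuous X ∧ Continuous X' ∧
      (∀ t, -τ (Fin.last K) ≤ t → X t = x t) ∧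
      (∀ t, (X' t).ofLp = A₀ *ᵥ (X t).ofLp + ∑ i : Fin K, A i *ᵥ (X (t - τ i.succ)).ofLp) ∧
      ∀ t, 0 ≤ t → HasDerivWithinAt X (X' t) (Ici 0) t := by
  obtain ⟨hc, -, hd⟩ := hx
  let X : ℝ → EuclideanSpace ℝ (Fin n) := fun t => x (max t (-τ (Fin.last K)))
  have hX : ∀ t, -τ (Fin.last K) ≤ t → X t = x t := fun t ht => by simp only [X, max_eq_left ht]
  have hXc : Continuous X := hc.comp_continuous (by fun_prop) fun t => mem_Ici.2 (le_max_right _ _)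
  have hXc' : Continuous fun t => (X t).ofLp := (PiLp.continuous_ofLp 2 _).comp hXc
  refine ⟨X, fun t => WithLp.toLp 2 (A₀ *ᵥ (X t).ofLp + ∑ i : Fin K, A i *ᵥ (X (t - τ i.succ)).ofLp),
    hXc, ?_, hX, fun t => rfl, fun t ht => ?_⟩
  · refine (PiLp.continuous_toLp 2 _).comp ?_
    refine Continuous.add (Continuous.matrix_mulVec continuous_const hXc')
      (continuous_finsetSum _ fun i _ => Continuous.matrix_mulVec continuous_const
        (hXc'.comp (continuous_sub_right _)))
  · have h := hd t ht
    have e : ∀ i : Fin K, X (t - τ i.succ) = x (t - τ i.succ) := fun i =>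
      hX _ (by linarith [hle i.succ])
    simp only [e, hX t (by linarith)]
    exact h.congr (fun s hs => hX s (by linarith [mem_Ici.1 hs])) (hX t (by linarith))

theorem exists_norm_deriv_le (A₀ : Matrix (Fin n) (Fin n) ℝ) (A : Fin K → Matrix (Fin n) (Fin n) ℝ) :
    ∃ L : ℝ, 0 < L ∧ ∀ (m : ℝ) (v v' : EuclideanSpace ℝ (Fin n))
      (u : Fin K → EuclideanSpace ℝ (Fin n)), ‖v‖ ≤ m → (∀ i, ‖u i‖ ≤ m) →
      v'.ofLp = A₀ *ᵥ v.ofLp + ∑ i, A i *ᵥ (u i).ofLp → ‖v'‖ ≤ L * m := by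
  refine ⟨‖Matrix.toEuclideanCLM (𝕜 := ℝ) A₀‖ + ∑ i, ‖Matrix.toEuclideanCLM (𝕜 := ℝ) (A i)‖ + 1,
    by positivity, fun m v v' u hv hu h => ?_⟩
  have hm : 0 ≤ m := (norm_nonneg v).trans hv
  have e : v' = Matrix.toEuclideanCLM (𝕜 := ℝ) A₀ v +
      ∑ i, Matrix.toEuclideanCLM (𝕜 := ℝ) (A i) (u i) := by
    ext a
    rw [h]
    simp
  rw [e]
  calc _ ≤ ‖Matrix.toEuclideanCLM (𝕜 := ℝ) A₀ v‖ +
        ∑ i, ‖Matrix.toEuclideanCLM (𝕜 := ℝ) (A i) (u i)‖ :=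
        (norm_add_le _ _).trans (by gcongr; exact norm_sum_le _ _)
    _ ≤ ‖Matrix.toEuclideanCLM (𝕜 := ℝ) A₀‖ * m +
        ∑ i, ‖Matrix.toEuclideanCLM (𝕜 := ℝ) (A i)‖ * m := by
        gcongr with i
        · exact ContinuousLinearMap.le_opNorm_of_le _ hv
        · exact ContinuousLinearMap.le_opNorm_of_le _ (hu i)
    _ ≤ _ := by rw [← Finset.sum_mul, ← add_mul]; nlinarith

/-- Assemble a state from a vector and scalar `L²` functions. -/
def State.mkL : ((Fin n → ℝ) × ∀ p : Fin K × Fin n, Lp ℝ 2 (lebIcc (τ p.1.succ))) →L[ℝ] State n τ :=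
  (WithLp.prodContinuousLinearEquiv 2 ℝ _ _).symm.toContinuousLinearMap ∘L
    (((PiLp.continuousLinearEquiv 2 ℝ _).symm.toContinuousLinearMap ∘L
      ContinuousLinearMap.fst ℝ _ _).prod
    ((PiLp.continuousLinearEquiv 2 ℝ _).symm.toContinuousLinearMap ∘L
      ContinuousLinearMap.snd ℝ _ _))

theorem continuous_coord {X : ℝ → EuclideanSpace ℝ (Fin n)} (hX : Continuous X) (a : Fin n) :
    Continuous fun t => X t a := (EuclideanSpace.proj (𝕜 := ℝ) a).continuous.comp hX

/-- The state `(τ_K x(t), x(t + ·))` of a curve at time `t`. -/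
def segState (τ : Fin (K + 1) → ℝ) {X : ℝ → EuclideanSpace ℝ (Fin n)} (hX : Continuous X) (t : ℝ) :
    State n τ :=
  State.mkL (fun a => τ (Fin.last K) * X t a, fun p => seg (continuous_coord hX p.2) (τ p.1.succ) t)

theorem segState_fst {X : ℝ → EuclideanSpace ℝ (Fin n)} (hX : Continuous X) (t : ℝ) :
    (segState τ hX t).fst.ofLp = τ (Fin.last K) • (X t).ofLp := rfl

theorem segState_fn {X : ℝ → EuclideanSpace ℝ (Fin n)} (hX : Continuous X) (t : ℝ) (i : Fin K) :
    ∀ᵐ s ∂(lebIcc (τ i.succ)), (segState τ hX t).fn i s = (X (t + s)).ofLp := by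
  filter_upwards [ae_all_iff.2 fun a => coeFn_seg (continuous_coord hX a) (τ i.succ) t] with s hs
  ext a
  exact hs a

theorem hasDerivAt_segState (h0 : τ 0 = 0) (hτ : StrictMono τ)
    {X X' : ℝ → EuclideanSpace ℝ (Fin n)} (hX : Continuous X) (hX' : Continuous X')
    (hd : ∀ u, 0 < u → HasDerivAt X (X' u) u) {t : ℝ} (ht : τ (Fin.last K) < t) :
    HasDerivAt (segState τ hX) (segState τ hX' t) t := by
  have hd' : ∀ a u, 0 < u → HasDerivAt (fun t => X t a) (X' u a) u := fun a u hu =>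
    (EuclideanSpace.proj (𝕜 := ℝ) a).hasFDerivAt.comp_hasDerivAt u (hd u hu)
  have ht0 : 0 < t := (delay_nonneg h0 hτ _).trans_lt ht
  refine (State.mkL (n := n) (τ := τ)).hasFDerivAt.comp_hasDerivAt t (HasDerivAt.prodMk ?_ ?_)
  · exact hasDerivAt_pi.2 fun a => (hd' a t ht0).const_mul _
  · exact hasDerivAt_pi.2 fun p => hasDerivAt_seg _ _ (hd' p.2)
      ((hτ.monotone (Fin.le_last _)).trans_lt ht)

theorem norm_le_norm_segState {X : ℝ → EuclideanSpace ℝ (Fin n)} (hX : Continuous X)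
    (hr : 0 ≤ τ (Fin.last K)) (t : ℝ) : τ (Fin.last K) * ‖X t‖ ≤ ‖segState τ hX t‖ := by
  have h := WithLp.norm_fst_le _ (segState τ hX t)
  have e : (segState τ hX t).fst = τ (Fin.last K) • X t := by
    ext a; rfl
  rwa [e, norm_smul, Real.norm_of_nonneg hr] at h

/-- The constant does not depend on the curve, as the uniformity over all solutions requires. -/
theorem exists_norm_segState_le (h0 : τ 0 = 0) (hτ : StrictMono τ) : ∃ D : ℝ, 0 < D ∧
    ∀ (X : ℝ → EuclideanSpace ℝ (Fin n)) (hX : Continuous X) (t M : ℝ),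
      (∀ s ∈ Icc (t - τ (Fin.last K)) t, ‖X s‖ ≤ M) → ‖segState τ hX t‖ ≤ D * M := by
  have hr := delay_nonneg h0 hτ (Fin.last K)
  let D := τ (Fin.last K) + ∑ i : Fin K, lebNorm (τ i.succ)
  have hD : 0 ≤ D := add_nonneg hr (Finset.sum_nonneg fun i _ => lebNorm_nonneg _)
  refine ⟨‖State.mkL (n := n) (τ := τ)‖ * D + 1, by positivity, fun X hX t M hM => ?_⟩
  have hM0 : 0 ≤ M := (norm_nonneg _).trans (hM t ⟨by linarith, le_rfl⟩)
  have hc : ∀ s ∈ Icc (t - τ (Fin.last K)) t, ∀ a, |X s a| ≤ M := fun s hs a =>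
    (PiLp.norm_apply_le (X s) a).trans (hM s hs)
  have hq : ‖((fun a => τ (Fin.last K) * X t a,
      fun p => seg (continuous_coord hX p.2) (τ p.1.succ) t) :
      (Fin n → ℝ) × ∀ p : Fin K × Fin n, Lp ℝ 2 (lebIcc (τ p.1.succ)))‖ ≤ D * M := by
    refine max_le ?_ ?_
    · refine (pi_norm_le_iff_of_nonneg (by positivity)).2 fun a => ?_
      rw [norm_mul, Real.norm_of_nonneg hr]
      refine mul_le_mul ?_ (hc t ⟨by linarith, le_rfl⟩ a) (norm_nonneg _) hD
      exact le_add_of_nonneg_right (Finset.sum_nonneg fun i _ => lebNorm_nonneg _)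
    · refine (pi_norm_le_iff_of_nonneg (by positivity)).2 fun p => ?_
      refine (norm_seg_le _ hM0 fun s hs => hc _ ⟨?_, ?_⟩ p.2).trans ?_
      · linarith [hs.1, hτ.monotone (Fin.le_last p.1.succ)]
      · linarith [hs.2]
      · refine mul_le_mul_of_nonneg_right ?_ hM0
        exact (Finset.single_le_sum (f := fun i : Fin K => lebNorm (τ i.succ))
          (fun i _ => lebNorm_nonneg _) (Finset.mem_univ p.1)).trans (le_add_of_nonneg_left hr)
  calc ‖segState τ hX t‖ ≤ ‖State.mkL (n := n) (τ := τ)‖ * (D * M) :=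
        ContinuousLinearMap.le_opNorm_of_le _ hq
    _ ≤ (‖State.mkL (n := n) (τ := τ)‖ * D + 1) * M := by linarith

end Solutions

end DelayLMI
end

/-! ### Assembly of the stability theorem -/

theorem mainTheorem4 {n K : ℕ} (hK : 1 ≤ K)
    -- the delays `0 = τ₀ < τ₁ < ⋯ < τ_K` and the system matrices
    (τ : Fin (K + 1) → ℝ) (hτ_zero : τ 0 = 0) (hτ : StrictMono τ)
    (A₀ : Matrix (Fin n) (Fin n) ℝ) (A : Fin K → Matrix (Fin n) (Fin n) ℝ)
    -- the decision variables, with the weak derivatives of `Q`, `S`, `R`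
    (d : ℕ) (ε : ℝ) (hε : 0 < ε) (P : Matrix (Fin n) (Fin n) ℝ)
    (Q Q' S S' : Fin K → ℝ → Matrix (Fin n) (Fin n) ℝ)
    (R R₁ R₂ : Fin K → Fin K → ℝ → ℝ → Matrix (Fin n) (Fin n) ℝ)
    (hQ : ∀ i, DelayLMI.MemW2Interval (τ i.succ) (Q i) (Q' i))
    (hS : ∀ i, DelayLMI.MemW2Interval (τ i.succ) (S i) (S' i))
    (hR : ∀ i j, DelayLMI.MemW2Rect (τ i.succ) (τ j.succ) (R i j) (R₁ i j) (R₂ i j))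
    -- the spacing pairs
    (F₁ : ℝ → Matrix (Fin n ⊕ Fin n) (Fin n ⊕ Fin n) ℝ)
    (H₁ : ℝ → ℝ → Matrix (Fin n ⊕ Fin n) (Fin n ⊕ Fin n) ℝ)
    (hFH₁ : DelayLMI.MemTheta (τ (Fin.last K)) F₁ H₁)
    (F₂ : ℝ → Matrix ((Fin n ⊕ Fin n × Fin K) ⊕ Fin n) ((Fin n ⊕ Fin n × Fin K) ⊕ Fin n) ℝ)
    (H₂ : ℝ → ℝ →
      Matrix ((Fin n ⊕ Fin n × Fin K) ⊕ Fin n) ((Fin n ⊕ Fin n × Fin K) ⊕ Fin n) ℝ)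
    (hFH₂ : DelayLMI.MemTheta (τ (Fin.last K)) F₂ H₂)
    -- the two sum-of-squares constraints
    (hMN : DelayLMI.MemXi τ d (DelayLMI.Mfun τ ε P Q S F₁) (DelayLMI.Nfun τ R H₁))
    (hDE : DelayLMI.MemXi τ d
      (fun s => -DelayLMI.Dfun τ A₀ A ε P Q Q' S S' R F₂ s)
      (fun s θ => -DelayLMI.Efun τ R₁ R₂ H₂ s θ))
    -- symmetry and coupling constraints
    (hP : ∀ i, P = τ (Fin.last K) • (Q i 0)ᵀ + τ (Fin.last K) • S i 0)
    (hSsymm : ∀ i, ∀ s ∈ Set.Icc (-τ i.succ) 0, S i s = (S i s)ᵀ)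
    (hRsymm : ∀ i j, ∀ s ∈ Set.Icc (-τ i.succ) 0, ∀ θ ∈ Set.Icc (-τ j.succ) 0,
      R i j s θ = (R j i θ s)ᵀ)
    (hQR : ∀ i j, ∀ s ∈ Set.Icc (-τ j.succ) 0, Q j s = R i j 0 s) :
    DelayLMI.ExponentiallyStable τ A₀ A := by
  have hc := DelayLMI.delay_last_pos hK hτ_zero hτ
  have hle : ∀ i, τ i ≤ τ (Fin.last K) := fun i => hτ.monotone (Fin.le_last i)
  have hQc := fun i a b => (hQ i a b).1
  have hSc := fun i a b => (hS i a b).1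
  have hRc := fun i j a b => (hR i j a b).1
  -- `P` is not assumed symmetric: `Qᵢ(0) = Rᵢᵢ(0, 0)` is symmetric, and so is `Sᵢ(0)`. Since `K ≥
  -- 1`, some index is available.
  have hPsymm : Pᵀ = P := by
    have i₀ : Fin K := ⟨0, hK⟩
    have hm : (0 : ℝ) ∈ Set.Icc (-τ i₀.succ) 0 :=
      ⟨neg_nonpos.2 (DelayLMI.delay_nonneg hτ_zero hτ _), le_rfl⟩
    have h1 : (Q i₀ 0)ᵀ = Q i₀ 0 := by
      rw [hQR i₀ i₀ 0 hm]
      exact (hRsymm i₀ i₀ 0 hm 0 hm).symm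
    rw [hP i₀, Matrix.transpose_add, Matrix.transpose_smul, Matrix.transpose_smul,
      ← hSsymm i₀ 0 hm, h1, h1]
  obtain ⟨T, hT⟩ := DelayLMI.exists_isStateOp (P := P) hQc hSc hRc
  have hcε : 0 < ε * τ (Fin.last K) := mul_pos hε hc
  have hcoer : ∀ z, ε * τ (Fin.last K) * inner ℝ z z ≤ inner ℝ z (T z) := fun z => by
    rw [hT.inner_self hQc hSc hRc, DelayLMI.State.inner_eq]
    exact DelayLMI.le_L1val_of_memXi hK hτ_zero hτ hε hQc hSc hRc hFH₁ hMN _ z.memLp_fn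
  obtain ⟨T', hTT'⟩ := DelayLMI.exists_inverse_of_coercive T hcε hcoer
  obtain ⟨C, hC, β, hβ, hdecay⟩ := DelayLMI.exists_exp_decay hTT'
    (hT.inner_comm hQc hSc hRc hPsymm hSsymm hRsymm) hcε (half_pos hcε) hcoer
  obtain ⟨L, hL, hLb⟩ := DelayLMI.exists_norm_deriv_le A₀ A
  obtain ⟨D, hD, hDb⟩ := DelayLMI.exists_norm_segState_le (n := n) hτ_zero hτ
  -- Any time beyond `τ_K` would do: from there on the state curve is differentiable.
  let t₀ : ℝ := τ (Fin.last K) + 1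
  let B : ℝ := 2 * Real.exp (2 * L * (t₀ + τ (Fin.last K)))
  have hB : 0 < B := by positivity
  -- The first summand covers `t ≤ t₀` by the growth bound, the second covers `t ≥ t₀` by the
  -- Lyapunov decay; the factor `exp(β t₀)` restarts the decay at time `0`.
  refine ⟨B * Real.exp (β * t₀) + (τ (Fin.last K))⁻¹ * (C * (D * B)) * Real.exp (β * t₀),
    by positivity, β, hβ, fun φ x hx t ht => ?_⟩
  obtain ⟨X, X', hX, hX', hXx, hXX', hXd⟩ := hx.exists_extension hc.le hle
  have hgrowth : ∀ s, 0 ≤ s → s ≤ t₀ → ‖X s‖ ≤ B * ‖φ‖ := by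
    intro s hs hs'
    refine (DelayLMI.norm_le_of_delay_bound (B := ‖φ‖) hc.le hL hX (fun u hu => ?_)
      (fun u hu => (hXd u hu).mono (Set.Ici_subset_Ici.2 hu)) (fun u hu m hm => ?_) s hs).trans ?_
    · rw [hXx u hu.1, hx.2.1 ⟨u, hu⟩]
      exact φ.norm_coe_le_norm _
    · refine hLb m (X u) (X' u) (fun i => X (u - τ i.succ)) (hm u ⟨by linarith, le_rfl⟩)
        (fun i => hm _ ⟨by linarith [hle i.succ], ?_⟩) (hXX' u)
      linarith [DelayLMI.delay_nonneg hτ_zero hτ i.succ]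
    · simp only [B]
      gcongr
  have hexp : Real.exp (β * t₀) * Real.exp (-β * t) = Real.exp (-β * (t - t₀)) := by
    rw [← Real.exp_add]
    congr 1
    ring
  rw [← hXx t (by linarith), add_mul, add_mul, mul_assoc B, mul_assoc _ (Real.exp (β * t₀)), hexp]
  rcases le_total t t₀ with htt | htt
  · have h1 : 1 ≤ Real.exp (-β * (t - t₀)) := Real.one_le_exp (by nlinarith)
    refine (hgrowth t ht htt).trans (le_add_of_le_of_nonneg ?_ (by positivity))
    gcongr
    exact le_mul_of_one_le_right hB.le h1
  · have hXd' : ∀ u, 0 < u → HasDerivAt X (X' u) u := fun u hu =>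
      (hXd u hu.le).hasDerivAt (Ici_mem_nhds hu)
    -- At each time `u ≥ t₀` the dissipation inequality is applied with `z = T' y(u)` and with `η`
    -- the solution shifted by `u`, so that time `u` becomes `0`.
    have h1 := hdecay (DelayLMI.segState τ hX) (DelayLMI.segState τ hX') t₀
      (fun u hu => DelayLMI.hasDerivAt_segState hτ_zero hτ hX hX' hXd' (by linarith))
      (fun u hu => by
        refine DelayLMI.inner_le_of_memXi hK hτ_zero hτ hε hQ hS hR hFH₁ hFH₂ hMN hDE hP hSsymm
          hRsymm hQR hT (η := fun s => (X (u + s)).ofLp) (η' := fun s => (X' (u + s)).ofLp)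
          (fun a s hs => ?_) (fun a => ?_) ?_ ?_ (fun i => ?_) ?_ (fun i => ?_)
        · have h2 : HasDerivAt (fun t => X t a) (X' (u + s) a) (u + s) :=
            (EuclideanSpace.proj (𝕜 := ℝ) a).hasFDerivAt.comp_hasDerivAt (u + s)
              (hXd' _ (by linarith [hs.1]))
          exact h2.comp_const_add u s
        · exact ((DelayLMI.continuous_coord hX' a).comp (continuous_const_add u)).continuousOn
        · simp only [add_zero, hXX' u, sub_eq_add_neg]
        · rw [(hTT' _).1, DelayLMI.segState_fst, add_zero]
        · rw [(hTT' _).1]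
          exact DelayLMI.segState_fn hX u i
        · rw [DelayLMI.segState_fst, add_zero]
        · exact DelayLMI.segState_fn hX' u i) t htt
    have h2 : ‖DelayLMI.segState τ hX t₀‖ ≤ D * (B * ‖φ‖) :=
      hDb X hX t₀ _ fun s hs => hgrowth s (by linarith [hs.1]) hs.2
    have h3 := (DelayLMI.norm_le_norm_segState hX hc.le t).trans h1
    have h4 : ‖X t‖ ≤ (τ (Fin.last K))⁻¹ *
        (C * Real.exp (-β * (t - t₀)) * (D * (B * ‖φ‖))) := by
      rw [← div_eq_inv_mul, le_div_iff₀ hc, mul_comm]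
      exact h3.trans (by gcongr)
    refine h4.trans (le_add_of_nonneg_of_le (by positivity) (le_of_eq ?_))
    ring
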